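/- Let $n\ge 3$ and let $M$ be a smooth manifold of dimension $n$. A \emph{Goursat structure} on $M$ is a smooth rank two distribution $\mathcal D\subset TM$ whose derived flag, defined by $\mathcal D^{(0)}=\mathcal D$ and $\mathcal D^{(i+1)}=\mathcal D^{(i)}+[\mathcal D^{(i)},\mathcal D^{(i)}]$, satisfies $\dim\mathcal D^{(i)}(p)=i+2$ for all $0\le i\le n-2$ and all $p\in M$. A \emph{Kumpera–Ruiz normal form} on $\mathbb R^n$ is a pair of vector fields of the form $\kappa^n=\sigma_{n-3}\circ\cdots\circ\sigma_1(\kappa^3)$, where $\kappa^3=\bigl(\tfrac{\partial}{\partial x_3},\;x_3\tfrac{\partial}{\partial x_2}+\tfrac{\partial}{\partial x_1}\bigr)$ is the Pfaff–Darboux form on $\mathbb R^3$ and each $\sigma_i$ is either a regular prolongation $R_c$ with some parameter $c\in\mathbb R$ (which may depend on $i$), or the singular prolongation $S$. For a pair $(\kappa_1,\kappa_2)$ of vector fields on $\mathbb R^{m-1}$, lifted to $\mathbb R^m$ by translation along the $x_m$-direction, these are $$R_c(\kappa_1,\kappa_2)=\bigl(\tfrac{\partial}{\partial x_m},\;(x_m+c)\kappa_1+\kappa_2\bigr),\qquad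 S(\kappa_1,\kappa_2)=\bigl(\tfrac{\partial}{\partial x_m},\;\kappa_1+x_m\kappa_2\bigr).$$ \textbf{Theorem.} Let $\mathcal D$ be a Goursat structure on $M$ and let $p\in M$. Then there exist a Kumpera–Ruiz normal form $(\kappa_1,\kappa_2)$ on $\mathbb R^n$, an open neighbourhood $V$ of $p$ in $M$, an open neighbourhood $U$ of $0$ in $\mathbb R^n$ and a smooth diffeomorphism $\varphi:V\to U$ with $\varphi(p)=0$ such that $\varphi_*\mathcal D$ is the distribution spanned on $U$ by $\kappa_1$ and $\kappa_2$. -/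

import Mathlib

open scoped Manifold ContDiff Topology

noncomputable section

/-- `ℝⁿ` with its standard smooth structure; the coordinates `x₁, …, xₙ` are `x 0, …, x (n - 1)`. -/
abbrev RSpace (n : ℕ) : Type := EuclideanSpace ℝ (Fin n)

section Distributions

variable {n : ℕ} {M : Type*} [TopologicalSpace M] [ChartedSpace (RSpace n) M]

/-- The vector field `V` is smooth on a neighbourhood of `p`. -/
def SmoothNear [IsManifold (𝓡 n) ∞ M] (V : Π x : M, TangentSpace (𝓡 n) x) (p : M) : Prop :=
  ∀ᶠ x in 𝓝 p, ContMDiffAt (𝓡 n) (𝓡 n).tangent ∞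
    (fun y => (⟨y, V y⟩ : TangentBundle (𝓡 n) M)) x

/-- A field of tangent subspaces is a smooth distribution of rank `k` if near every point it is
spanned by `k` smooth, pointwise linearly independent vector fields. -/
def IsSmoothDistribution [IsManifold (𝓡 n) ∞ M] (k : ℕ)
    (D : Π x : M, Submodule ℝ (TangentSpace (𝓡 n) x)) : Prop :=
  ∀ p : M, ∃ f : Fin k → Π x : M, TangentSpace (𝓡 n) x,
    (∀ i, SmoothNear (f i) p) ∧
    ∀ᶠ x in 𝓝 p, LinearIndependent ℝ (fun i => f i x) ∧
      D x = Submodule.span ℝ (Set.range fun i => f i x)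

/-- The vector fields that are, near `p`, smooth sections of `D`. A local vector field is
represented by an arbitrary extension to all of `M`; only its germ at `p` matters. -/
def localSections [IsManifold (𝓡 n) ∞ M]
    (D : Π x : M, Submodule ℝ (TangentSpace (𝓡 n) x)) (p : M) :
    Submodule ℝ (Π x : M, TangentSpace (𝓡 n) x) where
  carrier := {V | SmoothNear V p ∧ ∀ᶠ x in 𝓝 p, V x ∈ D x}
  add_mem' := by
    rintro V W ⟨hV, hV'⟩ ⟨hW, hW'⟩
    refine ⟨?_, ?_⟩
    · filter_upwards [hV, hW] with x h1 h2
      exact h1.add_section h2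
    · filter_upwards [hV', hW'] with x h1 h2
      exact (D x).add_mem h1 h2
  zero_mem' := by
    refine ⟨Filter.Eventually.of_forall fun x => ?_, Filter.Eventually.of_forall fun x => ?_⟩
    · exact (Bundle.contMDiff_zeroSection ℝ (TangentSpace (𝓡 n) : M → Type _)).contMDiffAt
    · exact (D x).zero_mem
  smul_mem' := by
    rintro c V ⟨hV, hV'⟩
    refine ⟨?_, ?_⟩
    · filter_upwards [hV] with x h1
      exact h1.const_smul_section
    · filter_upwards [hV'] with x h1
      exact (D x).smul_mem c h1

/-- Local sections near `p` of the members of the derived flag: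
`D⁽⁰⁾ = D` and `D⁽ⁱ⁺¹⁾ = D⁽ⁱ⁾ + [D⁽ⁱ⁾, D⁽ⁱ⁾]`. -/
def derivedSections [IsManifold (𝓡 n) ∞ M]
    (D : Π x : M, Submodule ℝ (TangentSpace (𝓡 n) x)) (p : M) :
    ℕ → Submodule ℝ (Π x : M, TangentSpace (𝓡 n) x)
  | 0 => localSections D p
  | i + 1 => derivedSections D p i ⊔
      Submodule.span ℝ {B | ∃ V ∈ derivedSections D p i, ∃ W ∈ derivedSections D p i,
        B = VectorField.mlieBracket (𝓡 n) V W}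

/-- The subspace `D⁽ⁱ⁾(p)` of `T_p M`: the values at `p` of the local sections of `D⁽ⁱ⁾`. -/
def derivedFlag [IsManifold (𝓡 n) ∞ M]
    (D : Π x : M, Submodule ℝ (TangentSpace (𝓡 n) x)) (i : ℕ) (p : M) :
    Submodule ℝ (TangentSpace (𝓡 n) p) :=
  (derivedSections D p i).map (LinearMap.proj p)

/-- A Goursat structure on an `n`-manifold (considered for `n ≥ 3`): a smooth rank two distribution
with `dim D⁽ⁱ⁾(p) = i + 2` for all `0 ≤ i ≤ n - 2` and all points `p`. -/
structure IsGoursat [IsManifold (𝓡 n) ∞ M]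
    (D : Π x : M, Submodule ℝ (TangentSpace (𝓡 n) x)) : Prop where
  smooth : IsSmoothDistribution 2 D
  finrank_derivedFlag : ∀ i : ℕ, i + 2 ≤ n → ∀ p : M,
    Module.finrank ℝ (derivedFlag D i p) = i + 2

/-- `D` at `p` and `D'` at `p'` are locally equivalent: some smooth diffeomorphism `φ` between open
neighbourhoods of `p` and `p'` maps `p` to `p'` and satisfies `φ_* D = D'`. -/
def LocallyEquivalent {M' : Type*} [TopologicalSpace M'] [ChartedSpace (RSpace n) M']
    (D : Π x : M, Submodule ℝ (TangentSpace (𝓡 n) x)) (p : M)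
    (D' : Π x : M', Submodule ℝ (TangentSpace (𝓡 n) x)) (p' : M') : Prop :=
  ∃ φ : OpenPartialHomeomorph M M', p ∈ φ.source ∧ φ p = p' ∧
    ContMDiffOn (𝓡 n) (𝓡 n) ∞ φ φ.source ∧
    ContMDiffOn (𝓡 n) (𝓡 n) ∞ φ.symm φ.target ∧
    ∀ x ∈ φ.source, (D x).map (mfderiv (𝓡 n) (𝓡 n) φ x).toLinearMap = D' (φ x)

end Distributions

/-- A pair of vector fields on `ℝⁿ`. -/
abbrev FieldPair (n : ℕ) : Type := (RSpace n → RSpace n) × (RSpace n → RSpace n)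

/-- The lift of a vector field on `ℝⁿ` to `ℝⁿ⁺¹`, by translation along the last coordinate. -/
def liftField {n : ℕ} (f : RSpace n → RSpace n) : RSpace (n + 1) → RSpace (n + 1) :=
  fun x => WithLp.toLp 2
    (Fin.snoc (α := fun _ => ℝ) (f (WithLp.toLp 2 fun j : Fin n => x j.castSucc)) 0)

/-- The Pfaff-Darboux form `κ³ = (∂/∂x₃, x₃ ∂/∂x₂ + ∂/∂x₁)` on `ℝ³`. -/
def pfaffDarboux : FieldPair 3 :=
  (fun _ => !₂[0, 0, 1], fun x => !₂[1, x 2, 0])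

/-- The regular prolongation `R_c`:
`(κ₁, κ₂) ↦ (∂/∂x_{n+1}, (x_{n+1} + c) κ₁ + κ₂)`. -/
def regularProlongation {n : ℕ} (c : ℝ) (κ : FieldPair n) : FieldPair (n + 1) :=
  (fun _ => EuclideanSpace.single (Fin.last n) 1,
   fun x => (x (Fin.last n) + c) • liftField κ.1 x + liftField κ.2 x)

/-- The singular prolongation `S`: `(κ₁, κ₂) ↦ (∂/∂x_{n+1}, κ₁ + x_{n+1} κ₂)`. -/
def singularProlongation {n : ℕ} (κ : FieldPair n) : FieldPair (n + 1) :=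
  (fun _ => EuclideanSpace.single (Fin.last n) 1,
   fun x => liftField κ.1 x + x (Fin.last n) • liftField κ.2 x)

/-- Kumpera-Ruiz normal forms: the pairs obtained from the Pfaff-Darboux form by finitely many
(possibly no) regular and singular prolongations. -/
inductive IsKumperaRuiz : (n : ℕ) → FieldPair n → Prop
  | base : IsKumperaRuiz 3 pfaffDarboux
  | regular {n : ℕ} {κ : FieldPair n} (c : ℝ) (h : IsKumperaRuiz n κ) :
      IsKumperaRuiz (n + 1) (regularProlongation c κ)
  | singular {n : ℕ} {κ : FieldPair n} (h : IsKumperaRuiz n κ) :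
      IsKumperaRuiz (n + 1) (singularProlongation κ)

/-- The distribution on `ℝⁿ` spanned by a pair of vector fields. -/
def spanDistribution {n : ℕ} (κ : FieldPair n) (x : RSpace n) :
    Submodule ℝ (TangentSpace (𝓡 n) x) :=
  Submodule.span ℝ ({κ.1 x, κ.2 x} : Set (TangentSpace (𝓡 n) x))

end

/-! The proof is an induction on the dimension that undoes one prolongation at a time. Let `X`, `Y`
span `D` near `p`, and put `Z = [X, Y]`. When `n ≥ 4`, `D⁽²⁾` has only one dimension more than `D⁽¹⁾
= span(X, Y, Z)`, so `[X, Z]` and `[Y, Z]` are proportional modulo `D⁽¹⁾`. Hence some nonvanishing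
section `C` of `D` is characteristic: its brackets with `D⁽¹⁾` stay in `D⁽¹⁾`
(`GoursatNear.exists_characteristic`). When `n = 3` any nonvanishing section will do. By the flow
box theorem `C` may be taken to be the last coordinate field (`GoursatNear.exists_straightening`).
Now `D⁽¹⁾` contains this field and is invariant along it, so it is the preimage of a plane field
`D'` in one variable fewer. The flag of `D'` pulls back to the flag of `D` shifted by one
(`flagAt_comap`), so for `n ≥ 4` `D'` is again Goursat (`GoursatNear.exists_quotient`).

By induction `D'` is spanned, in suitable coordinates, by a Kumpera-Ruiz pair `(κ₁, κ₂)`. The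
structure `D` itself is spanned by the last coordinate field and a field `Y` projecting to `u κ₁ + v
κ₂`. As the last coordinate varies, this projected line turns inside the plane `D'`, and it turns
with nonzero speed because `D⁽¹⁾` has rank three. An affine coordinate of the line can therefore
replace the last coordinate. If `v ≠ 0` at the origin, `u / v` minus its value `c` there produces
the regular prolongation `R_c`. If `v = 0` there, `v / u` already vanishes at the origin and
produces `S`. Both cases are instances of `exists_isLocalEquiv_prolongation`, which also yields the
Pfaff-Darboux form on `ℝ³` (`exists_pfaffDarboux`).

Two supports are built along the way: smoothness of local flows, from the inverse function theorem
in a Banach space of curves (`exists_smooth_flow`), and invariance of the derived flag under local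
diffeomorphisms (`IsLocalEquiv.finrank_eq`). -/

noncomputable section

/-! ### Smooth germs, the inverse function theorem and smooth frames -/

section SmoothGerms

variable {E F G : Type*} [NormedAddCommGroup E] [NormedSpace ℝ E] [NormedAddCommGroup F]
  [NormedSpace ℝ F] [NormedAddCommGroup G] [NormedSpace ℝ G]

/-- The map `f` is smooth on a neighbourhood of `p`. -/
def SmoothGerm (f : E → F) (p : E) : Prop := ∀ᶠ x in 𝓝 p, ContDiffAt ℝ ∞ f x

namespace SmoothGerm

variable {f g : E → F} {p : E}

theorem contDiffAt (hf : SmoothGerm f p) : ContDiffAt ℝ ∞ f p := hf.self_of_nhds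

theorem eventually (hf : SmoothGerm f p) : ∀ᶠ q in 𝓝 p, SmoothGerm f q :=
  eventually_eventually_nhds.2 hf

theorem differentiableAt (hf : SmoothGerm f p) : DifferentiableAt ℝ f p :=
  hf.contDiffAt.differentiableAt (by simp)

theorem continuousAt (hf : SmoothGerm f p) : ContinuousAt f p := hf.contDiffAt.continuousAt

theorem congr (hf : SmoothGerm f p) (h : g =ᶠ[𝓝 p] f) : SmoothGerm g p := by
  filter_upwards [hf, h.eventuallyEq_nhds] with x hx hx'
  exact hx.congr_of_eventuallyEq hx'

theorem of_contDiff (hf : ContDiff ℝ ∞ f) : SmoothGerm f p :=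
  Filter.Eventually.of_forall fun _ => hf.contDiffAt

theorem const (c : F) : SmoothGerm (fun _ : E => c) p := of_contDiff contDiff_const

theorem clm (L : E →L[ℝ] F) : SmoothGerm L p := of_contDiff L.contDiff

theorem add (hf : SmoothGerm f p) (hg : SmoothGerm g p) : SmoothGerm (fun x => f x + g x) p := by
  filter_upwards [hf, hg] with x h1 h2 using h1.add h2

theorem sub (hf : SmoothGerm f p) (hg : SmoothGerm g p) : SmoothGerm (fun x => f x - g x) p := by
  filter_upwards [hf, hg] with x h1 h2 using h1.sub h2

theorem neg (hf : SmoothGerm f p) : SmoothGerm (fun x => -f x) p := by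
  filter_upwards [hf] with x h1 using h1.neg

theorem smul {a : E → ℝ} (ha : SmoothGerm a p) (hf : SmoothGerm f p) :
    SmoothGerm (fun x => a x • f x) p := by
  filter_upwards [ha, hf] with x h1 h2 using h1.smul h2

theorem mul {a b : E → ℝ} (ha : SmoothGerm a p) (hb : SmoothGerm b p) :
    SmoothGerm (fun x => a x * b x) p := ha.smul hb

theorem div {a b : E → ℝ} (ha : SmoothGerm a p) (hb : SmoothGerm b p) (h0 : b p ≠ 0) :
    SmoothGerm (fun x => a x / b x) p := by
  filter_upwards [ha, hb, hb.continuousAt.eventually_ne h0] with x h1 h2 h3 using h1.div h2 h3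

theorem sum {ι : Type*} {s : Finset ι} {f : ι → E → F} (hf : ∀ i ∈ s, SmoothGerm (f i) p) :
    SmoothGerm (fun x => ∑ i ∈ s, f i x) p := by
  filter_upwards [(Filter.eventually_all_finset s).2 hf] with x hx
  exact ContDiffAt.sum hx

theorem clm_apply {L : E → F →L[ℝ] G} (hL : SmoothGerm L p) (hf : SmoothGerm f p) :
    SmoothGerm (fun x => L x (f x)) p := by
  filter_upwards [hL, hf] with x h1 h2 using h1.clm_apply h2

theorem comp {h : F → G} (hh : SmoothGerm h (f p)) (hf : SmoothGerm f p) :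
    SmoothGerm (fun x => h (f x)) p := by
  filter_upwards [hf, hf.continuousAt.eventually hh] with x h1 h2 using h2.comp x h1

theorem clm_comp (L : F →L[ℝ] G) (hf : SmoothGerm f p) : SmoothGerm (fun x => L (f x)) p :=
  (clm L).comp hf

protected theorem fderiv (hf : SmoothGerm f p) : SmoothGerm (fderiv ℝ f) p := by
  filter_upwards [hf] with x h1 using h1.fderiv_right (by simp)

protected theorem lieBracket {V W : E → E} (hV : SmoothGerm V p) (hW : SmoothGerm W p) :
    SmoothGerm (VectorField.lieBracket ℝ V W) p := by
  filter_upwards [hV, hW] with x h1 h2 using h1.lieBracket_vectorField h2 (by simp)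

/-- The inverse function theorem for smooth maps. -/
theorem exists_openPartialHomeomorph [CompleteSpace E] {f : E → F} {f' : E ≃L[ℝ] F}
    (hf : SmoothGerm f p) (hf' : HasFDerivAt f (f' : E →L[ℝ] F) p) {s : Set E} (hs : s ∈ 𝓝 p) :
    ∃ φ : OpenPartialHomeomorph E F, p ∈ φ.source ∧ φ.source ⊆ s ∧ (φ : E → F) = f ∧
      ContDiffOn ℝ ∞ φ φ.source ∧ ContDiffOn ℝ ∞ φ.symm φ.target := by
  have hinv : ∀ᶠ x in 𝓝 p, fderiv ℝ f x ∈ Set.range ((↑) : (E ≃L[ℝ] F) → (E →L[ℝ] F)) := by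
    have h := ContinuousLinearEquiv.nhds f'
    rw [← hf'.fderiv] at h
    exact hf.fderiv.continuousAt.eventually h
  -- The source is cut down to an open set on which `f` is smooth with invertible derivative, so
  -- that the inverse is smooth on the whole target and not only at `f p`.
  obtain ⟨u, hu, huo, hpu⟩ := eventually_nhds_iff.1 ((hf.and hinv).and hs)
  let ψ := hf.contDiffAt.toOpenPartialHomeomorph f hf' (by simp)
  have hψ : p ∈ ψ.source := ContDiffAt.mem_toOpenPartialHomeomorph_source _ _ _
  have hψf : (ψ : E → F) = f := ContDiffAt.toOpenPartialHomeomorph_coe _ _ _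
  have hsrc : (ψ.restrOpen u huo).source = ψ.source ∩ u := rfl
  have hcoe : ((ψ.restrOpen u huo : OpenPartialHomeomorph E F) : E → F) = f := hψf
  refine ⟨ψ.restrOpen u huo, ⟨hψ, hpu⟩, fun x hx => (hu x (hsrc ▸ hx).2).2, hcoe, ?_, ?_⟩
  · rw [hcoe]
    exact fun x hx => (hu x (hsrc ▸ hx).2).1.1.contDiffWithinAt
  · intro y hy
    have hx := (ψ.restrOpen u huo).map_target hy
    have hx' := (hu _ (hsrc ▸ hx).2).1
    obtain ⟨e, he⟩ := hx'.2
    refine (OpenPartialHomeomorph.contDiffAt_symm _ hy (f₀' := e) ?_ ?_).contDiffWithinAt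
    · rw [hcoe, he]
      exact (hx'.1.differentiableAt (by simp)).hasFDerivAt
    · rw [hcoe]; exact hx'.1

end SmoothGerm

theorem OpenPartialHomeomorph.fderiv_symm_apply_fderiv {φ : OpenPartialHomeomorph E F}
    (h : ContDiffOn ℝ ∞ φ φ.source)
    (h' : ContDiffOn ℝ ∞ φ.symm φ.target) {x : E} (hx : x ∈ φ.source) (v : E) :
    fderiv ℝ φ.symm (φ x) (fderiv ℝ φ x v) = v := by
  have h1 := ((h.contDiffAt (φ.open_source.mem_nhds hx)).differentiableAt (by simp)).hasFDerivAt
  have h2 := ((h'.contDiffAt (φ.open_target.mem_nhds (φ.map_source hx))).differentiableAt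
    (by simp)).hasFDerivAt
  have h3 : HasFDerivAt (φ.symm ∘ φ) (ContinuousLinearMap.id ℝ E) x :=
    (hasFDerivAt_id x).congr_of_eventuallyEq (φ.eventually_left_inverse hx)
  exact DFunLike.congr_fun ((h2.comp x h1).unique h3) v

theorem LinearIndependent.eventually_of_continuousAt {X : Type*} [TopologicalSpace X] {ι : Type*}
    [Finite ι] {V : ι → X → F} {p : X} (hV : ∀ i, ContinuousAt (V i) p)
    (h : LinearIndependent ℝ fun i => V i p) : ∀ᶠ x in 𝓝 p, LinearIndependent ℝ fun i => V i x := by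
  have hc : ContinuousAt (fun x => fun i => V i x) p := continuousAt_pi.2 hV
  exact hc.eventually (isOpen_setOfPred_linearIndependent.mem_nhds h)

variable [FiniteDimensional ℝ F] {k : ℕ} {p : E}

/-- Near `p`, smooth pointwise independent fields span the same subspaces as smooth fields in
reduced echelon form. -/
theorem exists_echelonFrame {X : Fin k → E → F} (hX : ∀ i, SmoothGerm (X i) p)
    (hli : LinearIndependent ℝ fun i => X i p) :
    ∃ (L : F →L[ℝ] (Fin k → ℝ)) (A B : Fin k → E → (Fin k → ℝ)) (Y : Fin k → E → F),
      (∀ i, SmoothGerm (Y i) p) ∧ (∀ i, SmoothGerm (A i) p) ∧ (∀ i, SmoothGerm (B i) p) ∧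
      ∀ᶠ x in 𝓝 p, (∀ i, L (Y i x) = Pi.single i 1) ∧
        (∀ i, X i x = ∑ j, A i x j • Y j x) ∧ ∀ i, Y i x = ∑ j, B i x j • X j x := by
  let T : E → (Fin k → ℝ) →L[ℝ] F := fun x =>
    ∑ i, (ContinuousLinearMap.proj (R := ℝ) (φ := fun _ : Fin k => ℝ) i).smulRight (X i x)
  have hTapp : ∀ x c, T x c = ∑ i, c i • X i x := by
    intro x c; simp [T]
  have hT : SmoothGerm T p := SmoothGerm.sum fun i _ =>
    (SmoothGerm.clm (ContinuousLinearMap.smulRightL ℝ (Fin k → ℝ) F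
      (ContinuousLinearMap.proj (R := ℝ) (φ := fun _ : Fin k => ℝ) i))).comp (hX i)
  have hinj : LinearMap.ker (T p : (Fin k → ℝ) →ₗ[ℝ] F) = ⊥ := by
    rw [LinearMap.ker_eq_bot']
    intro c hc
    have hc' : ∑ i, c i • X i p = 0 := by rw [← hTapp]; exact hc
    exact funext (Fintype.linearIndependent_iff.1 hli c hc')
  -- `L` inverts `T` on the left at `p` only. Then `A = L ∘ T` is the identity at `p`, hence
  -- invertible nearby, and the columns of `T A⁻¹` form the frame normalised by `L`.
  obtain ⟨L₀, hL₀⟩ := LinearMap.exists_leftInverse_of_injective _ hinj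
  let L : F →L[ℝ] (Fin k → ℝ) := LinearMap.toContinuousLinearMap L₀
  let A : E → (Fin k → ℝ) →L[ℝ] (Fin k → ℝ) := fun x => L.comp (T x)
  have hA : SmoothGerm A p :=
    (SmoothGerm.clm (ContinuousLinearMap.compL ℝ (Fin k → ℝ) F (Fin k → ℝ) L)).comp hT
  have hAp : A p = 1 := by
    ext1 c
    exact LinearMap.congr_fun hL₀ c
  have hI : SmoothGerm (fun x => Ring.inverse (A x)) p := by
    have hu : ∀ᶠ x in 𝓝 p, IsUnit (A x) :=
      hA.continuousAt.eventually (Units.isOpen.mem_nhds (by rw [hAp]; exact isUnit_one))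
    filter_upwards [hu, hA] with x hx hx'
    obtain ⟨u, hu⟩ := hx
    have h := contDiffAt_ringInverse ℝ (n := ∞) u
    rw [hu] at h
    exact h.comp x hx'
  have hu : ∀ᶠ x in 𝓝 p, IsUnit (A x) :=
    hA.continuousAt.eventually (Units.isOpen.mem_nhds (by rw [hAp]; exact isUnit_one))
  refine ⟨L, fun i x => A x (Pi.single i 1), fun i x => Ring.inverse (A x) (Pi.single i 1),
    fun i x => T x (Ring.inverse (A x) (Pi.single i 1)), fun i => hT.clm_apply
      (hI.clm_apply (SmoothGerm.const _)), fun i => hA.clm_apply (SmoothGerm.const _),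
      fun i => hI.clm_apply (SmoothGerm.const _), ?_⟩
  filter_upwards [hu] with x hx
  refine ⟨fun i => ?_, fun i => ?_, fun i => hTapp _ _⟩
  · change (A x * Ring.inverse (A x)) (Pi.single i 1) = _
    rw [Ring.mul_inverse_cancel _ hx]; rfl
  · have h1 : ∀ c : Fin k → ℝ, ∑ j, c j • T x (Ring.inverse (A x) (Pi.single j 1)) =
        T x (Ring.inverse (A x) c) := by
      intro c
      conv_rhs => rw [pi_eq_sum_univ' c]
      simp only [map_sum, map_smul]
    rw [h1]
    change _ = T x ((Ring.inverse (A x) * A x) (Pi.single i 1))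
    rw [Ring.inverse_mul_cancel _ hx, one_apply_eq_self, hTapp]
    simp [Pi.single_apply]

/-- A smooth section of the span of smooth independent fields is a combination of these fields
with smooth coefficients. -/
theorem SmoothGerm.exists_coeff {X : Fin k → E → F} (hX : ∀ i, SmoothGerm (X i) p)
    (hli : LinearIndependent ℝ fun i => X i p) {V : E → F} (hV : SmoothGerm V p)
    (hmem : ∀ᶠ x in 𝓝 p, V x ∈ Submodule.span ℝ (Set.range fun i => X i x)) :
    ∃ a : Fin k → E → ℝ, (∀ i, SmoothGerm (a i) p) ∧ ∀ᶠ x in 𝓝 p, V x = ∑ i, a i x • X i x := by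
  obtain ⟨L, A, B, Y, hY, hA, hB, h⟩ := exists_echelonFrame hX hli
  refine ⟨fun j x => ∑ i, L (V x) i * B i x j, fun j => SmoothGerm.sum fun i _ =>
    (((hV.clm_comp L).clm_comp (ContinuousLinearMap.proj (R := ℝ) (φ := fun _ : Fin k => ℝ) i))).mul
      ((hB i).clm_comp (ContinuousLinearMap.proj (R := ℝ) (φ := fun _ : Fin k => ℝ) j)), ?_⟩
  filter_upwards [h, hmem] with x ⟨h1, h2, h3⟩ hx
  -- A vector `v` in the span of the echelon frame has coordinates `L v`. A fixed linear map thus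
  -- reads off the coefficients, which makes them smooth.
  have key : V x = ∑ i, L (V x) i • Y i x := by
    refine Submodule.span_induction (p := fun v _ => v = ∑ i, L v i • Y i x) ?_ ?_ ?_ ?_ hx
    · rintro _ ⟨j, rfl⟩
      have : L (X j x) = A j x := by
        rw [h2 j, map_sum]
        simp only [map_smul, h1]
        exact (pi_eq_sum_univ' _).symm
      change X j x = ∑ i, L (X j x) i • Y i x
      rw [this]; exact h2 j
    · simp
    · intro v w _ _ hv hw
      conv_lhs => rw [hv, hw]
      simp [add_smul, Finset.sum_add_distrib]
    · intro c v _ hv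
      conv_lhs => rw [hv]
      simp [Finset.smul_sum, mul_smul]
  conv_lhs => rw [key]
  conv_lhs => enter [2, i]; rw [h3 i, Finset.smul_sum]
  rw [Finset.sum_comm]
  simp_rw [smul_smul, Finset.sum_smul]

end SmoothGerms

end

noncomputable section

/-! ### Smoothness of the operator `γ ↦ f ∘ γ` on bounded continuous maps -/

section Superposition

open BoundedContinuousFunction

universe u v
variable {α : Type v} [TopologicalSpace α] {E : Type u} [NormedAddCommGroup E] [NormedSpace ℝ E]

/-- Pointwise application of bounded continuous families of operators. -/
def boundedApply (α : Type v) [TopologicalSpace α] (E F : Type u) [NormedAddCommGroup E]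
    [NormedSpace ℝ E] [NormedAddCommGroup F] [NormedSpace ℝ F] :
    (α →ᵇ (E →L[ℝ] F)) →L[ℝ] (α →ᵇ E) →L[ℝ] (α →ᵇ F) :=
  LinearMap.mkContinuous₂
    (LinearMap.mk₂ ℝ
      (fun (A : α →ᵇ (E →L[ℝ] F)) (γ : α →ᵇ E) =>
        BoundedContinuousFunction.ofNormedAddCommGroup (fun s => A s (γ s))
          (A.continuous.clm_apply γ.continuous) (‖A‖ * ‖γ‖) fun s =>
            (A s).le_of_opNorm_le_of_le (A.norm_coe_le_norm s) (γ.norm_coe_le_norm s))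
      (fun A B γ => by ext s; simp) (fun c A γ => by ext s; simp)
      (fun A γ δ => by ext s; simp) (fun c A γ => by ext s; simp))
    1 fun A γ => by
      rw [one_mul]
      exact (BoundedContinuousFunction.norm_le (by positivity)).2 fun s =>
        (A s).le_of_opNorm_le_of_le (A.norm_coe_le_norm s) (γ.norm_coe_le_norm s)

/-- The superposition operator `γ ↦ f ∘ γ` on bounded continuous maps. -/
def superposition (α : Type v) [TopologicalSpace α] {F : Type u} [NormedAddCommGroup F]
    (f : E → F) (hf : Continuous f)
    (hs : HasCompactSupport f) (γ : α →ᵇ E) : α →ᵇ F :=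
  BoundedContinuousFunction.ofNormedAddCommGroup (fun s => f (γ s)) (hf.comp γ.continuous)
    (hs.exists_bound_of_continuous hf).choose fun s =>
      (hs.exists_bound_of_continuous hf).choose_spec (γ s)

/-- The first-order remainder is quadratic because the derivative is Lipschitz. The constant does
not depend on `x`, so the estimate passes to the supremum norm. -/
theorem norm_sub_sub_fderiv_le {F : Type u} [NormedAddCommGroup F] [NormedSpace ℝ F] {f : E → F}
    (hf : ContDiff ℝ ∞ f) {K : NNReal} (hK : LipschitzWith K (fderiv ℝ f)) (x y : E) :
    ‖f y - f x - fderiv ℝ f x (y - x)‖ ≤ K * ‖y - x‖ * ‖y - x‖ := by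
  refine Convex.norm_image_sub_le_of_norm_hasFDerivWithin_le' (s := segment ℝ x y)
    (f' := fderiv ℝ f) (φ := fderiv ℝ f x)
    (fun z _ => (hf.differentiable (by simp) z).hasFDerivAt.hasFDerivWithinAt) (fun z hz => ?_)
    (convex_segment x y) (left_mem_segment ℝ x y) (right_mem_segment ℝ x y)
  refine (hK.norm_sub_le z x).trans ?_
  gcongr
  have := norm_sub_le_of_mem_segment hz
  simpa using this

theorem hasFDerivAt_superposition {F : Type u} [NormedAddCommGroup F] [NormedSpace ℝ F] {f : E → F}
    (hf : ContDiff ℝ ∞ f) (hs : HasCompactSupport f) (γ : α →ᵇ E) :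
    HasFDerivAt (superposition α f hf.continuous hs)
      (boundedApply α E F (superposition α (fderiv ℝ f) (hf.continuous_fderiv (by simp))
        (hs.fderiv (𝕜 := ℝ)) γ)) γ := by
  have hf' : ContDiff ℝ ∞ (fderiv ℝ f) := hf.fderiv_right (by simp)
  obtain ⟨K, hK⟩ := hf'.lipschitzWith_of_hasCompactSupport (hs.fderiv (𝕜 := ℝ)) (by simp)
  rw [hasFDerivAt_iff_isLittleO_nhds_zero]
  have hO : (fun h : α →ᵇ E => superposition α f hf.continuous hs (γ + h) -
      superposition α f hf.continuous hs γ -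
      boundedApply α E F (superposition α (fderiv ℝ f) (hf.continuous_fderiv (by simp))
        (hs.fderiv (𝕜 := ℝ)) γ) h) =O[𝓝 0] fun h => ‖h‖ ^ 2 := by
    refine Asymptotics.IsBigO.of_bound K (Filter.Eventually.of_forall fun h => ?_)
    rw [norm_pow, norm_norm, BoundedContinuousFunction.norm_le (by positivity)]
    intro s
    have h1 := norm_sub_sub_fderiv_le hf hK (γ s) (γ s + h s)
    rw [add_sub_cancel_left] at h1
    refine h1.trans ?_
    have := h.norm_coe_le_norm s
    calc (K : ℝ) * ‖h s‖ * ‖h s‖ ≤ K * ‖h‖ * ‖h‖ := by gcongr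
      _ = K * ‖h‖ ^ 2 := by ring
  refine hO.trans_isLittleO ?_
  exact Asymptotics.isLittleO_norm_pow_id one_lt_two

/-- The derivative is the superposition operator of `fderiv ℝ f` followed by the fixed continuous
linear map `boundedApply`. Regularity therefore climbs by induction on the order with a varying
codomain; a single universe for `E` and `F` lets `E →L[ℝ] F` serve as the next codomain. -/
theorem contDiff_superposition {F : Type u} [NormedAddCommGroup F] [NormedSpace ℝ F] {f : E → F}
    (hf : ContDiff ℝ ∞ f) (hs : HasCompactSupport f) :
    ContDiff ℝ ∞ (superposition α f hf.continuous hs) := by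
  rw [contDiff_infty]
  intro n
  induction n generalizing F with
  | zero =>
    exact contDiff_zero.2 (continuous_iff_continuousAt.2 fun γ =>
      (hasFDerivAt_superposition hf hs γ).continuousAt)
  | succ n ih =>
    have hf' : ContDiff ℝ ∞ (fderiv ℝ f) := hf.fderiv_right (by simp)
    push_cast
    refine contDiff_succ_iff_fderiv.2 ⟨fun γ =>
      (hasFDerivAt_superposition hf hs γ).differentiableAt,
      by simp, ?_⟩
    rw [show fderiv ℝ (superposition α f hf.continuous hs) = fun γ => boundedApply α E F
      (superposition α (fderiv ℝ f) hf'.continuous (hs.fderiv (𝕜 := ℝ)) γ) from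
      funext fun γ => (hasFDerivAt_superposition hf hs γ).fderiv]
    exact (boundedApply α E F).contDiff.comp (ih hf' (hs.fderiv (𝕜 := ℝ)))

end Superposition

/-! ### Smooth local flows and the flow box theorem -/

section Flow

open BoundedContinuousFunction MeasureTheory

universe u
variable {E : Type u} [NormedAddCommGroup E] [NormedSpace ℝ E]

/-- The projection of the real line onto `[-1, 1]`. -/
def clamp (s : ℝ) : ℝ := max (-1) (min 1 s)

theorem continuous_clamp : Continuous clamp := by unfold clamp; fun_prop

theorem abs_clamp_le (s : ℝ) : |clamp s| ≤ 1 := by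
  rw [abs_le]; unfold clamp; constructor
  · exact le_max_left _ _
  · exact max_le (by norm_num) (min_le_left _ _)

theorem clamp_of_abs_le {s : ℝ} (h : |s| ≤ 1) : clamp s = s := by
  rw [abs_le] at h
  unfold clamp
  rw [min_eq_right h.2, max_eq_right h.1]

theorem norm_integral_clamp_le (γ : ℝ →ᵇ E) (s : ℝ) :
    ‖∫ σ in (0 : ℝ)..clamp s, γ σ‖ ≤ ‖γ‖ := by
  refine (intervalIntegral.norm_integral_le_of_norm_le_const
    fun x _ => γ.norm_coe_le_norm x).trans ?_
  rw [sub_zero]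
  exact mul_le_of_le_one_right (norm_nonneg _) (abs_clamp_le s)

/-- The primitive vanishing at `0`, stopped outside `[-1, 1]`. -/
def clampedPrimitive (E : Type u) [NormedAddCommGroup E] [NormedSpace ℝ E] :
    (ℝ →ᵇ E) →L[ℝ] (ℝ →ᵇ E) :=
  LinearMap.mkContinuous
    { toFun := fun γ => BoundedContinuousFunction.ofNormedAddCommGroup
        (fun s => ∫ σ in (0 : ℝ)..clamp s, γ σ)
        ((intervalIntegral.continuous_primitive
          (fun a b => γ.continuous.intervalIntegrable a b) 0).comp continuous_clamp) ‖γ‖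
        (norm_integral_clamp_le γ)
      map_add' := fun γ δ => by
        ext s
        exact intervalIntegral.integral_add (γ.continuous.intervalIntegrable _ _)
          (δ.continuous.intervalIntegrable _ _)
      map_smul' := fun c γ => by
        ext s
        exact intervalIntegral.integral_smul c _ }
    1 fun γ => by
      rw [one_mul]
      exact (BoundedContinuousFunction.norm_le (norm_nonneg _)).2 (norm_integral_clamp_le γ)

theorem norm_clampedPrimitive_le (γ : ℝ →ᵇ E) : ‖clampedPrimitive E γ‖ ≤ ‖γ‖ := by
  have := (clampedPrimitive E).le_of_opNorm_le
    (LinearMap.mkContinuous_norm_le _ zero_le_one _) γ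
  simpa using this

variable {C : E → E}

/-- The curve `γ` is on `[-1, 1]` the integral curve of `t • C` starting at `x`. -/
def IsFlowCurve (hC : ContDiff ℝ ∞ C) (hs : HasCompactSupport C) (t : ℝ) (x : E) (γ : ℝ →ᵇ E) :
    Prop :=
  γ = BoundedContinuousFunction.const ℝ x +
    t • clampedPrimitive E (superposition ℝ C hC.continuous hs γ)

theorem IsFlowCurve.apply {hC : ContDiff ℝ ∞ C} {hs : HasCompactSupport C} {t : ℝ} {x : E}
    {γ : ℝ →ᵇ E} (h : IsFlowCurve hC hs t x γ) (s : ℝ) :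
    γ s = x + t • ∫ σ in (0 : ℝ)..clamp s, C (γ σ) :=
  DFunLike.congr_fun h s

/-- The right-hand side of the integral equation is Lipschitz in the curve with constant at most
`|t| * K < 1`, so it has at most one fixed point. -/
theorem IsFlowCurve.unique {hC : ContDiff ℝ ∞ C} {hs : HasCompactSupport C} {K : NNReal}
    (hK : LipschitzWith K C) {t : ℝ} (ht : |t| * K < 1) {x : E} {γ δ : ℝ →ᵇ E}
    (hγ : IsFlowCurve hC hs t x γ) (hδ : IsFlowCurve hC hs t x δ) : γ = δ := by
  have h1 : γ - δ = t • clampedPrimitive E (superposition ℝ C hC.continuous hs γ -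
      superposition ℝ C hC.continuous hs δ) := by
    conv_lhs => rw [hγ, hδ]
    rw [map_sub, smul_sub]; abel
  have h2 : ‖superposition ℝ C hC.continuous hs γ - superposition ℝ C hC.continuous hs δ‖ ≤
      K * ‖γ - δ‖ := by
    rw [BoundedContinuousFunction.norm_le (by positivity)]
    intro s
    refine (hK.norm_sub_le (γ s) (δ s)).trans ?_
    gcongr
    exact (γ - δ).norm_coe_le_norm s
  have h3 : ‖γ - δ‖ ≤ |t| * K * ‖γ - δ‖ := by
    conv_lhs => rw [h1, norm_smul]
    rw [mul_assoc]
    exact mul_le_mul_of_nonneg_left ((norm_clampedPrimitive_le _).trans h2) (abs_nonneg t)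
  rw [← sub_eq_zero, ← norm_eq_zero]
  nlinarith [norm_nonneg (γ - δ)]

/-- This is the change of variable `σ ↦ r σ` in the integral equation. It is what makes the
parameter `t` behave as time. -/
theorem IsFlowCurve.rescale {hC : ContDiff ℝ ∞ C} {hs : HasCompactSupport C} {t : ℝ} {x : E}
    {γ : ℝ →ᵇ E} (h : IsFlowCurve hC hs t x γ) {r : ℝ} (hr : |r| ≤ 1) :
    IsFlowCurve hC hs (t * r) x
      (γ.compContinuous ⟨fun s => r * clamp s, continuous_const.mul continuous_clamp⟩) := by
  ext s
  change γ (r * clamp s) = x + (t * r) • ∫ σ in (0 : ℝ)..clamp s, C (γ (r * clamp σ))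
  have hrs : |r * clamp s| ≤ 1 := by
    rw [abs_mul]; exact mul_le_one₀ hr (abs_nonneg _) (abs_clamp_le s)
  rw [h.apply, clamp_of_abs_le hrs, mul_smul]
  congr 2
  have h1 : ∫ σ in (0 : ℝ)..clamp s, C (γ (r * clamp σ)) =
      ∫ σ in (0 : ℝ)..clamp s, C (γ (r * σ)) := by
    refine intervalIntegral.integral_congr fun σ hσ => ?_
    have hσ' : |σ| ≤ 1 := by
      have h0 := abs_le.1 (abs_clamp_le s)
      rw [abs_le]
      rcases Set.mem_uIcc.1 hσ with h | h <;> constructor <;> linarith [h.1, h.2, h0.1, h0.2]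
    change C (γ (r * clamp σ)) = C (γ (r * σ))
    rw [clamp_of_abs_le hσ']
  rw [h1, intervalIntegral.smul_integral_comp_mul_left (fun σ => C (γ σ)) r, mul_zero]

variable [CompleteSpace E]

/-- Time is a scalar parameter of the equation `γ = x + t J(C ∘ γ)` in the Banach space of curves.
At `t = 0` its linearisation in `γ` is the identity, so the inverse function theorem solves it
smoothly in `(t, x)`. -/
theorem exists_flowCurves (hC : ContDiff ℝ ∞ C) (hs : HasCompactSupport C) (p : E) :
    ∃ Γ : ℝ × E → ℝ →ᵇ E, SmoothGerm Γ (0, p) ∧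
      ∀ᶠ u in 𝓝 ((0 : ℝ), p), IsFlowCurve hC hs u.1 u.2 (Γ u) := by
  let N := superposition ℝ C hC.continuous hs
  have hN : ContDiff ℝ ∞ N := contDiff_superposition hC hs
  let J := clampedPrimitive E
  let cst : E →L[ℝ] (ℝ →ᵇ E) := LinearMap.mkContinuous
    { toFun := BoundedContinuousFunction.const ℝ
      map_add' := fun _ _ => rfl
      map_smul' := fun _ _ => rfl } 1 fun x => by
        rw [one_mul]; exact BoundedContinuousFunction.norm_const_le x
  let Ψ : (ℝ × E) × (ℝ →ᵇ E) → (ℝ × E) × (ℝ →ᵇ E) := fun z =>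
    (z.1, z.2 - cst z.1.2 - z.1.1 • J (N z.2))
  have hΨ : ContDiff ℝ ∞ Ψ := by
    have h1 : ContDiff ℝ ∞ fun z : (ℝ × E) × (ℝ →ᵇ E) => cst z.1.2 :=
      cst.contDiff.comp (contDiff_snd.comp contDiff_fst)
    have h2 : ContDiff ℝ ∞ fun z : (ℝ × E) × (ℝ →ᵇ E) => J (N z.2) :=
      J.contDiff.comp (hN.comp contDiff_snd)
    exact contDiff_fst.prodMk ((contDiff_snd.sub h1).sub ((contDiff_fst.comp contDiff_fst).smul h2))
  let z₀ : (ℝ × E) × (ℝ →ᵇ E) := ((0, p), cst p)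
  -- At `t = 0` the term `t • D(J ∘ N)` drops out, so the derivative of `Ψ` is the shear `(w, η) ↦
  -- (w, η + S w)`, which is invertible.
  let S : (ℝ × E) →L[ℝ] (ℝ →ᵇ E) :=
    -(cst.comp (ContinuousLinearMap.snd ℝ ℝ E)) -
      (ContinuousLinearMap.fst ℝ ℝ E).smulRight (J (N (cst p)))
  let Ψ' : ((ℝ × E) × (ℝ →ᵇ E)) ≃L[ℝ] ((ℝ × E) × (ℝ →ᵇ E)) :=
    ContinuousLinearEquiv.skewProd (ContinuousLinearEquiv.refl ℝ (ℝ × E))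
      (ContinuousLinearEquiv.refl ℝ (ℝ →ᵇ E)) S
  have hΨ' : HasFDerivAt Ψ (Ψ' : _ →L[ℝ] _) z₀ := by
    have h2 : HasFDerivAt (fun z : (ℝ × E) × (ℝ →ᵇ E) => J (N z.2))
        (fderiv ℝ (fun z : (ℝ × E) × (ℝ →ᵇ E) => J (N z.2)) z₀) z₀ :=
      ((J.contDiff.comp (hN.comp contDiff_snd)).differentiable (by simp) z₀).hasFDerivAt
    have h3 : HasFDerivAt (fun z : (ℝ × E) × (ℝ →ᵇ E) => z.1.1)
      ((ContinuousLinearMap.fst ℝ ℝ E).comp (ContinuousLinearMap.fst ℝ (ℝ × E) (ℝ →ᵇ E))) z₀ :=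
      ((ContinuousLinearMap.fst ℝ ℝ E).comp
        (ContinuousLinearMap.fst ℝ (ℝ × E) (ℝ →ᵇ E))).hasFDerivAt
    have h4 : HasFDerivAt (fun z : (ℝ × E) × (ℝ →ᵇ E) => z.2 - cst z.1.2)
      (ContinuousLinearMap.snd ℝ (ℝ × E) (ℝ →ᵇ E) - (cst.comp (ContinuousLinearMap.snd ℝ ℝ E)).comp
        (ContinuousLinearMap.fst ℝ (ℝ × E) (ℝ →ᵇ E))) z₀ :=
      (ContinuousLinearMap.snd ℝ (ℝ × E) (ℝ →ᵇ E) - (cst.comp (ContinuousLinearMap.snd ℝ ℝ E)).comp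
        (ContinuousLinearMap.fst ℝ (ℝ × E) (ℝ →ᵇ E))).hasFDerivAt
    have h5 := (ContinuousLinearMap.fst ℝ (ℝ × E) (ℝ →ᵇ E)).hasFDerivAt (x := z₀) |>.prodMk
      (h4.sub (h3.smul h2))
    refine h5.congr_fderiv ?_
    refine ContinuousLinearMap.ext fun z => ?_
    simp [Ψ', S, z₀]
    abel
  obtain ⟨φ, hz₀, -, hφ, -, hφs⟩ :=
    (SmoothGerm.of_contDiff hΨ (p := z₀)).exists_openPartialHomeomorph hΨ' Filter.univ_mem
  have hΨz : Ψ z₀ = ((0, p), 0) := by simp [Ψ, z₀]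
  have htar : (((0 : ℝ), p), (0 : ℝ →ᵇ E)) ∈ φ.target := by
    rw [← hΨz, ← hφ]; exact φ.map_source hz₀
  have hι : ContDiff ℝ ∞ fun u : ℝ × E => (u, (0 : ℝ →ᵇ E)) := contDiff_prodMk_left _
  have hev : ∀ᶠ u : ℝ × E in 𝓝 ((0 : ℝ), p), (u, (0 : ℝ →ᵇ E)) ∈ φ.target :=
    hι.continuous.continuousAt.eventually (φ.open_target.mem_nhds htar)
  refine ⟨fun u => (φ.symm (u, 0)).2, ?_, ?_⟩
  · filter_upwards [hev] with u hu
    exact contDiffAt_snd.comp u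
      (((hφs.contDiffAt (φ.open_target.mem_nhds hu))).comp u hι.contDiffAt)
  · filter_upwards [hev] with u hu
    have h := φ.right_inv hu
    rw [hφ] at h
    have h1 : (φ.symm (u, 0)).1 = u := congrArg Prod.fst h
    have h2 := congrArg Prod.snd h
    simp only [Ψ, h1] at h2
    change _ = cst u.2 + u.1 • J (N _)
    rw [← sub_eq_zero, ← sub_sub]
    exact h2

/-- The local flow of a smooth vector field is smooth. -/
theorem exists_smooth_flow (hC : ContDiff ℝ ∞ C) (hs : HasCompactSupport C) (p : E) :
    ∃ Φ : ℝ × E → E, SmoothGerm Φ (0, p) ∧ (∀ᶠ x in 𝓝 p, Φ (0, x) = x) ∧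
      ∀ᶠ z in 𝓝 ((0 : ℝ), p), HasDerivAt (fun s => Φ (s, z.2)) (C (Φ z)) z.1 := by
  obtain ⟨Γ, hΓ, hΓ'⟩ := exists_flowCurves hC hs p
  obtain ⟨K, hK⟩ := hC.lipschitzWith_of_hasCompactSupport hs (by simp)
  refine ⟨fun u => Γ u 1, hΓ.clm_comp (BoundedContinuousFunction.evalCLM ℝ (1 : ℝ)), ?_, ?_⟩
  · have hc : ContinuousAt (fun x : E => ((0 : ℝ), x)) p := by fun_prop
    filter_upwards [hc.eventually hΓ'] with x hx
    have := hx.apply 1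
    simpa using this
  · have h1 : ∀ᶠ u in 𝓝 ((0 : ℝ), p), |u.1| * (K : ℝ) < 1 := by
      have hc : ContinuousAt (fun u : ℝ × E => |u.1| * (K : ℝ)) (0, p) := by fun_prop
      exact hc.eventually_lt continuousAt_const (by simp)
    have h2 := hΓ'.and h1
    rw [nhds_prod_eq, Filter.eventually_prod_iff] at h2
    obtain ⟨P, hP, Q, hQ, h⟩ := h2
    obtain ⟨ε, hε, hεP⟩ := Metric.eventually_nhds_iff.1 hP
    have hPT : ∀ t : ℝ, |t| ≤ ε / 2 → P t := fun t ht => hεP (by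
      rw [Real.dist_eq, sub_zero]; linarith)
    set T := ε / 2 with hTdef
    have hT : 0 < T := by positivity
    have hTT : |T| ≤ T := (abs_of_pos hT).le
    have hball : ∀ᶠ t in 𝓝 (0 : ℝ), |t| < T :=
      (continuous_abs.continuousAt (x := (0 : ℝ))).eventually_lt continuousAt_const
        (by simpa using hT)
    rw [nhds_prod_eq]
    filter_upwards [hball.prod_mk hQ] with ⟨t, x⟩ ⟨ht, hx⟩
    simp only at ht hx
    have hflow := (h (hPT T hTT) hx).1
    -- By rescaling and uniqueness, all the curves with `|t'| < T` are portions of the single curve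
    -- at parameter `T`. The time derivative then comes from the fundamental theorem of calculus
    -- along that one curve.
    have key : ∀ t' : ℝ, |t'| < T → Γ (t', x) 1 = Γ (T, x) (t' / T) := by
      intro t' ht'
      have hr : |t' / T| ≤ 1 := by
        rw [abs_div, abs_of_pos hT, div_le_one hT]; exact ht'.le
      have h3 := hflow.rescale hr
      rw [show (T, x).1 * (t' / T) = t' by simp; field_simp] at h3
      have h4 := h (hPT t' ht'.le) hx
      have h5 := IsFlowCurve.unique hK h4.2 h4.1 h3
      have h6 := DFunLike.congr_fun h5 1
      rw [h6]
      change Γ (T, x) (t' / T * clamp 1) = _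
      rw [clamp_of_abs_le (by simp), mul_one]
    have hnear : ∀ᶠ t' in 𝓝 t, |t'| < T :=
      continuous_abs.continuousAt.eventually_lt continuousAt_const ht
    have heq : (fun s => Γ (s, x) 1) =ᶠ[𝓝 t]
        fun s => x + T • ∫ σ in (0 : ℝ)..(s / T), C (Γ (T, x) σ) := by
      filter_upwards [hnear] with s hs
      rw [key s hs, hflow.apply, clamp_of_abs_le]
      rw [abs_div, abs_of_pos hT, div_le_one hT]; exact hs.le
    refine HasDerivAt.congr_of_eventuallyEq ?_ heq
    have hcont : Continuous fun σ => C (Γ (T, x) σ) := hC.continuous.comp (Γ (T, x)).continuous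
    have h7 : HasDerivAt (fun s => ∫ σ in (0 : ℝ)..s, C (Γ (T, x) σ))
      (C (Γ (T, x) (t / T))) (t / T) :=
      intervalIntegral.integral_hasDerivAt_right (hcont.intervalIntegrable _ _)
        (hcont.stronglyMeasurableAtFilter _ _) hcont.continuousAt
    have h8 := (h7.scomp t ((hasDerivAt_id t).div_const T)).const_smul T |>.const_add x
    refine h8.congr_deriv ?_
    rw [smul_smul, ← key t ht]
    have : T * (1 / T) = 1 := by field_simp
    rw [this, one_smul]

/-- The flow box theorem: a smooth vector field is constant in suitable coordinates around a point
where it does not vanish. -/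
theorem SmoothGerm.exists_flowBox [FiniteDimensional ℝ E] {C : E → E} {p : E}
    (hC : SmoothGerm C p) (h0 : C p ≠ 0) {e : E} (he : e ≠ 0) :
    ∃ φ : OpenPartialHomeomorph E E, p ∈ φ.source ∧ φ p = 0 ∧ ContDiffOn ℝ ∞ φ φ.source ∧
      ContDiffOn ℝ ∞ φ.symm φ.target ∧ ∀ x ∈ φ.source, fderiv ℝ φ x (C x) = e := by
  obtain ⟨r, hr, hball⟩ := Metric.eventually_nhds_iff_ball.1 hC
  let χ : ContDiffBump p := ⟨r / 4, r / 2, by positivity, by linarith⟩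
  let C₁ : E → E := fun x => χ x • C x
  have hC₁ : ContDiff ℝ ∞ C₁ := by
    refine contDiff_iff_contDiffAt.2 fun x => ?_
    by_cases hx : x ∈ tsupport χ
    · refine χ.contDiff.contDiffAt.smul (hball x ?_)
      rw [χ.tsupport_eq] at hx
      exact Metric.closedBall_subset_ball (show r / 2 < r by linarith) hx
    · refine contDiffAt_const (c := (0 : E)) |>.congr_of_eventuallyEq ?_
      filter_upwards [notMem_tsupport_iff_eventuallyEq.1 hx] with y hy
      simp [C₁, hy]
  have hs₁ : HasCompactSupport C₁ := χ.hasCompactSupport.smul_right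
  have heq : C₁ =ᶠ[𝓝 p] C := by
    filter_upwards [χ.eventuallyEq_one] with x hx
    simp [C₁, hx]
  obtain ⟨Φ, hΦ, hΦ0, hΦC⟩ := exists_smooth_flow hC₁ hs₁ p
  obtain ⟨L, hL⟩ := SeparatingDual.exists_continuousLinearEquiv_apply_eq (R := ℝ) he h0
  obtain ⟨ℓ, hℓ⟩ := SeparatingDual.exists_eq_one (R := ℝ) he
  -- `G = Φ ∘ g` flows for time `ℓ y` from a point of the affine hyperplane `p + L (ker ℓ)`, which
  -- is transverse to `C p = L e`. Its local inverse is the required chart.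
  let g : E → ℝ × E := fun y => (ℓ y, p + L (y - ℓ y • e))
  have hg : ContDiff ℝ ∞ g := by
    refine ℓ.contDiff.prodMk (contDiff_const.add (L.contDiff.comp (contDiff_id.sub ?_)))
    exact ℓ.contDiff.smul contDiff_const
  have hg0 : g 0 = (0, p) := by simp [g]
  let G : E → E := fun y => Φ (g y)
  have hG : SmoothGerm G 0 := SmoothGerm.comp (by rw [hg0]; exact hΦ) (SmoothGerm.of_contDiff hg)
  have hG0 : G 0 = p := by simp only [G, hg0]; exact hΦ0.self_of_nhds
  have hGe : ∀ᶠ y in 𝓝 (0 : E), fderiv ℝ G y e = C (G y) := by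
    have h1 : ∀ᶠ y in 𝓝 (0 : E), HasDerivAt (fun s => Φ (s, (g y).2)) (C₁ (Φ (g y))) (g y).1 :=
      hg.continuous.continuousAt.eventually (by rw [hg0]; exact hΦC)
    have h2 : ∀ᶠ y in 𝓝 (0 : E), C₁ (G y) = C (G y) :=
      hG.continuousAt.eventually (by rw [hG0]; exact heq)
    filter_upwards [hG, h1, h2] with y hy h1 h2
    have hline : HasDerivAt (fun s : ℝ => y + s • e) e 0 := by
      simpa using ((hasDerivAt_id (0 : ℝ)).smul_const e).const_add y
    have hy' : HasFDerivAt G (fderiv ℝ G y) (y + (0 : ℝ) • e) := by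
      rw [zero_smul, add_zero]
      exact (hy.differentiableAt (by simp)).hasFDerivAt
    have h3 := hy'.comp_hasDerivAt (0 : ℝ) hline
    have hsh : HasDerivAt (fun s : ℝ => ℓ y + s) 1 0 := (hasDerivAt_id (0 : ℝ)).const_add (ℓ y)
    have h1' : HasDerivAt (fun s => Φ (s, (g y).2)) (C₁ (Φ (g y))) (ℓ y + 0) := by
      rw [add_zero]; exact h1
    have h4 := h1'.scomp (0 : ℝ) hsh
    have h5 : (G ∘ fun s : ℝ => y + s • e) = (fun s => Φ (s, (g y).2)) ∘ fun s : ℝ => ℓ y + s := by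
      funext s
      simp only [G, g, Function.comp, map_add, map_smul, hℓ, smul_eq_mul, mul_one]
      congr 3
      rw [add_smul]; congr 1; abel
    rw [h5] at h3
    rw [h3.unique h4, one_smul]
    exact h2
  have hG' : HasFDerivAt G (L : E →L[ℝ] E) 0 := by
    have h1 := hG.differentiableAt.hasFDerivAt
    refine h1.congr_fderiv (ContinuousLinearMap.ext fun v => ?_)
    -- On `ker ℓ` the time is zero and `G` is `w ↦ p + L w` near `0`; along `e` the derivative is `C
    -- p = L e`. Together these give `L` as the derivative of `G` at `0`.
    have h2 : ∀ w, ℓ w = 0 → fderiv ℝ G 0 w = L w := by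
      intro w hw
      have hline : HasDerivAt (fun s : ℝ => s • w) w 0 := by
        simpa using (hasDerivAt_id (0 : ℝ)).smul_const w
      have h1' : HasFDerivAt G (fderiv ℝ G 0) ((0 : ℝ) • w) := by rw [zero_smul]; exact h1
      have h3 := h1'.comp_hasDerivAt (0 : ℝ) hline
      have hc : ContinuousAt (fun s : ℝ => p + s • L w) 0 := by fun_prop
      have h5 : (G ∘ fun s : ℝ => s • w) =ᶠ[𝓝 0] fun s => p + s • L w := by
        filter_upwards [hc.eventually (by simpa using hΦ0)] with s hs
        rw [← hs]
        simp [G, g, hw]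
      have h6 : HasDerivAt (fun s : ℝ => p + s • L w) (L w) 0 := by
        simpa using ((hasDerivAt_id (0 : ℝ)).smul_const (L w)).const_add p
      exact h3.unique (h6.congr_of_eventuallyEq h5)
    have h3 : fderiv ℝ G 0 e = L e := by rw [hGe.self_of_nhds, hG0, hL]
    have h4 := h2 (v - ℓ v • e) (by simp [hℓ])
    rw [map_sub, map_smul, h3, map_sub, map_smul] at h4
    exact sub_left_injective h4
  obtain ⟨ψ, h0ψ, hψs, hψ, hψ1, hψ2⟩ := hG.exists_openPartialHomeomorph hG' hGe
  refine ⟨ψ.symm, ?_, ?_, hψ2, by simpa using hψ1, fun x hx => ?_⟩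
  · rw [ψ.symm_source, ← hG0, ← hψ]; exact ψ.map_source h0ψ
  · conv_lhs => rw [← hG0, ← hψ]
    exact ψ.left_inv h0ψ
  · have hy : ψ.symm x ∈ ψ.source := ψ.map_target hx
    have h1 := ψ.fderiv_symm_apply_fderiv hψ1 hψ2 hy e
    have h2 : fderiv ℝ ψ (ψ.symm x) e = C (ψ (ψ.symm x)) := by
      rw [hψ]; exact hψs hy
    rw [h2, ψ.right_inv hx] at h1
    exact h1

end Flow

end

noncomputable section

/-! ### Modules of vector fields and their derived modules -/

section Flags

open VectorField

variable {E : Type*} [NormedAddCommGroup E] [NormedSpace ℝ E]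

/-- A module of germs at `p` of smooth vector fields on a vector space. -/
structure IsFieldModule (S : Submodule ℝ (E → E)) (p : E) : Prop where
  smooth : ∀ V ∈ S, SmoothGerm V p
  congr : ∀ V ∈ S, ∀ W, W =ᶠ[𝓝 p] V → W ∈ S
  smul : ∀ a : E → ℝ, SmoothGerm a p → ∀ V ∈ S, (fun x => a x • V x) ∈ S

/-- The sum of a space of vector fields and the space of all brackets of its members. -/
def bracketExtension (S : Submodule ℝ (E → E)) : Submodule ℝ (E → E) :=
  S ⊔ Submodule.span ℝ {B | ∃ V ∈ S, ∃ W ∈ S, B = lieBracket ℝ V W}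

/-- The smooth sections near `p` of a field of subspaces of a vector space. -/
def fieldSections (D : E → Submodule ℝ E) (p : E) : Submodule ℝ (E → E) where
  carrier := {V | SmoothGerm V p ∧ ∀ᶠ x in 𝓝 p, V x ∈ D x}
  add_mem' := fun hV hW => ⟨hV.1.add hW.1, by
    filter_upwards [hV.2, hW.2] with x h1 h2 using (D x).add_mem h1 h2⟩
  zero_mem' := ⟨SmoothGerm.const 0, Filter.Eventually.of_forall fun x => (D x).zero_mem⟩
  smul_mem' := fun c _ hV => ⟨(SmoothGerm.const c).smul hV.1, by
    filter_upwards [hV.2] with x h1 using (D x).smul_mem c h1⟩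

/-- The values at `p` of the `i`-th derived module of sections of `D`. -/
def flagAt (D : E → Submodule ℝ E) (i : ℕ) (p : E) : Submodule ℝ E :=
  (bracketExtension^[i] (fieldSections D p)).map (LinearMap.proj p)

theorem isFieldModule_fieldSections (D : E → Submodule ℝ E) (p : E) :
    IsFieldModule (fieldSections D p) p where
  smooth := fun _ hV => hV.1
  congr := fun _ hV _ hW => ⟨hV.1.congr hW, by
    filter_upwards [hV.2, hW] with x h1 h2
    rw [h2]; exact h1⟩
  smul := fun a ha V hV => ⟨ha.smul hV.1, by
    filter_upwards [hV.2] with x h1 using (D x).smul_mem _ h1⟩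

theorem fieldSections_congr {D D' : E → Submodule ℝ E} {p : E} (h : ∀ᶠ x in 𝓝 p, D x = D' x) :
    fieldSections D p = fieldSections D' p := by
  ext V
  refine and_congr_right fun _ => Filter.eventually_congr ?_
  filter_upwards [h] with x hx
  rw [hx]

theorem le_bracketExtension (S : Submodule ℝ (E → E)) : S ≤ bracketExtension S := le_sup_left

theorem lieBracket_mem_bracketExtension {S : Submodule ℝ (E → E)} {V W : E → E} (hV : V ∈ S)
    (hW : W ∈ S) : lieBracket ℝ V W ∈ bracketExtension S :=
  Submodule.mem_sup_right (Submodule.subset_span ⟨V, hV, W, hW, rfl⟩)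

theorem bracketExtension_induction {S : Submodule ℝ (E → E)} {P : (E → E) → Prop}
    (mem : ∀ V ∈ S, P V) (bracket : ∀ V ∈ S, ∀ W ∈ S, P (lieBracket ℝ V W))
    (add : ∀ V W, P V → P W → P (V + W)) (smul : ∀ (c : ℝ) V, P V → P (c • V)) {V : E → E}
    (hV : V ∈ bracketExtension S) : P V := by
  obtain ⟨A, hA, B, hB, rfl⟩ := Submodule.mem_sup.1 hV
  refine add _ _ (mem _ hA) (Submodule.span_induction (p := fun B _ => P B) ?_ (mem 0 S.zero_mem)
    (fun V W _ _ => add V W) (fun c V _ => smul c V) hB)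
  rintro _ ⟨V, hV, W, hW, rfl⟩
  exact bracket V hV W hW

/-- Closure under multiplication by functions is the Leibniz rule `a [V, W] = [V, a W] - V(a) W`.
The rule is available only near `p`, where `a` and `W` are smooth, which is why closure under
equality of germs belongs to `IsFieldModule`. -/
theorem IsFieldModule.bracketExtension {S : Submodule ℝ (E → E)} {p : E}
    (hS : IsFieldModule S p) : IsFieldModule (bracketExtension S) p where
  smooth := fun V hV => bracketExtension_induction hS.smooth
    (fun V hV W hW => (hS.smooth V hV).lieBracket (hS.smooth W hW)) (fun _ _ => SmoothGerm.add)
    (fun c _ h => (SmoothGerm.const c).smul h) hV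
  congr := fun V hV W hW => by
    have h : W - V ∈ S := hS.congr 0 S.zero_mem _ (by
      filter_upwards [hW] with x hx
      simp [hx])
    have := Submodule.add_mem _ hV (le_bracketExtension S h)
    rwa [add_sub_cancel] at this
  smul := fun a ha V hV => by
    refine bracketExtension_induction
      (P := fun V => (fun x => a x • V x) ∈ _root_.bracketExtension S)
      (fun V hV => le_bracketExtension S (hS.smul a ha V hV)) (fun V hV W hW => ?_)
      (fun V W h1 h2 => ?_) (fun c V h => ?_) hV
    · have h1 : lieBracket ℝ V (fun x => a x • W x) - (fun x => fderiv ℝ a x (V x) • W x) ∈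
          _root_.bracketExtension S :=
        Submodule.sub_mem _ (lieBracket_mem_bracketExtension hV (hS.smul a ha W hW))
          (le_bracketExtension S (hS.smul _ (ha.fderiv.clm_apply (hS.smooth V hV)) W hW))
      have h2 : (fun x => a x • lieBracket ℝ V W x) -
          (lieBracket ℝ V (fun x => a x • W x) - (fun x => fderiv ℝ a x (V x) • W x)) ∈ S := by
        refine hS.congr 0 S.zero_mem _ ?_
        filter_upwards [ha, hS.smooth W hW] with x h1 h2
        simp [lieBracket_smul_right (h1.differentiableAt (by simp)) (h2.differentiableAt (by simp))]
      have := Submodule.add_mem _ (le_bracketExtension S h2) h1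
      rwa [sub_add_cancel] at this
    · have := Submodule.add_mem _ h1 h2
      convert this using 1
      ext1 x; simp
    · have := Submodule.smul_mem _ c h
      convert this using 1
      ext1 x; simp [smul_comm c]

theorem IsFieldModule.iterate {S : Submodule ℝ (E → E)} {p : E} (hS : IsFieldModule S p) (i : ℕ) :
    IsFieldModule (_root_.bracketExtension^[i] S) p := by
  induction i with
  | zero => exact hS
  | succ i ih => rw [Function.iterate_succ_apply']; exact ih.bracketExtension

theorem lieBracket_sum_smul_left {k : ℕ} {X : Fin k → E → E} {a : Fin k → E → ℝ} {W : E → E} {x : E}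
    (hX : ∀ i, DifferentiableAt ℝ (X i) x) (ha : ∀ i, DifferentiableAt ℝ (a i) x) :
    lieBracket ℝ (fun y => ∑ i, a i y • X i y) W x =
      ∑ i, (a i x • lieBracket ℝ (X i) W x - fderiv ℝ (a i) x (W x) • X i x) := by
  simp only [lieBracket]
  have h : fderiv ℝ (fun y => ∑ i, a i y • X i y) x = ∑ i, fderiv ℝ (fun y => a i y • X i y) x :=
    fderiv_fun_sum fun i _ => (ha i).smul (hX i)
  rw [h]
  simp only [map_sum, map_smul, sum_apply, fderiv_fun_smul (ha _) (hX _)]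
  rw [← Finset.sum_sub_distrib]
  refine Finset.sum_congr rfl fun i _ => ?_
  simp [smul_sub, sub_sub]

/-- By the Leibniz rule, differentiating the coefficients produces only multiples of the frame
fields themselves. -/
theorem lieBracket_sum_mem {k : ℕ} {X : Fin k → E → E} {a b : Fin k → E → ℝ} {x : E}
    (hX : ∀ i, DifferentiableAt ℝ (X i) x) (ha : ∀ i, DifferentiableAt ℝ (a i) x)
    (hb : ∀ i, DifferentiableAt ℝ (b i) x) {S : Submodule ℝ E} (h : ∀ i, X i x ∈ S)
    (h' : ∀ i j, lieBracket ℝ (X i) (X j) x ∈ S) :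
    lieBracket ℝ (fun y => ∑ i, a i y • X i y) (fun y => ∑ i, b i y • X i y) x ∈ S := by
  rw [lieBracket_sum_smul_left hX ha]
  refine S.sum_mem fun i _ => S.sub_mem (S.smul_mem _ ?_) (S.smul_mem _ (h i))
  rw [lieBracket_swap, lieBracket_sum_smul_left hX hb]
  exact S.neg_mem (S.sum_mem fun j _ => S.sub_mem (S.smul_mem _ (h' j i)) (S.smul_mem _ (h j)))

/-- The field of subspaces spanned by a family of vector fields. -/
def frameSpan {k : ℕ} (X : Fin k → E → E) (x : E) : Submodule ℝ E :=
  Submodule.span ℝ (Set.range fun i => X i x)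

theorem mem_frameSpan {k : ℕ} {X : Fin k → E → E} {x v : E} :
    v ∈ frameSpan X x ↔ ∃ c : Fin k → ℝ, ∑ i, c i • X i x = v :=
  Submodule.mem_span_range_iff_exists_fun ℝ

theorem self_mem_frameSpan {k : ℕ} (X : Fin k → E → E) (i : Fin k) (x : E) :
    X i x ∈ frameSpan X x := Submodule.subset_span ⟨i, rfl⟩

theorem frameSpan_le {k : ℕ} {X : Fin k → E → E} {x : E} {S : Submodule ℝ E}
    (h : ∀ i, X i x ∈ S) : frameSpan X x ≤ S :=
  Submodule.span_le.2 (Set.range_subset_iff.2 h)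

variable [FiniteDimensional ℝ E] {k : ℕ} {X : Fin k → E → E} {p : E}

/-- A bracket of sections of the span of a frame is a combination of the frame and its brackets. -/
theorem eventually_mem_of_mem_bracketExtension (hX : ∀ i, SmoothGerm (X i) p)
    (hli : LinearIndependent ℝ fun i => X i p) {S : E → Submodule ℝ E}
    (h : ∀ᶠ x in 𝓝 p, (∀ i, X i x ∈ S x) ∧ ∀ i j, lieBracket ℝ (X i) (X j) x ∈ S x) {V : E → E}
    (hV : V ∈ bracketExtension (fieldSections (frameSpan X) p)) : ∀ᶠ x in 𝓝 p, V x ∈ S x := by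
  refine bracketExtension_induction (P := fun V => ∀ᶠ x in 𝓝 p, V x ∈ S x) ?_ ?_ ?_ ?_ hV
  · rintro V ⟨-, hV⟩
    filter_upwards [h, hV] with x h1 h2 using frameSpan_le h1.1 h2
  · rintro V ⟨hV, hV'⟩ W ⟨hW, hW'⟩
    obtain ⟨a, ha, hVa⟩ := hV.exists_coeff hX hli hV'
    obtain ⟨b, hb, hWb⟩ := hW.exists_coeff hX hli hW'
    have hX' := Filter.eventually_all.2 hX
    have ha' := Filter.eventually_all.2 ha
    have hb' := Filter.eventually_all.2 hb
    filter_upwards [h, hVa.eventually_nhds, hWb.eventually_nhds, hX', ha', hb'] with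
      x h h1 h2 h3 h4 h5
    rw [Filter.EventuallyEq.lieBracket_vectorField_eq h1 h2]
    exact lieBracket_sum_mem (fun i => (h3 i).differentiableAt (by simp))
      (fun i => (h4 i).differentiableAt (by simp))
        (fun i => (h5 i).differentiableAt (by simp)) h.1 h.2
  · intro V W h1 h2
    filter_upwards [h1, h2] with x h1 h2 using (S x).add_mem h1 h2
  · intro c V h1
    filter_upwards [h1] with x h1 using (S x).smul_mem c h1

/-- If `Z` is a frame made of members of the derived module of `span X` which contains `X` and its
brackets in its span, then the derived module is the module of sections of `span Z`. -/
theorem bracketExtension_fieldSections {m : ℕ} {Z : Fin m → E → E} (hX : ∀ i, SmoothGerm (X i) p)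
    (hli : LinearIndependent ℝ fun i => X i p)
    (hZ : ∀ j, Z j ∈ bracketExtension (fieldSections (frameSpan X) p))
    (hZli : LinearIndependent ℝ fun j => Z j p)
    (h : ∀ᶠ x in 𝓝 p, (∀ i, X i x ∈ frameSpan Z x) ∧
      ∀ i j, lieBracket ℝ (X i) (X j) x ∈ frameSpan Z x) :
    bracketExtension (fieldSections (frameSpan X) p) = fieldSections (frameSpan Z) p := by
  have hM := (isFieldModule_fieldSections (frameSpan X) p).bracketExtension
  refine le_antisymm ?_ ?_
  · intro V hV
    exact ⟨hM.smooth V hV, eventually_mem_of_mem_bracketExtension hX hli h hV⟩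
  · rintro V ⟨hV, hV'⟩
    obtain ⟨a, ha, hVa⟩ := hV.exists_coeff (fun j => hM.smooth _ (hZ j)) hZli hV'
    refine hM.congr (∑ j, fun x => a j x • Z j x)
      (Submodule.sum_mem _ fun j _ => hM.smul _ (ha j) _ (hZ j)) V ?_
    filter_upwards [hVa] with x hx
    simp [hx]

end Flags

end

noncomputable section

/-! ### Characteristic fields of the derived structure -/

section Characteristic

open VectorField

/-- Local Goursat condition for a field of subspaces of `ℝⁿ`. -/
structure GoursatNear {n : ℕ} (D : RSpace n → Submodule ℝ (RSpace n)) (p : RSpace n) : Prop where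
  exists_frame : ∃ X Y : RSpace n → RSpace n, SmoothGerm X p ∧ SmoothGerm Y p ∧
    LinearIndependent ℝ ![X p, Y p] ∧ ∀ᶠ x in 𝓝 p, D x = frameSpan ![X, Y] x
  finrank_flagAt : ∀ᶠ q in 𝓝 p, ∀ i, i + 2 ≤ n → Module.finrank ℝ (flagAt D i q) = i + 2

section Frames

variable {E : Type*} [NormedAddCommGroup E] [NormedSpace ℝ E] {X Y Z T : E → E} {x v : E}

theorem mem_frameSpan_two : v ∈ frameSpan ![X, Y] x ↔ ∃ a b : ℝ, a • X x + b • Y x = v := by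
  rw [mem_frameSpan]
  constructor
  · rintro ⟨c, hc⟩
    exact ⟨c 0, c 1, by rw [← hc, Fin.sum_univ_two]; rfl⟩
  · rintro ⟨a, b, h⟩
    exact ⟨![a, b], by rw [← h, Fin.sum_univ_two]; rfl⟩

theorem mem_frameSpan_three : v ∈ frameSpan ![X, Y, Z] x ↔
    ∃ a b c : ℝ, a • X x + b • Y x + c • Z x = v := by
  rw [mem_frameSpan]
  constructor
  · rintro ⟨c, hc⟩
    exact ⟨c 0, c 1, c 2, by rw [← hc, Fin.sum_univ_three]; rfl⟩
  · rintro ⟨a, b, c, h⟩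
    exact ⟨![a, b, c], by rw [← h, Fin.sum_univ_three]; rfl⟩

theorem fst_mem_frameSpan_three : X x ∈ frameSpan ![X, Y, Z] x := self_mem_frameSpan ![X, Y, Z] 0 x
theorem snd_mem_frameSpan_three : Y x ∈ frameSpan ![X, Y, Z] x := self_mem_frameSpan ![X, Y, Z] 1 x
theorem trd_mem_frameSpan_three : Z x ∈ frameSpan ![X, Y, Z] x := self_mem_frameSpan ![X, Y, Z] 2 x

theorem eval_two {E : Type*} (X Y : E → E) (x : E) :
    (fun i => (![X, Y] : Fin 2 → E → E) i x) = ![X x, Y x] := by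
  ext i; fin_cases i <;> rfl

theorem eval_three {E : Type*} (X Y Z : E → E) (x : E) :
    (fun i => (![X, Y, Z] : Fin 3 → E → E) i x) = ![X x, Y x, Z x] := by
  ext i; fin_cases i <;> rfl

theorem eval_four {E : Type*} (X Y Z T : E → E) (x : E) :
    (fun i => (![X, Y, Z, T] : Fin 4 → E → E) i x) = ![X x, Y x, Z x, T x] := by
  ext i; fin_cases i <;> rfl

end Frames

variable {n : ℕ} {D : RSpace n → Submodule ℝ (RSpace n)} {p : RSpace n}

theorem flagAt_succ_eq {D D' : RSpace n → Submodule ℝ (RSpace n)} {q : RSpace n}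
    (h : bracketExtension (fieldSections D q) = fieldSections D' q) (i : ℕ) :
    flagAt D (i + 1) q = flagAt D' i q := by
  rw [flagAt, Function.iterate_succ_apply, h, flagAt]

/-- The first derived module of a Goursat structure, for any frame of the structure. -/
theorem GoursatNear.bracketExtension_eq (hD : GoursatNear D p) (hn : 3 ≤ n)
    {X Y : RSpace n → RSpace n} (hX : SmoothGerm X p) (hY : SmoothGerm Y p)
    (hXY : ∀ᶠ x in 𝓝 p, D x = frameSpan ![X, Y] x) (hli : LinearIndependent ℝ ![X p, Y p]) :
    ∀ᶠ q in 𝓝 p, LinearIndependent ℝ ![X q, Y q, lieBracket ℝ X Y q] ∧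
      bracketExtension (fieldSections D q) =
        fieldSections (frameSpan ![X, Y, lieBracket ℝ X Y]) q := by
  have hli' : ∀ᶠ q in 𝓝 p, LinearIndependent ℝ fun i => (![X, Y] : Fin 2 → _) i q := by
    refine LinearIndependent.eventually_of_continuousAt (fun i => ?_) ?_
    · fin_cases i
      exacts [hX.continuousAt, hY.continuousAt]
    · rw [eval_two]; exact hli
  filter_upwards [hD.finrank_flagAt, hXY.eventually_nhds, hX.eventually, hY.eventually, hli']
    with q hq hXYq hXq hYq hliq
  have hXYs : ∀ i, SmoothGerm ((![X, Y] : Fin 2 → _) i) q := by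
    intro i; fin_cases i
    exacts [hXq, hYq]
  have hsec := fieldSections_congr hXYq
  have hXmem : X ∈ fieldSections (frameSpan ![X, Y]) q :=
    ⟨hXq, Filter.Eventually.of_forall fun x => self_mem_frameSpan ![X, Y] 0 x⟩
  have hYmem : Y ∈ fieldSections (frameSpan ![X, Y]) q :=
    ⟨hYq, Filter.Eventually.of_forall fun x => self_mem_frameSpan ![X, Y] 1 x⟩
  have hall : ∀ᶠ x in 𝓝 q,
      (∀ i, (![X, Y] : Fin 2 → _) i x ∈ frameSpan ![X, Y, lieBracket ℝ X Y] x) ∧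
      ∀ i j, lieBracket ℝ ((![X, Y] : Fin 2 → _) i) ((![X, Y] : Fin 2 → _) j) x ∈
        frameSpan ![X, Y, lieBracket ℝ X Y] x := by
    refine Filter.Eventually.of_forall fun x => ⟨fun i => ?_, fun i j => ?_⟩
    · fin_cases i
      exacts [fst_mem_frameSpan_three, snd_mem_frameSpan_three]
    · fin_cases i <;> fin_cases j
      · simp
      · exact trd_mem_frameSpan_three
      · change lieBracket ℝ Y X x ∈ _
        rw [lieBracket_swap]
        exact Submodule.neg_mem _ trd_mem_frameSpan_three
      · simp
  have hle : flagAt D 1 q ≤ frameSpan ![X, Y, lieBracket ℝ X Y] q := by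
    rintro _ ⟨V, hV, rfl⟩
    rw [Function.iterate_one, hsec] at hV
    exact (eventually_mem_of_mem_bracketExtension hXYs hliq hall hV).self_of_nhds
  -- The span of these three fields contains the three-dimensional `D⁽¹⁾(q)`, which forces
  -- independence.
  have hindep : LinearIndependent ℝ fun i => (![X, Y, lieBracket ℝ X Y] : Fin 3 → _) i q := by
    have h := Submodule.finrank_mono hle
    rw [hq 1 (by omega)] at h
    rw [linearIndependent_iff_card_le_finrank_span, Fintype.card_fin]
    exact h
  refine ⟨by rwa [eval_three] at hindep, ?_⟩
  rw [hsec]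
  refine bracketExtension_fieldSections hXYs hliq (fun j => ?_) hindep hall
  fin_cases j
  exacts [le_bracketExtension _ hXmem, le_bracketExtension _ hYmem,
    lieBracket_mem_bracketExtension hXmem hYmem]

section Brackets

variable {E : Type*} [NormedAddCommGroup E] [NormedSpace ℝ E] {X Y Z C W : E → E}
    {a : E → ℝ} {x : E}

theorem lieBracket_sub_smul_left (hX : DifferentiableAt ℝ X x) (hY : DifferentiableAt ℝ Y x)
    (ha : DifferentiableAt ℝ a x) : lieBracket ℝ (fun y => X y - a y • Y y) W x =
      lieBracket ℝ X W x - a x • lieBracket ℝ Y W x + fderiv ℝ a x (W x) • Y x := by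
  have h : fderiv ℝ (fun y => X y - a y • Y y) x =
      fderiv ℝ X x - (a x • fderiv ℝ Y x + (fderiv ℝ a x).smulRight (Y x)) := by
    rw [fderiv_fun_sub hX (ha.fun_smul hY), fderiv_fun_smul ha hY]
  simp only [lieBracket, h, map_sub, map_smul]
  simp
  module

theorem lieBracket_add_smul_right (hZ : DifferentiableAt ℝ Z x) (hY : DifferentiableAt ℝ Y x)
    (ha : DifferentiableAt ℝ a x) : lieBracket ℝ C (fun y => Z y + a y • Y y) x =
      lieBracket ℝ C Z x + fderiv ℝ a x (C x) • Y x + a x • lieBracket ℝ C Y x := by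
  have h : fderiv ℝ (fun y => Z y + a y • Y y) x =
      fderiv ℝ Z x + (a x • fderiv ℝ Y x + (fderiv ℝ a x).smulRight (Y x)) := by
    rw [fderiv_fun_add hZ (ha.fun_smul hY), fderiv_fun_smul ha hY]
  simp only [lieBracket, h, map_add, map_smul]
  simp
  module

/-- Write `Z = [X, Y]`. If `[X, Z]` equals `a [Y, Z]` modulo `X, Y, Z`, then `C = X - a Y` satisfies
`[C, Z] ∈ span(X, Y, Z)`, and `[C, Y]` differs from `Z` by a multiple of `Y`. The field `[Y, Z]`
heads the frame, so `a` is the coefficient `c 0`. -/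
theorem exists_characteristic_of_mem [FiniteDimensional ℝ E] {p : E} (hX : SmoothGerm X p)
    (hY : SmoothGerm Y p) (hli : LinearIndependent ℝ
      ![lieBracket ℝ Y (lieBracket ℝ X Y) p, X p, Y p, lieBracket ℝ X Y p])
    (h : ∀ᶠ x in 𝓝 p, lieBracket ℝ X (lieBracket ℝ X Y) x ∈
      frameSpan ![lieBracket ℝ Y (lieBracket ℝ X Y), X, Y, lieBracket ℝ X Y] x) :
    ∃ a : E → ℝ, SmoothGerm a p ∧ ∀ᶠ x in 𝓝 p,
      lieBracket ℝ (fun y => X y - a y • Y y) (lieBracket ℝ (fun y => X y - a y • Y y) Y) x ∈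
        frameSpan ![fun y => X y - a y • Y y, Y, lieBracket ℝ (fun y => X y - a y • Y y) Y] x := by
  set Z := lieBracket ℝ X Y with hZdef
  have hZ : SmoothGerm Z p := hX.lieBracket hY
  have hfr : ∀ i, SmoothGerm ((![lieBracket ℝ Y Z, X, Y, Z] : Fin 4 → _) i) p := by
    intro i; fin_cases i
    exacts [hY.lieBracket hZ, hX, hY, hZ]
  obtain ⟨c, hc, hcX⟩ := (hX.lieBracket hZ).exists_coeff hfr (by rw [eval_four]; exact hli) h
  set C : E → E := fun y => X y - c 0 y • Y y with hCdef
  set b : E → ℝ := fun y => fderiv ℝ (c 0) y (Y y) with hbdef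
  have hb : SmoothGerm b p := (hc 0).fderiv.clm_apply hY
  have hCY : lieBracket ℝ C Y =ᶠ[𝓝 p] fun y => Z y + b y • Y y := by
    filter_upwards [hX, hY, hc 0] with x h1 h2 h3
    rw [hCdef, lieBracket_sub_smul_left (h1.differentiableAt (by simp))
      (h2.differentiableAt (by simp)) (h3.differentiableAt (by simp))]
    simp [hZdef, hbdef]
  refine ⟨c 0, hc 0, ?_⟩
  filter_upwards [hCY.eventuallyEq_nhds, hX, hY, hZ, hc 0, hb, hcX] with x h1 h2 h3 h4 h5 h6 h7
  have e1 : lieBracket ℝ C (lieBracket ℝ C Y) x = lieBracket ℝ C (fun y => Z y + b y • Y y) x :=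
    Filter.EventuallyEq.lieBracket_vectorField_eq (Filter.EventuallyEq.refl _ _) h1
  have e2 : lieBracket ℝ C Z x = lieBracket ℝ X Z x - c 0 x • lieBracket ℝ Y Z x +
      fderiv ℝ (c 0) x (Z x) • Y x :=
    lieBracket_sub_smul_left (h2.differentiableAt (by simp)) (h3.differentiableAt (by simp))
      (h5.differentiableAt (by simp))
  have e3 := lieBracket_add_smul_right (C := C) (h4.differentiableAt (by simp))
    (h3.differentiableAt (by simp)) (h6.differentiableAt (by simp))
  have e4 : lieBracket ℝ C Y x = Z x + b x • Y x := h1.self_of_nhds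
  have e5 : lieBracket ℝ X Z x =
      c 0 x • lieBracket ℝ Y Z x + c 1 x • X x + c 2 x • Y x + c 3 x • Z x := by
    rw [h7, Fin.sum_univ_four]; rfl
  rw [mem_frameSpan_three]
  -- The coefficients come from expanding `[C, Z + b Y]` and substituting `X = C + c₀ Y` and `Z =
  -- [C, Y] - b Y`, where `b = Y(c₀)`.
  refine ⟨c 1 x, c 1 x * c 0 x + c 2 x - c 3 x * b x + fderiv ℝ (c 0) x (Z x) +
    fderiv ℝ b x (C x), c 3 x + b x, ?_⟩
  rw [e1, e3, e2, e5, e4]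
  simp only [hCdef]
  module

end Brackets

/-- Since `D⁽²⁾` has rank four near `p`, the independent fields `[Y, Z], X, Y, Z` span it there, and
`[X, Z]` has to be a combination of them. -/
theorem GoursatNear.exists_characteristic_of_notMem (hD : GoursatNear D p) (hn : 4 ≤ n)
    {X Y : RSpace n → RSpace n} (hX : SmoothGerm X p) (hY : SmoothGerm Y p)
    (hXY : ∀ᶠ x in 𝓝 p, D x = frameSpan ![X, Y] x) (hli : LinearIndependent ℝ ![X p, Y p])
    (hT : lieBracket ℝ Y (lieBracket ℝ X Y) p ∉ frameSpan ![X, Y, lieBracket ℝ X Y] p) :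
    ∃ C Y : RSpace n → RSpace n, SmoothGerm C p ∧ SmoothGerm Y p ∧
      (∀ᶠ x in 𝓝 p, D x = frameSpan ![C, Y] x) ∧ LinearIndependent ℝ ![C p, Y p] ∧
      ∀ᶠ x in 𝓝 p, lieBracket ℝ C (lieBracket ℝ C Y) x ∈
        frameSpan ![C, Y, lieBracket ℝ C Y] x := by
  have hD1 := hD.bracketExtension_eq (by omega) hX hY hXY hli
  set Z := lieBracket ℝ X Y with hZdef
  have hZ : SmoothGerm Z p := hX.lieBracket hY
  have hli4 : LinearIndependent ℝ ![lieBracket ℝ Y Z p, X p, Y p, Z p] := by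
    refine linearIndependent_finCons.2 ⟨hD1.self_of_nhds.1, ?_⟩
    rw [frameSpan, eval_three] at hT
    exact hT
  have hli4' : ∀ᶠ q in 𝓝 p, LinearIndependent ℝ fun i =>
      (![lieBracket ℝ Y Z, X, Y, Z] : Fin 4 → _) i q := by
    refine LinearIndependent.eventually_of_continuousAt (fun i => ?_) ?_
    · fin_cases i
      exacts [(hY.lieBracket hZ).continuousAt, hX.continuousAt, hY.continuousAt, hZ.continuousAt]
    · rw [eval_four]; exact hli4
  have hmem : ∀ᶠ q in 𝓝 p, lieBracket ℝ X Z q ∈ frameSpan ![lieBracket ℝ Y Z, X, Y, Z] q := by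
    filter_upwards [hD.finrank_flagAt, hD1, hli4', hX.eventually, hY.eventually, hZ.eventually]
      with q hq hq1 hqli hXq hYq hZq
    have hr := hq 2 (by omega)
    rw [flagAt_succ_eq hq1.2] at hr
    have mX : X ∈ fieldSections (frameSpan ![X, Y, Z]) q :=
      ⟨hXq, Filter.Eventually.of_forall fun x => fst_mem_frameSpan_three⟩
    have mY : Y ∈ fieldSections (frameSpan ![X, Y, Z]) q :=
      ⟨hYq, Filter.Eventually.of_forall fun x => snd_mem_frameSpan_three⟩
    have mZ : Z ∈ fieldSections (frameSpan ![X, Y, Z]) q :=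
      ⟨hZq, Filter.Eventually.of_forall fun x => trd_mem_frameSpan_three⟩
    have hle : frameSpan ![lieBracket ℝ Y Z, X, Y, Z] q ≤ flagAt (frameSpan ![X, Y, Z]) 1 q := by
      refine frameSpan_le fun i => ?_
      fin_cases i
      exacts [⟨_, lieBracket_mem_bracketExtension mY mZ, rfl⟩, ⟨_, le_bracketExtension _ mX, rfl⟩,
        ⟨_, le_bracketExtension _ mY, rfl⟩, ⟨_, le_bracketExtension _ mZ, rfl⟩]
    rw [Submodule.eq_of_le_of_finrank_eq hle (by
      rw [hr, frameSpan, finrank_span_eq_card hqli, Fintype.card_fin])]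
    exact ⟨_, lieBracket_mem_bracketExtension mX mZ, rfl⟩
  obtain ⟨a, ha, hCa⟩ := exists_characteristic_of_mem hX hY hli4 hmem
  refine ⟨fun y => X y - a y • Y y, Y, hX.sub (ha.smul hY), hY, ?_, ?_, hCa⟩
  · filter_upwards [hXY] with x hx
    rw [hx]
    ext v
    rw [mem_frameSpan_two, mem_frameSpan_two]
    constructor
    · rintro ⟨c, d, rfl⟩
      exact ⟨c, c * a x + d, by module⟩
    · rintro ⟨c, d, rfl⟩
      exact ⟨c, d - c * a x, by module⟩
  · rw [LinearIndependent.pair_iff] at hli ⊢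
    intro s t hst
    obtain ⟨h1, h2⟩ := hli s (t - s * a p) (by rw [← hst]; module)
    subst h1
    exact ⟨rfl, by simpa using h2⟩

/-- A Goursat structure has a frame whose first member is characteristic for the derived
structure. -/
theorem GoursatNear.exists_characteristic (hD : GoursatNear D p) (hn : 3 ≤ n) :
    ∃ C Y : RSpace n → RSpace n, SmoothGerm C p ∧ SmoothGerm Y p ∧
      (∀ᶠ x in 𝓝 p, D x = frameSpan ![C, Y] x) ∧ LinearIndependent ℝ ![C p, Y p] ∧
      ∀ᶠ x in 𝓝 p, lieBracket ℝ C (lieBracket ℝ C Y) x ∈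
        frameSpan ![C, Y, lieBracket ℝ C Y] x := by
  obtain ⟨X, Y, hX, hY, hli, hXY⟩ := hD.exists_frame
  have hD1 := hD.bracketExtension_eq hn hX hY hXY hli
  obtain rfl | hn4 := hn.eq_or_lt
  -- For `n = 3` the derived structure is the whole tangent space, so the characteristic condition
  -- is empty.
  · refine ⟨X, Y, hX, hY, hXY, hli, ?_⟩
    filter_upwards [hD1] with x hx
    rw [frameSpan, eval_three, hx.1.span_eq_top_of_card_eq_finrank' (by simp)]
    exact Submodule.mem_top
  by_cases hT : lieBracket ℝ Y (lieBracket ℝ X Y) p ∈ frameSpan ![X, Y, lieBracket ℝ X Y] p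
  swap
  · exact hD.exists_characteristic_of_notMem hn4 hX hY hXY hli hT
  -- When `[Y, Z]` lies in `D⁽¹⁾(p)`, the roles of `X` and `Y` are exchanged. If `[X, Z]` lay there
  -- too, `D⁽²⁾(p)` would have rank at most three instead of four.
  have hneg : lieBracket ℝ Y X = -lieBracket ℝ X Y := funext fun x => lieBracket_swap
  refine hD.exists_characteristic_of_notMem hn4 hY hX ?_ ?_ ?_
  · filter_upwards [hXY] with x hx
    rw [hx]
    ext v
    rw [mem_frameSpan_two, mem_frameSpan_two]
    constructor <;> rintro ⟨a, b, rfl⟩ <;> exact ⟨b, a, add_comm _ _⟩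
  · exact LinearIndependent.pair_symm_iff.1 hli
  intro hS
  have hS' : lieBracket ℝ X (lieBracket ℝ X Y) p ∈ frameSpan ![X, Y, lieBracket ℝ X Y] p := by
    have e : lieBracket ℝ X (lieBracket ℝ Y X) p = -lieBracket ℝ X (lieBracket ℝ X Y) p := by
      rw [hneg]
      simp [lieBracket, fderiv_neg]
      abel
    rw [e, mem_frameSpan_three] at hS
    obtain ⟨a, b, c, h⟩ := hS
    rw [mem_frameSpan_three]
    refine ⟨-b, -a, c, ?_⟩
    rw [← neg_neg (lieBracket ℝ X (lieBracket ℝ X Y) p), ← h, hneg]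
    simp only [Pi.neg_apply]
    module
  have hr := hD.finrank_flagAt.self_of_nhds 2 (by omega)
  rw [flagAt_succ_eq hD1.self_of_nhds.2] at hr
  set Z := lieBracket ℝ X Y with hZdef
  have hZ : SmoothGerm Z p := hX.lieBracket hY
  have hle : flagAt (frameSpan ![X, Y, Z]) 1 p ≤ frameSpan ![X, Y, Z] p := by
    rintro _ ⟨V, hV, rfl⟩
    have hsm : ∀ i, SmoothGerm ((![X, Y, Z] : Fin 3 → _) i) p := by
      intro i; fin_cases i
      exacts [hX, hY, hZ]
    -- Both memberships are known at `p` alone, whereas the lemma wants a field of subspaces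
    -- containing the brackets at all nearby points. Adjoining the two brackets to the span gives
    -- such a field, and it collapses to the span at `p`.
    have := (eventually_mem_of_mem_bracketExtension hsm
      (by rw [eval_three]; exact hD1.self_of_nhds.1)
      (S := fun x => frameSpan ![X, Y, Z] x ⊔
        Submodule.span ℝ {lieBracket ℝ X Z x, lieBracket ℝ Y Z x}) ?_ hV).self_of_nhds
    · refine (sup_le le_rfl (Submodule.span_le.2 ?_) :
        frameSpan ![X, Y, Z] p ⊔ _ ≤ frameSpan ![X, Y, Z] p) this
      rintro _ (rfl | rfl)
      exacts [hS', hT]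
    · refine Filter.Eventually.of_forall fun x => ⟨fun i => Submodule.mem_sup_left
        (self_mem_frameSpan _ i x), ?_⟩
      have mXZ : lieBracket ℝ X Z x ∈ frameSpan ![X, Y, Z] x ⊔
          Submodule.span ℝ {lieBracket ℝ X Z x, lieBracket ℝ Y Z x} :=
        Submodule.mem_sup_right (Submodule.subset_span (by simp))
      have mYZ : lieBracket ℝ Y Z x ∈ frameSpan ![X, Y, Z] x ⊔
          Submodule.span ℝ {lieBracket ℝ X Z x, lieBracket ℝ Y Z x} :=
        Submodule.mem_sup_right (Submodule.subset_span (by simp))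
      have mXY : lieBracket ℝ X Y x ∈ frameSpan ![X, Y, Z] x ⊔
          Submodule.span ℝ {lieBracket ℝ X Z x, lieBracket ℝ Y Z x} :=
        Submodule.mem_sup_left trd_mem_frameSpan_three
      have hanti : ∀ {V W : RSpace n → RSpace n} {S : Submodule ℝ (RSpace n)},
          lieBracket ℝ V W x ∈ S → lieBracket ℝ W V x ∈ S := by
        intro V W S h
        rw [lieBracket_swap]; exact S.neg_mem h
      intro i j
      fin_cases i <;> fin_cases j
      exacts [by simp, mXY, mXZ, hanti mXY, by simp, mYZ, hanti mXZ, hanti mYZ, by simp]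
  have h3 := Submodule.finrank_mono hle
  have h4 : Module.finrank ℝ (frameSpan ![X, Y, Z] p) ≤ 3 := by
    exact (finrank_range_le_card (R := ℝ) fun i => (![X, Y, Z] : Fin 3 → _) i p).trans_eq (by simp)
  omega

end Characteristic
end

noncomputable section

/-! ### Splitting off the last coordinate -/

section LastCoordinate

/-- Forgetting the last coordinate. -/
def initL (n : ℕ) : RSpace (n + 1) →L[ℝ] RSpace n :=
  LinearMap.toContinuousLinearMap
    { toFun := fun x => WithLp.toLp 2 fun j : Fin n => x j.castSucc
      map_add' := fun _ _ => rfl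
      map_smul' := fun _ _ => rfl }

/-- The inclusion of `ℝⁿ` as the hyperplane on which the last coordinate vanishes. -/
def inclL (n : ℕ) : RSpace n →L[ℝ] RSpace (n + 1) :=
  LinearMap.toContinuousLinearMap
    { toFun := fun x => WithLp.toLp 2 (Fin.snoc (α := fun _ => ℝ) x 0)
      map_add' := fun x y => by
        ext j
        refine Fin.lastCases ?_ (fun j => ?_) j <;> simp
      map_smul' := fun c x => by
        ext j
        refine Fin.lastCases ?_ (fun j => ?_) j <;> simp }

/-- The last coordinate. -/
def lastL (n : ℕ) : RSpace (n + 1) →L[ℝ] ℝ := EuclideanSpace.proj (Fin.last n)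

/-- The last vector of the standard basis. -/
def lastVec (n : ℕ) : RSpace (n + 1) := EuclideanSpace.single (Fin.last n) 1

variable {n : ℕ}

theorem initL_apply (x : RSpace (n + 1)) (j : Fin n) : initL n x j = x j.castSucc := rfl

theorem inclL_castSucc (x : RSpace n) (j : Fin n) : inclL n x j.castSucc = x j :=
  Fin.snoc_castSucc (α := fun _ => ℝ) _ _ _

theorem inclL_last (x : RSpace n) : inclL n x (Fin.last n) = 0 :=
  Fin.snoc_last (α := fun _ => ℝ) _ _

@[simp] theorem initL_inclL (x : RSpace n) : initL n (inclL n x) = x := by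
  ext j; rw [initL_apply, inclL_castSucc]

@[simp] theorem initL_lastVec : initL n (lastVec n) = 0 := by
  ext j; rw [initL_apply]; simp [lastVec]

@[simp] theorem lastL_inclL (x : RSpace n) : lastL n (inclL n x) = 0 := by
  simp [lastL, inclL_last]

@[simp] theorem lastL_lastVec : lastL n (lastVec n) = 1 := by
  simp [lastL, lastVec]

theorem lastVec_ne_zero : lastVec n ≠ 0 := fun h => by
  have := lastL_lastVec (n := n)
  rw [h, map_zero] at this
  exact zero_ne_one this

theorem inclL_initL_add (x : RSpace (n + 1)) :
    inclL n (initL n x) + lastL n x • lastVec n = x := by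
  ext j
  refine Fin.lastCases ?_ (fun j => ?_) j
  · simp [inclL_last, lastL, lastVec]
  · simp [inclL_castSucc, initL_apply, lastVec]

theorem liftField_apply (f : RSpace n → RSpace n) (x : RSpace (n + 1)) :
    liftField f x = inclL n (f (initL n x)) := rfl

theorem finrank_comap_initL (S : Submodule ℝ (RSpace n)) :
    Module.finrank ℝ (S.comap (initL n).toLinearMap) = Module.finrank ℝ S + 1 := by
  let e : (S.comap (initL n).toLinearMap) ≃ₗ[ℝ] S × ℝ :=
    { toFun := fun v => (⟨initL n v, v.2⟩, lastL n v)
      map_add' := fun _ _ => rfl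
      map_smul' := fun _ _ => rfl
      invFun := fun w => ⟨inclL n w.1 + w.2 • lastVec n, by simp⟩
      left_inv := fun v => Subtype.ext (inclL_initL_add v.1)
      right_inv := fun w => by ext <;> simp }
  rw [e.finrank_eq, Module.finrank_prod, Module.finrank_self]

/-- A map whose derivative along the last coordinate vanishes is locally independent of this
coordinate. -/
theorem SmoothGerm.eventually_eq_inclL_initL {F : Type*} [NormedAddCommGroup F] [NormedSpace ℝ F]
    {f : RSpace (n + 1) → F} (hf : SmoothGerm f 0)
    (h : ∀ᶠ x in 𝓝 0, fderiv ℝ f x (lastVec n) = 0) :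
    ∀ᶠ x in 𝓝 0, f x = f (inclL n (initL n x)) := by
  obtain ⟨r, hr, hball⟩ := Metric.eventually_nhds_iff_ball.1 (hf.and h)
  have hc : ContinuousAt (fun x => inclL n (initL n x)) (0 : RSpace (n + 1)) := by fun_prop
  filter_upwards [Metric.ball_mem_nhds (0 : RSpace (n + 1)) hr,
    hc.preimage_mem_nhds (by simpa using Metric.ball_mem_nhds (0 : RSpace (n + 1)) hr)]
      with x hx hx'
  set y := inclL n (initL n x) with hy
  have hline : ∀ s : ℝ, HasDerivAt (fun s : ℝ => y + s • (x - y)) (x - y) s := fun s => by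
    simpa using ((hasDerivAt_id s).smul_const (x - y)).const_add y
  have hxy : x - y = lastL n x • lastVec n := by
    exact sub_eq_of_eq_add' (inclL_initL_add x).symm
  have hd : ∀ s ∈ Set.Icc (0 : ℝ) 1, HasDerivAt (fun s : ℝ => f (y + s • (x - y))) 0 s := by
    intro s hs
    have hmem : y + s • (x - y) ∈ Metric.ball (0 : RSpace (n + 1)) r :=
      (convex_ball (0 : RSpace (n + 1)) r).add_smul_sub_mem (x := y) hx' hx hs
    have h1 := ((hball _ hmem).1.differentiableAt (by simp)).hasFDerivAt.comp_hasDerivAt s (hline s)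
    rw [hxy, map_smul, ← hxy, (hball _ hmem).2, smul_zero] at h1
    exact h1
  have := norm_image_sub_le_of_norm_deriv_le_segment_01' (C := 0)
    (fun s hs => (hd s hs).hasDerivWithinAt) (fun s _ => by simp)
  simp only [one_smul, zero_smul, add_zero, add_sub_cancel, norm_le_zero_iff] at this
  exact sub_eq_zero.1 this

end LastCoordinate

/-! ### Pullback modules along the projection `initL` -/

section Quotient

open VectorField

variable {n : ℕ} {S : Submodule ℝ (RSpace n → RSpace n)} {q : RSpace (n + 1)}

/-- The module of germs at `q` generated by the pullbacks of the members of `S`. -/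
def pullbackModule (S : Submodule ℝ (RSpace n → RSpace n)) (q : RSpace (n + 1)) :
    Submodule ℝ (RSpace (n + 1) → RSpace n) :=
  Submodule.span ℝ {U | ∃ (a : RSpace (n + 1) → ℝ) (W : RSpace n → RSpace n), SmoothGerm a q ∧
    W ∈ S ∧ U =ᶠ[𝓝 q] fun x => a x • W (initL n x)}

theorem smul_comp_initL_mem {a : RSpace (n + 1) → ℝ} {W : RSpace n → RSpace n}
    (ha : SmoothGerm a q) (hW : W ∈ S) :
    (fun x => a x • W (initL n x)) ∈ pullbackModule S q :=
  Submodule.subset_span ⟨a, W, ha, hW, Filter.EventuallyEq.rfl⟩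

/-- A scalar can be absorbed into the coefficient of a generator, so `P` need not be closed under
scalars. Smoothness is proved alongside because the `add` case may use it to differentiate sums. -/
theorem pullbackModule_induction {P : (RSpace (n + 1) → RSpace n) → Prop}
    (congr : ∀ U U' : RSpace (n + 1) → RSpace n, U' =ᶠ[𝓝 q] U → P U → P U')
    (mem : ∀ (a : RSpace (n + 1) → ℝ) W, SmoothGerm a q → W ∈ S → P fun x => a x • W (initL n x))
    (add : ∀ U U' : RSpace (n + 1) → RSpace n, SmoothGerm U q → SmoothGerm U' q →
      P U → P U' → P fun x => U x + U' x)
    (hS : IsFieldModule S (initL n q)) {U : RSpace (n + 1) → RSpace n}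
    (hU : U ∈ pullbackModule S q) : SmoothGerm U q ∧ P U := by
  have hsm : ∀ (a : RSpace (n + 1) → ℝ) W, SmoothGerm a q → W ∈ S →
    SmoothGerm (fun x => a x • W (initL n x)) q :=
    fun a W ha hW => ha.smul ((hS.smooth W hW).comp (SmoothGerm.clm (initL n)))
  have h : ∀ c : ℝ, SmoothGerm (fun x => c • U x) q ∧ P fun x => c • U x := by
    refine Submodule.span_induction (p := fun U _ => ∀ c : ℝ, SmoothGerm (fun x => c • U x) q ∧
      P fun x => c • U x) ?_ ?_ ?_ ?_ hU
    · rintro U ⟨a, W, ha, hW, hU⟩ c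
      have ha' : SmoothGerm (fun x => c * a x) q := (SmoothGerm.const c).mul ha
      have hU' : (fun x => c • U x) =ᶠ[𝓝 q] fun x => (c * a x) • W (initL n x) := by
        filter_upwards [hU] with x hx
        rw [hx, smul_smul]
      exact ⟨(hsm _ W ha' hW).congr hU', congr _ _ hU' (mem _ W ha' hW)⟩
    · intro c
      have h0 : (fun x : RSpace (n + 1) => c • (0 : RSpace (n + 1) → RSpace n) x) =ᶠ[𝓝 q]
          fun x => (0 : ℝ) • (0 : RSpace n → RSpace n) (initL n x) :=
        Filter.Eventually.of_forall fun x => by simp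
      exact ⟨(hsm _ 0 (SmoothGerm.const 0) S.zero_mem).congr h0,
        congr _ _ h0 (mem _ 0 (SmoothGerm.const 0) S.zero_mem)⟩
    · intro U U' _ _ h h' c
      simp only [Pi.add_apply, smul_add]
      exact ⟨(h c).1.add (h' c).1, add _ _ (h c).1 (h' c).1 (h c).2 (h' c).2⟩
    · intro d U _ h c
      simp only [Pi.smul_apply, smul_smul]
      exact h (c * d)
  simpa using h 1

theorem pullbackModule_congr {U U' : RSpace (n + 1) → RSpace n} (hU : U ∈ pullbackModule S q)
    (h : U' =ᶠ[𝓝 q] U) : U' ∈ pullbackModule S q := by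
  have h0 : U' - U ∈ pullbackModule S q := by
    refine Submodule.subset_span ⟨fun _ => 0, 0, SmoothGerm.const 0, S.zero_mem, ?_⟩
    filter_upwards [h] with x hx
    simp [hx]
  have := Submodule.add_mem _ hU h0
  rwa [add_sub_cancel] at this

variable (hS : IsFieldModule S (initL n q))

include hS in
theorem smul_mem_pullbackModule {U : RSpace (n + 1) → RSpace n} (hU : U ∈ pullbackModule S q)
    {a : RSpace (n + 1) → ℝ} (ha : SmoothGerm a q) : (fun x => a x • U x) ∈ pullbackModule S q := by
  refine (pullbackModule_induction (P := fun U => (fun x => a x • U x) ∈ pullbackModule S q)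
    ?_ ?_ ?_ hS hU).2
  · intro U U' h hU
    refine pullbackModule_congr hU ?_
    filter_upwards [h] with x hx
    rw [hx]
  · intro b W hb hW
    simp only [smul_smul]
    exact smul_comp_initL_mem (ha.mul hb) hW
  · intro U U' _ _ h h'
    simp only [smul_add]
    exact Submodule.add_mem _ h h'

include hS in
theorem apply_mem_of_mem_pullbackModule {U : RSpace (n + 1) → RSpace n}
    (hU : U ∈ pullbackModule S q) : U q ∈ S.map (LinearMap.proj (initL n q)) := by
  refine (pullbackModule_induction (P := fun U => U q ∈ S.map (LinearMap.proj (initL n q)))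
    ?_ ?_ ?_ hS hU).2
  · intro U U' h hU
    rwa [h.self_of_nhds]
  · intro b W _ hW
    exact Submodule.smul_mem _ _ ⟨W, hW, rfl⟩
  · intro U U' _ _ h h'
    exact Submodule.add_mem _ h h'

theorem fderiv_smul_comp_initL {a : RSpace (n + 1) → ℝ} {W : RSpace n → RSpace n}
    {x : RSpace (n + 1)} (ha : DifferentiableAt ℝ a x) (hW : DifferentiableAt ℝ W (initL n x))
    (v : RSpace (n + 1)) : fderiv ℝ (fun y => a y • W (initL n y)) x v =
      fderiv ℝ a x v • W (initL n x) + a x • fderiv ℝ W (initL n x) (initL n v) := by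
  have h := (ha.hasFDerivAt.smul (hW.hasFDerivAt.comp x (initL n).hasFDerivAt)).fderiv
  have h' : fderiv ℝ (fun y => a y • W (initL n y)) x = _ := h
  rw [h']
  simp [add_comm]

include hS in
-- Pulled-back fields are constant along the last coordinate, so only the coefficients get
-- differentiated.
theorem fderiv_lastVec_mem_pullbackModule {U : RSpace (n + 1) → RSpace n}
    (hU : U ∈ pullbackModule S q) : (fun x => fderiv ℝ U x (lastVec n)) ∈ pullbackModule S q := by
  refine (pullbackModule_induction
    (P := fun U => (fun x => fderiv ℝ U x (lastVec n)) ∈ pullbackModule S q) ?_ ?_ ?_ hS hU).2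
  · intro U U' h hU
    refine pullbackModule_congr hU ?_
    filter_upwards [h.fderiv (𝕜 := ℝ)] with x hx
    rw [hx]
  · intro b W hb hW
    refine pullbackModule_congr (smul_comp_initL_mem
      (hb.fderiv.clm_apply (SmoothGerm.const (lastVec n))) hW) ?_
    filter_upwards [hb, (initL n).continuous.continuousAt.eventually (hS.smooth W hW)] with x h1 h2
    rw [fderiv_smul_comp_initL (h1.differentiableAt (by simp)) (h2.differentiableAt (by simp))]
    simp
  · intro U U' h1 h2 h h'
    refine pullbackModule_congr (Submodule.add_mem _ h h') ?_
    filter_upwards [h1, h2] with x h1 h2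
    rw [fderiv_fun_add (h1.differentiableAt (by simp)) (h2.differentiableAt (by simp))]
    rfl

end Quotient
end

noncomputable section

/-! ### The derived flag of a pulled-back field of subspaces -/

section Quotient

open VectorField

variable {n : ℕ} {S : Submodule ℝ (RSpace n → RSpace n)} {q : RSpace (n + 1)}

theorem pullbackModule_mono {S' : Submodule ℝ (RSpace n → RSpace n)} (h : S ≤ S') :
    pullbackModule S q ≤ pullbackModule S' q :=
  Submodule.span_mono fun _ ⟨a, W, ha, hW, hU⟩ => ⟨a, W, ha, h hW, hU⟩

/-- The bracket of the lifts of `U` and `U'`, viewed along `ℝⁿ`. -/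
def horizontalBracket (U U' : RSpace (n + 1) → RSpace n) (x : RSpace (n + 1)) : RSpace n :=
  fderiv ℝ U' x (inclL n (U x)) - fderiv ℝ U x (inclL n (U' x))

theorem horizontalBracket_congr {U U' U₁ U₁' : RSpace (n + 1) → RSpace n} (h : U₁ =ᶠ[𝓝 q] U)
    (h' : U₁' =ᶠ[𝓝 q] U') : horizontalBracket U₁ U₁' =ᶠ[𝓝 q] horizontalBracket U U' := by
  filter_upwards [h, h', h.fderiv (𝕜 := ℝ), h'.fderiv (𝕜 := ℝ)] with x h1 h2 h3 h4
  rw [horizontalBracket, h1, h2, h3, h4, horizontalBracket]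

/-- On generators this is `[a W, b W'] = a b [W, W'] + b' W' - a' W`, where `b'` and `a'` are
derivatives of the coefficients along the other field. An induction in each argument reduces to that
case. -/
theorem horizontalBracket_mem (hS : IsFieldModule S (initL n q)) {U U' : RSpace (n + 1) → RSpace n}
    (hU : U ∈ pullbackModule S q) (hU' : U' ∈ pullbackModule S q) :
    horizontalBracket U U' ∈ pullbackModule (bracketExtension S) q := by
  have hS' := hS.bracketExtension
  refine (pullbackModule_induction
    (P := fun U => horizontalBracket U U' ∈ pullbackModule (bracketExtension S) q)
    (fun U U₁ h hU => pullbackModule_congr hU (horizontalBracket_congr h Filter.EventuallyEq.rfl))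
    ?_ ?_ hS hU).2
  · intro a W ha hW
    have hWs := (initL n).continuous.continuousAt.eventually (hS.smooth W hW)
    refine (pullbackModule_induction
      (P := fun U' => horizontalBracket (fun x => a x • W (initL n x))
      U' ∈ pullbackModule (bracketExtension S) q) (fun U U₁ h hU => pullbackModule_congr hU
        (horizontalBracket_congr Filter.EventuallyEq.rfl h)) ?_ ?_ hS hU').2
    · intro b W' hb hW'
      have hW's := (initL n).continuous.continuousAt.eventually (hS.smooth W' hW')
      have hsW : SmoothGerm (fun x => inclL n (a x • W (initL n x))) q :=
        (ha.smul ((hS.smooth W hW).comp (SmoothGerm.clm (initL n)))).clm_comp _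
      have hsW' : SmoothGerm (fun x => inclL n (b x • W' (initL n x))) q :=
        (hb.smul ((hS.smooth W' hW').comp (SmoothGerm.clm (initL n)))).clm_comp _
      refine pullbackModule_congr (Submodule.add_mem _ (Submodule.add_mem _
        (smul_comp_initL_mem (hb.fderiv.clm_apply hsW) (le_bracketExtension S hW'))
        (smul_comp_initL_mem (ha.fderiv.clm_apply hsW').neg (le_bracketExtension S hW)))
        (smul_comp_initL_mem (ha.mul hb) (lieBracket_mem_bracketExtension hW hW'))) ?_
      filter_upwards [ha, hb, hWs, hW's] with x h1 h2 h3 h4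
      rw [horizontalBracket,
        fderiv_smul_comp_initL (h1.differentiableAt (by simp)) (h3.differentiableAt (by simp)),
        fderiv_smul_comp_initL (h2.differentiableAt (by simp)) (h4.differentiableAt (by simp))]
      simp only [Pi.add_apply, lieBracket, initL_inclL, map_smul]
      module
    · intro V V' hV hV' h h'
      refine pullbackModule_congr (Submodule.add_mem _ h h') ?_
      filter_upwards [hV, hV'] with x h1 h2
      simp only [horizontalBracket, Pi.add_apply,
        fderiv_fun_add (h1.differentiableAt (by simp)) (h2.differentiableAt (by simp)),
        add_apply, map_add]
      abel
  · intro V V' hV hV' h h'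
    refine pullbackModule_congr (Submodule.add_mem _ h h') ?_
    filter_upwards [hV, hV'] with x h1 h2
    simp only [horizontalBracket, Pi.add_apply,
      fderiv_fun_add (h1.differentiableAt (by simp)) (h2.differentiableAt (by simp)),
      add_apply, map_add]
    abel

theorem fderiv_initL_comp {V : RSpace (n + 1) → RSpace (n + 1)} {x : RSpace (n + 1)}
    (hV : DifferentiableAt ℝ V x) (v : RSpace (n + 1)) :
    fderiv ℝ (fun y => initL n (V y)) x v = initL n (fderiv ℝ V x v) := by
  have h : fderiv ℝ (fun y => initL n (V y)) x = (initL n).comp (fderiv ℝ V x) :=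
    ((initL n).hasFDerivAt.comp x hV.hasFDerivAt).fderiv
  rw [h]
  rfl

/-- Each field is split into a horizontal and a vertical part. The vertical parts contribute only
derivatives along the last coordinate, which preserve pullback modules. -/
theorem initL_lieBracket {V W : RSpace (n + 1) → RSpace (n + 1)} {x : RSpace (n + 1)}
    (hV : DifferentiableAt ℝ V x) (hW : DifferentiableAt ℝ W x) :
    initL n (lieBracket ℝ V W x) =
      horizontalBracket (fun y => initL n (V y)) (fun y => initL n (W y)) x +
      lastL n (V x) • fderiv ℝ (fun y => initL n (W y)) x (lastVec n) -
      lastL n (W x) • fderiv ℝ (fun y => initL n (V y)) x (lastVec n) := by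
  simp only [horizontalBracket, fderiv_initL_comp hV, fderiv_initL_comp hW, lieBracket, map_sub]
  conv_lhs => rw [← inclL_initL_add (V x), ← inclL_initL_add (W x)]
  simp only [map_add, map_smul]
  module

variable {k : ℕ} {A : Fin k → RSpace n → RSpace n}
  {D : RSpace (n + 1) → Submodule ℝ (RSpace (n + 1))}

/-- Sections of the derived flag of a pulled back field of subspaces project to combinations of
pullbacks. -/
theorem initL_comp_mem_pullbackModule (hA : ∀ i, SmoothGerm (A i) (initL n q))
    (hli : LinearIndependent ℝ fun i => A i (initL n q))
    (hD : ∀ᶠ x in 𝓝 q, D x = (frameSpan A (initL n x)).comap (initL n).toLinearMap) (i : ℕ)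
    {V : RSpace (n + 1) → RSpace (n + 1)} (hV : V ∈ bracketExtension^[i] (fieldSections D q)) :
    (fun x => initL n (V x)) ∈
      pullbackModule (bracketExtension^[i] (fieldSections (frameSpan A) (initL n q))) q := by
  induction i generalizing V with
  | zero =>
    obtain ⟨hV1, hV2⟩ := hV
    have hmem : ∀ j, A j ∈ fieldSections (frameSpan A) (initL n q) := fun j =>
      ⟨hA j, Filter.Eventually.of_forall fun x => self_mem_frameSpan A j x⟩
    obtain ⟨a, ha, hVa⟩ := (hV1.clm_comp (initL n)).exists_coeff
      (X := fun j x => A j (initL n x)) (fun j => (hA j).comp (SmoothGerm.clm (initL n))) hli (by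
        filter_upwards [hV2, hD] with x h1 h2
        rw [h2] at h1
        exact h1)
    refine pullbackModule_congr (Submodule.sum_mem (t := Finset.univ) _ fun j _ =>
      smul_comp_initL_mem (ha j) (hmem j)) ?_
    filter_upwards [hVa] with x hx
    simp [hx]
  | succ i ih =>
    have hM := (isFieldModule_fieldSections (frameSpan A) (initL n q)).iterate i
    have hM' := (isFieldModule_fieldSections D q).iterate i
    rw [Function.iterate_succ_apply'] at hV ⊢
    refine bracketExtension_induction (P := fun V => (fun x => initL n (V x)) ∈ pullbackModule
      (bracketExtension (bracketExtension^[i] (fieldSections (frameSpan A) (initL n q)))) q)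
      (fun V hV => pullbackModule_mono (le_bracketExtension _) (ih hV)) ?_ ?_ ?_ hV
    · intro V hV W hW
      have hVs := hM'.smooth V hV
      have hWs := hM'.smooth W hW
      have hle := pullbackModule_mono (q := q) (le_bracketExtension
        (bracketExtension^[i] (fieldSections (frameSpan A) (initL n q))))
      refine pullbackModule_congr (Submodule.sub_mem _ (Submodule.add_mem _
        (horizontalBracket_mem hM (ih hV) (ih hW))
        (smul_mem_pullbackModule hM.bracketExtension
          (hle (fderiv_lastVec_mem_pullbackModule hM (ih hW))) (hVs.clm_comp (lastL n))))
        (smul_mem_pullbackModule hM.bracketExtension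
          (hle (fderiv_lastVec_mem_pullbackModule hM (ih hV))) (hWs.clm_comp (lastL n)))) ?_
      filter_upwards [hVs, hWs] with x h1 h2
      exact initL_lieBracket (h1.differentiableAt (by simp)) (h2.differentiableAt (by simp))
    · intro V W h1 h2
      simp only [Pi.add_apply, map_add]
      exact Submodule.add_mem _ h1 h2
    · intro c V h1
      simp only [Pi.smul_apply, map_smul]
      exact Submodule.smul_mem _ c h1

/-- Lifting by translation commutes with brackets. Together with the vertical field, the lifts give
the inclusion from right to left in `flagAt_comap`. -/
theorem liftField_mem_iterate
    (hD : ∀ᶠ x in 𝓝 q, D x = (frameSpan A (initL n x)).comap (initL n).toLinearMap) (i : ℕ)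
    {W : RSpace n → RSpace n}
    (hW : W ∈ bracketExtension^[i] (fieldSections (frameSpan A) (initL n q))) :
    liftField W ∈ bracketExtension^[i] (fieldSections D q) := by
  induction i generalizing W with
  | zero =>
    refine ⟨(SmoothGerm.comp hW.1 (SmoothGerm.clm (initL n))).clm_comp (inclL n), ?_⟩
    filter_upwards [hD, (initL n).continuous.continuousAt.eventually hW.2] with x h1 h2
    rw [h1, liftField_apply]
    simpa using h2
  | succ i ih =>
    have hM := (isFieldModule_fieldSections (frameSpan A) (initL n q)).iterate i
    have hM' := (isFieldModule_fieldSections D q).iterate i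
    rw [Function.iterate_succ_apply'] at hW ⊢
    refine bracketExtension_induction (P := fun V => liftField V ∈
      bracketExtension (bracketExtension^[i] (fieldSections D q)))
      (fun V hV => le_bracketExtension _ (ih hV)) ?_ ?_ ?_ hW
    · intro V hV W hW
      refine hM'.bracketExtension.congr _ (lieBracket_mem_bracketExtension (ih hV) (ih hW)) _ ?_
      have hf : ∀ {V : RSpace n → RSpace n} {x}, DifferentiableAt ℝ V (initL n x) →
          HasFDerivAt (liftField V) ((inclL n).comp ((fderiv ℝ V (initL n x)).comp (initL n))) x :=
        fun {V} {x} hV => (inclL n).hasFDerivAt.comp x (hV.hasFDerivAt.comp x (initL n).hasFDerivAt)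
      filter_upwards [(initL n).continuous.continuousAt.eventually (hM.smooth V hV),
        (initL n).continuous.continuousAt.eventually (hM.smooth W hW)] with x h1 h2
      rw [lieBracket, (hf (h1.differentiableAt (by simp))).fderiv,
        (hf (h2.differentiableAt (by simp))).fderiv]
      simp [liftField_apply, lieBracket]
    · intro V W h1 h2
      have e : liftField (V + W) = liftField V + liftField W := by
        ext1 x; simp [liftField_apply]
      rw [e]
      exact Submodule.add_mem _ h1 h2
    · intro c V h1
      have e : liftField (c • V) = c • liftField V := by
        ext1 x; simp [liftField_apply]
      rw [e]
      exact Submodule.smul_mem _ c h1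

theorem const_lastVec_mem_iterate
    (hD : ∀ᶠ x in 𝓝 q, D x = (frameSpan A (initL n x)).comap (initL n).toLinearMap) (i : ℕ) :
    (fun _ => lastVec n) ∈ bracketExtension^[i] (fieldSections D q) := by
  induction i with
  | zero =>
    refine ⟨SmoothGerm.const _, ?_⟩
    filter_upwards [hD] with x hx
    rw [hx]
    simp
  | succ i ih => rw [Function.iterate_succ_apply']; exact le_bracketExtension _ ih

/-- The derived flag of a pulled back field of subspaces is pulled back. -/
theorem flagAt_comap (hA : ∀ i, SmoothGerm (A i) (initL n q))
    (hli : LinearIndependent ℝ fun i => A i (initL n q))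
    (hD : ∀ᶠ x in 𝓝 q, D x = (frameSpan A (initL n x)).comap (initL n).toLinearMap) (i : ℕ) :
    flagAt D i q = (flagAt (frameSpan A) i (initL n q)).comap (initL n).toLinearMap := by
  apply le_antisymm
  · rintro _ ⟨V, hV, rfl⟩
    exact apply_mem_of_mem_pullbackModule
      ((isFieldModule_fieldSections (frameSpan A) (initL n q)).iterate i)
      (initL_comp_mem_pullbackModule hA hli hD i hV)
  · rintro v ⟨W, hW, hWv⟩
    have hWv' : W (initL n q) = initL n v := hWv
    refine ⟨liftField W + lastL n v • fun _ => lastVec n, Submodule.add_mem _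
      (liftField_mem_iterate hD i hW) (Submodule.smul_mem _ _ (const_lastVec_mem_iterate hD i)), ?_⟩
    change liftField W q + lastL n v • lastVec n = v
    rw [liftField_apply, hWv', inclL_initL_add]

end Quotient
end

noncomputable section

/-! ### Descent of the derived structure to one dimension less -/

section Reduction

open VectorField

variable {n : ℕ}

theorem lieBracket_const_left {E : Type*} [NormedAddCommGroup E] [NormedSpace ℝ E] (e : E)
    (Y : E → E) : lieBracket ℝ (fun _ => e) Y = fun x => fderiv ℝ Y x e := by
  funext x
  simp [lieBracket]

/-- If the plane spanned by `U` and its derivative along the last coordinate is constant to first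
order along this coordinate, then it has a frame which does not depend on it. -/
theorem exists_frame_comp_initL {U U' : RSpace (n + 1) → RSpace n} (hU : SmoothGerm U 0)
    (hU' : ∀ᶠ x in 𝓝 0, U' x = fderiv ℝ U x (lastVec n))
    (hli : LinearIndependent ℝ ![U 0, U' 0])
    (h : ∀ᶠ x in 𝓝 0, ∃ a b : ℝ, a • U x + b • U' x = fderiv ℝ U' x (lastVec n)) :
    ∃ A : Fin 2 → RSpace n → RSpace n, (∀ i, SmoothGerm (A i) 0) ∧
      (LinearIndependent ℝ fun i => A i 0) ∧ ∀ᶠ x in 𝓝 0, ∀ v,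
        v ∈ frameSpan A (initL n x) ↔ ∃ a b : ℝ, a • U x + b • U' x = v := by
  have hsU' : SmoothGerm U' 0 := (hU.fderiv.clm_apply (SmoothGerm.const _)).congr hU'
  let X : Fin 2 → RSpace (n + 1) → RSpace n := ![U, U']
  have hX : ∀ i, SmoothGerm (X i) 0 := by
    intro i; fin_cases i
    exacts [hU, hsU']
  have hXe : ∀ x, (fun i => X i x) = ![U x, U' x] := by
    intro x; ext1 i; fin_cases i <;> rfl
  have hspan : ∀ x v, v ∈ Submodule.span ℝ (Set.range fun i => X i x) ↔
      ∃ a b : ℝ, a • U x + b • U' x = v := by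
    intro x v
    rw [hXe, Matrix.range_cons, Matrix.range_cons, Matrix.range_empty, Set.union_empty,
      Set.singleton_union, Submodule.mem_span_pair]
  obtain ⟨L, A, B, W, hW, hA, hB, hLW⟩ := exists_echelonFrame hX (by rw [hXe]; exact hli)
  have hsp : ∀ᶠ x in 𝓝 0, Submodule.span ℝ (Set.range fun i => X i x) =
      Submodule.span ℝ (Set.range fun i => W i x) := by
    filter_upwards [hLW] with x ⟨_, h2, h3⟩
    refine le_antisymm (Submodule.span_le.2 ?_) (Submodule.span_le.2 ?_)
    · rintro _ ⟨i, rfl⟩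
      simp only [h2 i]
      exact Submodule.sum_mem _ fun j _ => Submodule.smul_mem _ _ (Submodule.subset_span ⟨j, rfl⟩)
    · rintro _ ⟨i, rfl⟩
      simp only [h3 i]
      exact Submodule.sum_mem _ fun j _ => Submodule.smul_mem _ _ (Submodule.subset_span ⟨j, rfl⟩)
  have hdX : ∀ᶠ x in 𝓝 0, ∀ j, fderiv ℝ (X j) x (lastVec n) ∈
      Submodule.span ℝ (Set.range fun i => X i x) := by
    filter_upwards [hU', h] with x h1 h2 j
    rw [hspan]
    fin_cases j
    · exact ⟨0, 1, by rw [zero_smul, one_smul, zero_add]; exact h1⟩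
    · exact h2
  -- The normalisation `L (W i) = eᵢ` is constant, so `L` kills the derivative of `W i` along the
  -- last coordinate. By stationarity of the plane this derivative lies in the span of the `W j`, on
  -- which `L` is injective, so it vanishes.
  have hdW : ∀ i, ∀ᶠ x in 𝓝 0, fderiv ℝ (W i) x (lastVec n) = 0 := by
    intro i
    filter_upwards [hdX, hsp, hLW.eventually_nhds, Filter.eventually_all.2 hX,
      Filter.eventually_all.2 hB, hW i] with x h1 h2 h3 h4 h5 h6
    have hL0 : L (fderiv ℝ (W i) x (lastVec n)) = 0 := by
      have e1 : (fun y => L (W i y)) =ᶠ[𝓝 x] fun _ => Pi.single i 1 := by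
        filter_upwards [h3] with y hy using hy.1 i
      have e2 : fderiv ℝ (fun y => L (W i y)) x = L.comp (fderiv ℝ (W i) x) :=
        (L.hasFDerivAt.comp x (h6.differentiableAt (by simp)).hasFDerivAt).fderiv
      rw [e1.fderiv_eq] at e2
      simpa using (DFunLike.congr_fun e2 (lastVec n)).symm
    have hmem : fderiv ℝ (W i) x (lastVec n) ∈
        Submodule.span ℝ (Set.range fun i => W i x) := by
      rw [← h2]
      have e1 : W i =ᶠ[𝓝 x] fun y => ∑ j, B i y j • X j y := by
        filter_upwards [h3] with y hy using hy.2.2 i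
      have hBd : ∀ j, DifferentiableAt ℝ (fun y => B i y j) x := fun j =>
        differentiableAt_pi.1 ((h5 i).differentiableAt (by simp)) j
      have hXd : ∀ j, DifferentiableAt ℝ (X j) x := fun j => (h4 j).differentiableAt (by simp)
      have e2 : fderiv ℝ (fun y => ∑ j, B i y j • X j y) x =
          ∑ j, fderiv ℝ (fun y => B i y j • X j y) x :=
        fderiv_fun_sum fun j _ => (hBd j).fun_smul (hXd j)
      rw [e1.fderiv_eq, e2, sum_apply]
      refine Submodule.sum_mem _ fun j _ => ?_
      rw [fderiv_fun_smul (hBd j) (hXd j)]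
      exact Submodule.add_mem _ (Submodule.smul_mem _ _ (h1 j))
        (Submodule.smul_mem _ _ (Submodule.subset_span ⟨j, rfl⟩))
    obtain ⟨c, hc⟩ := (Submodule.mem_span_range_iff_exists_fun ℝ).1 hmem
    rw [← hc, map_sum] at hL0
    simp only [map_smul, h3.self_of_nhds.1] at hL0
    rw [← pi_eq_sum_univ' c] at hL0
    rw [← hc, hL0]
    simp
  have hconst := Filter.eventually_all.2 fun i => (hW i).eventually_eq_inclL_initL (hdW i)
  refine ⟨fun i z => W i (inclL n z), fun i =>
    SmoothGerm.comp (by rw [map_zero]; exact hW i) (SmoothGerm.clm (inclL n)), ?_, ?_⟩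
  · simp only [map_zero]
    have h0 := hsp.self_of_nhds
    rw [linearIndependent_iff_card_le_finrank_span, Set.finrank, ← h0, hXe,
      finrank_span_eq_card hli]
  · filter_upwards [hsp, hconst] with x h1 h2 v
    rw [← hspan, h1, frameSpan]
    simp only [← h2]

/-- If the last coordinate field is characteristic for the derived structure of a Goursat structure,
then the derived structure descends to a Goursat structure. -/
theorem GoursatNear.exists_quotient {D : RSpace (n + 1) → Submodule ℝ (RSpace (n + 1))}
    (hn : 2 ≤ n) (hD : GoursatNear D 0) {Y : RSpace (n + 1) → RSpace (n + 1)} (hY : SmoothGerm Y 0)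
    (hDY : ∀ᶠ x in 𝓝 0, D x = frameSpan ![fun _ => lastVec n, Y] x)
    (hli : LinearIndependent ℝ ![lastVec n, Y 0])
    (hchar : ∀ᶠ x in 𝓝 0,
      lieBracket ℝ (fun _ => lastVec n) (lieBracket ℝ (fun _ => lastVec n) Y) x ∈
        frameSpan ![fun _ => lastVec n, Y, lieBracket ℝ (fun _ => lastVec n) Y] x) :
    ∃ D' : RSpace n → Submodule ℝ (RSpace n), GoursatNear D' 0 ∧
      (∀ᶠ x in 𝓝 0, initL n (Y x) ∈ D' (initL n x)) ∧
      LinearIndependent ℝ ![initL n (Y 0), initL n (fderiv ℝ Y 0 (lastVec n))] := by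
  have hD1 := hD.bracketExtension_eq (by omega) (SmoothGerm.const (lastVec n)) hY hDY hli
  rw [lieBracket_const_left] at hD1 hchar
  rw [lieBracket_const_left] at hchar
  set Y' : RSpace (n + 1) → RSpace (n + 1) := fun x => fderiv ℝ Y x (lastVec n) with hY'
  have hsY' : SmoothGerm Y' 0 := hY.fderiv.clm_apply (SmoothGerm.const _)
  let U : RSpace (n + 1) → RSpace n := fun x => initL n (Y x)
  let U' : RSpace (n + 1) → RSpace n := fun x => initL n (Y' x)
  have hU' : ∀ᶠ x in 𝓝 0, U' x = fderiv ℝ U x (lastVec n) := by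
    filter_upwards [hY] with x hx
    exact (fderiv_initL_comp (hx.differentiableAt (by simp)) _).symm
  -- Projecting the characteristic relation removes the multiple of the last coordinate field: the
  -- second derivative of `U` stays in the plane of `U` and `U'`.
  have hU'' : ∀ᶠ x in 𝓝 0, ∃ a b : ℝ, a • U x + b • U' x = fderiv ℝ U' x (lastVec n) := by
    filter_upwards [hsY', hchar] with x hx h
    obtain ⟨a, b, c, h⟩ := mem_frameSpan_three.1 h
    refine ⟨b, c, ?_⟩
    rw [fderiv_initL_comp (hx.differentiableAt (by simp)), ← h]
    simp [U, U']
  have hUli : LinearIndependent ℝ ![U 0, U' 0] := by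
    have h3 := hD1.self_of_nhds.1
    rw [LinearIndependent.pair_iff]
    intro s t hst
    have hst' : initL n (s • Y 0 + t • Y' 0) = 0 := by
      rw [map_add, map_smul, map_smul]; exact hst
    have hv := inclL_initL_add (s • Y 0 + t • Y' 0)
    rw [hst', map_zero, zero_add] at hv
    have := Fintype.linearIndependent_iff.1 h3
      ![-lastL n (s • Y 0 + t • Y' 0), s, t] (by
        rw [Fin.sum_univ_three]
        change -lastL n (s • Y 0 + t • Y' 0) • lastVec n + s • Y 0 + t • Y' 0 = 0
        rw [neg_smul, hv]
        abel)
    exact ⟨this 1, this 2⟩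
  obtain ⟨A, hA, hAli, hAU⟩ := exists_frame_comp_initL (hY.clm_comp (initL n)) hU' hUli hU''
  have hA2 : A = ![A 0, A 1] := by ext1 i; fin_cases i <;> rfl
  have hcomap : ∀ᶠ x in 𝓝 0, frameSpan ![fun _ => lastVec n, Y, Y'] x =
      (frameSpan A (initL n x)).comap (initL n).toLinearMap := by
    filter_upwards [hAU] with x hx
    ext v
    rw [mem_frameSpan_three, Submodule.mem_comap]
    refine Iff.trans ?_ (hx (initL n v)).symm
    constructor
    · rintro ⟨a, b, c, rfl⟩
      exact ⟨b, c, by simp [U']⟩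
    · rintro ⟨b, c, h⟩
      have hw : initL n (v - (b • Y x + c • Y' x)) = 0 := by
        rw [map_sub, ← h]
        simp [U']
      have hv := inclL_initL_add (v - (b • Y x + c • Y' x))
      rw [hw, map_zero, zero_add] at hv
      exact ⟨_, b, c, by rw [hv]; abel⟩
  have hAli' : ∀ᶠ z in 𝓝 0, LinearIndependent ℝ fun i => A i z :=
    LinearIndependent.eventually_of_continuousAt (fun i => (hA i).continuousAt) hAli
  refine ⟨frameSpan A, ⟨⟨A 0, A 1, hA 0, hA 1, ?_, ?_⟩, ?_⟩, ?_, hUli⟩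
  · rw [← eval_two, ← hA2]; exact hAli
  · rw [← hA2]
    exact Filter.Eventually.of_forall fun _ => rfl
  · have hc : ContinuousAt (inclL n) 0 := (inclL n).continuous.continuousAt
    have hc' : ∀ {P : RSpace (n + 1) → Prop}, (∀ᶠ x in 𝓝 0, P x) → ∀ᶠ z in 𝓝 0, P (inclL n z) :=
      fun hP => hc.eventually (by rw [map_zero]; exact hP)
    filter_upwards [hc' hD1, hc' hcomap.eventually_nhds, hc' hD.finrank_flagAt, hAli',
      Filter.eventually_all.2 fun i => (hA i).eventually] with z h1 h2 h3 h4 h5 i hi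
    -- Step `i` of the quotient flag corresponds to step `i + 1` of the flag of `D`, and the fibre
    -- adds one dimension: `i + 3 = (i + 2) + 1`.
    have h6 := h3 (i + 1) (by omega)
    rw [flagAt_succ_eq h1.2, flagAt_comap (A := A) (by simpa using h5) (by simpa using h4) h2,
      finrank_comap_initL, initL_inclL] at h6
    omega
  · filter_upwards [hAU] with x hx
    exact (hx _).2 ⟨1, 0, by simp⟩

end Reduction
end

noncomputable section

/-! ### Invariance of the derived flag under local diffeomorphisms -/

section ManifoldTransfer

open VectorField

variable {n : ℕ} {M : Type*} [TopologicalSpace M] [ChartedSpace (RSpace n) M]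
  {M' : Type*} [TopologicalSpace M'] [ChartedSpace (RSpace n) M']
  {M'' : Type*} [TopologicalSpace M''] [ChartedSpace (RSpace n) M'']
  {D : Π x : M, Submodule ℝ (TangentSpace (𝓡 n) x)}
  {D' : Π x : M', Submodule ℝ (TangentSpace (𝓡 n) x)}
  {D'' : Π x : M'', Submodule ℝ (TangentSpace (𝓡 n) x)} {p : M}

/-- A smooth local diffeomorphism mapping one field of tangent subspaces to another. -/
structure IsLocalEquiv (φ : OpenPartialHomeomorph M M')
    (D : Π x : M, Submodule ℝ (TangentSpace (𝓡 n) x))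
    (D' : Π x : M', Submodule ℝ (TangentSpace (𝓡 n) x)) : Prop where
  contMDiffOn : ContMDiffOn (𝓡 n) (𝓡 n) ∞ φ φ.source
  contMDiffOn_symm : ContMDiffOn (𝓡 n) (𝓡 n) ∞ φ.symm φ.target
  map_eq : ∀ x ∈ φ.source, (D x).map (mfderiv (𝓡 n) (𝓡 n) φ x).toLinearMap = D' (φ x)

namespace IsLocalEquiv

variable {φ : OpenPartialHomeomorph M M'}

theorem mdifferentiable (h : IsLocalEquiv φ D D') : φ.MDifferentiable (𝓡 n) (𝓡 n) :=
  ⟨h.contMDiffOn.mdifferentiableOn (by simp), h.contMDiffOn_symm.mdifferentiableOn (by simp)⟩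

theorem symm (h : IsLocalEquiv φ D D') : IsLocalEquiv φ.symm D' D where
  contMDiffOn := h.contMDiffOn_symm
  contMDiffOn_symm := h.contMDiffOn
  map_eq := fun y hy => by
    obtain ⟨x, hx, rfl⟩ : ∃ x ∈ φ.source, φ x = y := ⟨φ.symm y, φ.map_target hy, φ.right_inv hy⟩
    have h1 := h.mdifferentiable.symm_comp_deriv hx
    rw [← h.map_eq x hx, φ.left_inv hx, ← Submodule.map_comp]
    ext v
    constructor
    · rintro ⟨w, hw, rfl⟩
      have h2 := DFunLike.congr_fun h1 w
      change mfderiv (𝓡 n) (𝓡 n) φ.symm (φ x) (mfderiv (𝓡 n) (𝓡 n) φ x w) ∈ D x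
      have h3 : mfderiv (𝓡 n) (𝓡 n) φ.symm (φ x) (mfderiv (𝓡 n) (𝓡 n) φ x w) = w := h2
      rw [h3]
      exact hw
    · intro hv
      exact ⟨v, hv, DFunLike.congr_fun h1 v⟩

theorem trans {ψ : OpenPartialHomeomorph M' M''} (h : IsLocalEquiv φ D D')
    (h' : IsLocalEquiv ψ D' D'') : IsLocalEquiv (φ.trans ψ) D D'' where
  contMDiffOn := by
    refine h'.contMDiffOn.comp (h.contMDiffOn.mono fun x hx => hx.1) fun x hx => hx.2
  contMDiffOn_symm := by
    refine h.contMDiffOn_symm.comp (h'.contMDiffOn_symm.mono fun x hx => ?_) fun x hx => ?_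
    · rw [OpenPartialHomeomorph.trans_target] at hx; exact hx.1
    · rw [OpenPartialHomeomorph.trans_target] at hx; exact hx.2
  map_eq := fun x hx => by
    have h1 : mfderiv (𝓡 n) (𝓡 n) (ψ ∘ φ) x =
        (mfderiv (𝓡 n) (𝓡 n) ψ (φ x)).comp (mfderiv (𝓡 n) (𝓡 n) φ x) :=
      mfderiv_comp x (h'.mdifferentiable.mdifferentiableAt hx.2)
        (h.mdifferentiable.mdifferentiableAt hx.1)
    rw [OpenPartialHomeomorph.coe_trans, h1]
    change _ = D'' (ψ (φ x))
    rw [← h'.map_eq (φ x) hx.2, ← h.map_eq x hx.1, ← Submodule.map_comp]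
    rfl

end IsLocalEquiv

theorem isManifold_minSmoothness (n : ℕ) (M : Type*) [TopologicalSpace M]
    [ChartedSpace (RSpace n) M]
    [IsManifold (𝓡 n) ∞ M] (k : ℕ) : IsManifold (𝓡 n) (minSmoothness ℝ k) M := by
  rw [minSmoothness_of_isRCLikeNormedField]
  exact IsManifold.of_le (n := ∞) (mod_cast le_top)

theorem mlieBracket_eq_lieBracket (V W : RSpace n → RSpace n) :
    mlieBracket (M := RSpace n) (𝓡 n) V W = lieBracket ℝ V W := by
  refine (mlieBracketWithin_univ (I := 𝓡 n) (V := V) (W := W)).symm.trans ?_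
  refine Eq.trans ?_ (lieBracketWithin_univ (𝕜 := ℝ))
  exact mlieBracketWithin_eq_lieBracketWithin

theorem derivedSections_mono [IsManifold (𝓡 n) ∞ M] (i : ℕ) :
    derivedSections D p i ≤ derivedSections D p (i + 1) := le_sup_left

theorem localSections_le_derivedSections [IsManifold (𝓡 n) ∞ M] (i : ℕ) :
    localSections D p ≤ derivedSections D p i := by
  induction i with
  | zero => exact le_rfl
  | succ i ih => exact ih.trans (derivedSections_mono i)

/-- The difference vanishes near `p`, so it is a section of `D` and lies in every step of the flag.
Naturality of brackets holds only near `p` and is used through this lemma. -/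
theorem derivedSections_congr [IsManifold (𝓡 n) ∞ M] {i : ℕ} {V W : Π x : M, TangentSpace (𝓡 n) x}
    (hV : V ∈ derivedSections D p i) (h : W =ᶠ[𝓝 p] V) : W ∈ derivedSections D p i := by
  have h0 : W - V ∈ localSections D p := by
    have h0' : W - V =ᶠ[𝓝 p] 0 := by
      filter_upwards [h] with x hx
      simp [hx]
      rfl
    refine ⟨?_, ?_⟩
    · filter_upwards [(localSections D p).zero_mem.1, h0'.eventuallyEq_nhds] with x h1 h2
      refine h1.congr_of_eventuallyEq ?_
      filter_upwards [h2] with y hy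
      rw [hy]
      rfl
    · filter_upwards [h0'] with x hx
      rw [hx]
      exact (D x).zero_mem
  have := Submodule.add_mem _ hV (localSections_le_derivedSections i h0)
  rwa [add_sub_cancel] at this

theorem derivedSections_induction [IsManifold (𝓡 n) ∞ M] {i : ℕ}
    {P : (Π x : M, TangentSpace (𝓡 n) x) → Prop}
    (mem : ∀ V ∈ derivedSections D p i, P V)
    (bracket : ∀ V ∈ derivedSections D p i, ∀ W ∈ derivedSections D p i,
      P (mlieBracket (𝓡 n) V W))
    (add : ∀ V W, P V → P W → P (V + W)) (smul : ∀ (c : ℝ) V, P V → P (c • V))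
    {V : Π x : M, TangentSpace (𝓡 n) x} (hV : V ∈ derivedSections D p (i + 1)) : P V := by
  obtain ⟨A, hA, B, hB, rfl⟩ := Submodule.mem_sup.1 hV
  refine add _ _ (mem _ hA) (Submodule.span_induction (p := fun B _ => P B) ?_
    (mem 0 (Submodule.zero_mem _)) (fun V W _ _ => add V W) (fun c V _ => smul c V) hB)
  rintro _ ⟨V, hV, W, hW, rfl⟩
  exact bracket V hV W hW

theorem smoothNear_of_mem_derivedSections [IsManifold (𝓡 n) ∞ M] {i : ℕ}
    {V : Π x : M, TangentSpace (𝓡 n) x} (hV : V ∈ derivedSections D p i) : SmoothNear V p := by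
  induction i generalizing V with
  | zero => exact hV.1
  | succ i ih =>
    refine derivedSections_induction (P := fun V => SmoothNear V p) (fun V hV => ih hV)
      (fun V hV W hW => ?_) (fun V W h1 h2 => ?_) (fun c V h1 => ?_) hV
    · filter_upwards [ih hV, ih hW] with x h1 h2
      have := isManifold_minSmoothness n M 2
      -- The bracket costs one derivative, and `∞ + 1 = ∞`.
      have : IsManifold (𝓡 n) ((⊤ : ℕ∞) + 1) M := ‹IsManifold (𝓡 n) ∞ M›
      exact ContMDiffAt.mlieBracket_vectorField (m := ⊤) (n := ⊤) h1 h2 (by simp)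
    · filter_upwards [h1, h2] with x h1 h2 using h1.add_section h2
    · filter_upwards [h1] with x h1 using h1.const_smul_section

/-- Sections pull back to sections because the derivative of `φ` maps `D` isomorphically onto `D'`;
higher steps follow since pullback commutes with brackets. -/
theorem IsLocalEquiv.mpullback_mem [IsManifold (𝓡 n) ∞ M] [IsManifold (𝓡 n) ∞ M']
    {φ : OpenPartialHomeomorph M M'} (h : IsLocalEquiv φ D D') (hp : p ∈ φ.source) (i : ℕ)
    {V : Π x : M', TangentSpace (𝓡 n) x} (hV : V ∈ derivedSections D' (φ p) i) :
    mpullback (𝓡 n) (𝓡 n) φ V ∈ derivedSections D p i := by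
  have hsrc : ∀ᶠ x in 𝓝 p, x ∈ φ.source := φ.open_source.mem_nhds hp
  have hc : ContinuousAt φ p := φ.continuousAt hp
  have hinv : ∀ x ∈ φ.source, (mfderiv (𝓡 n) (𝓡 n) φ x).IsInvertible := fun x hx =>
    ⟨h.mdifferentiable.mfderiv hx, rfl⟩
  have hsm : ∀ x ∈ φ.source, ContMDiffAt (𝓡 n) (𝓡 n) ∞ φ x := fun x hx =>
    h.contMDiffOn.contMDiffAt (φ.open_source.mem_nhds hx)
  induction i generalizing V with
  | zero =>
    refine ⟨?_, ?_⟩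
    · filter_upwards [hsrc, hc.eventually hV.1] with x hx h1
      exact ContMDiffAt.mpullback_vectorField_preimage h1 (hsm x hx) (hinv x hx) (by simp)
    · filter_upwards [hsrc, hc.eventually hV.2] with x hx h1
      rw [← h.map_eq x hx] at h1
      obtain ⟨w, hw, hwV⟩ := h1
      rw [mpullback_apply]
      have e : V (φ x) = mfderiv (𝓡 n) (𝓡 n) φ x w := hwV.symm
      rw [e]
      obtain ⟨L, hL⟩ := hinv x hx
      rw [← hL, ContinuousLinearMap.inverse_equiv]
      change L.symm (L w) ∈ D x
      rw [L.symm_apply_apply]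
      exact hw
  | succ i ih =>
    refine derivedSections_induction
      (P := fun V => mpullback (𝓡 n) (𝓡 n) φ V ∈ derivedSections D p (i + 1))
      (fun V hV => derivedSections_mono i (ih hV)) (fun V hV W hW => ?_) (fun V W h1 h2 => ?_)
      (fun c V h1 => ?_) hV
    · have := isManifold_minSmoothness n M 2
      have := isManifold_minSmoothness n M' 2
      have hb : mlieBracket (𝓡 n) (mpullback (𝓡 n) (𝓡 n) φ V) (mpullback (𝓡 n) (𝓡 n) φ W) ∈
          derivedSections D p (i + 1) :=
        Submodule.mem_sup_right (Submodule.subset_span ⟨_, ih hV, _, ih hW, rfl⟩)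
      refine derivedSections_congr hb ?_
      filter_upwards [hsrc, hc.eventually (smoothNear_of_mem_derivedSections hV),
        hc.eventually (smoothNear_of_mem_derivedSections hW)] with x hx h1 h2
      exact mpullback_mlieBracket (n := ∞) (h1.mdifferentiableAt (by simp))
        (h2.mdifferentiableAt (by simp)) (hsm x hx) (by
          rw [minSmoothness_of_isRCLikeNormedField]
          exact (mod_cast le_top : ((2 : ℕ∞) : WithTop ℕ∞) ≤ ∞))
    · rw [mpullback_add]
      exact Submodule.add_mem _ h1 h2
    · rw [mpullback_const_smul]
      exact Submodule.smul_mem _ c h1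

/-- Pulling back sections shows that the inverse of the derivative embeds one flag space into the
other. Applied to `φ.symm` as well, this gives equality of ranks. -/
theorem IsLocalEquiv.finrank_le [IsManifold (𝓡 n) ∞ M] [IsManifold (𝓡 n) ∞ M']
    {φ : OpenPartialHomeomorph M M'} (h : IsLocalEquiv φ D D') (hp : p ∈ φ.source) (i : ℕ) :
    Module.finrank ℝ (derivedFlag D' i (φ p)) ≤ Module.finrank ℝ (derivedFlag D i p) := by
  have : ∀ q : M, FiniteDimensional ℝ (TangentSpace (𝓡 n) q) := fun q =>
    inferInstanceAs (FiniteDimensional ℝ (RSpace n))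
  let L := h.mdifferentiable.mfderiv hp
  have hle : (derivedFlag D' i (φ p)).map (L.symm.toLinearEquiv : _ →ₗ[ℝ] _) ≤
      derivedFlag D i p := by
    rintro _ ⟨_, ⟨V, hV, rfl⟩, rfl⟩
    refine ⟨_, h.mpullback_mem hp i hV, ?_⟩
    change (mfderiv (𝓡 n) (𝓡 n) φ p).inverse (V (φ p)) = L.symm (V (φ p))
    have e : mfderiv (𝓡 n) (𝓡 n) φ p = (L : _ →L[ℝ] _) := rfl
    rw [e, ContinuousLinearMap.inverse_equiv]
    rfl
  rw [← LinearEquiv.finrank_map_eq L.symm.toLinearEquiv (derivedFlag D' i (φ p))]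
  exact Submodule.finrank_mono hle

theorem IsLocalEquiv.finrank_eq [IsManifold (𝓡 n) ∞ M] [IsManifold (𝓡 n) ∞ M']
    {φ : OpenPartialHomeomorph M M'} (h : IsLocalEquiv φ D D') (hp : p ∈ φ.source) (i : ℕ) :
    Module.finrank ℝ (derivedFlag D' i (φ p)) = Module.finrank ℝ (derivedFlag D i p) := by
  refine le_antisymm (h.finrank_le hp i) ?_
  have h1 := h.symm.finrank_le (φ.map_source hp) i
  rwa [φ.left_inv hp] at h1

theorem mem_derivedSections_iff {D : RSpace n → Submodule ℝ (RSpace n)} {p : RSpace n} {i : ℕ}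
    {V : RSpace n → RSpace n} :
    V ∈ derivedSections (M := RSpace n) D p i ↔ V ∈ bracketExtension^[i] (fieldSections D p) := by
  have h : derivedSections (M := RSpace n) D p i = bracketExtension^[i] (fieldSections D p) := by
    induction i with
    | zero =>
      ext V
      exact and_congr_left' (Filter.eventually_congr (Filter.Eventually.of_forall fun x =>
        contMDiffAt_vectorSpace_iff_contDiffAt))
    | succ i ih =>
      rw [Function.iterate_succ_apply', ← ih]
      refine congrArg (fun S => derivedSections (M := RSpace n) D p i ⊔ Submodule.span ℝ S) ?_
      ext B
      exact exists_congr fun V => and_congr_right fun _ => exists_congr fun W =>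
        and_congr_right fun _ => Eq.congr_right (mlieBracket_eq_lieBracket V W)
  rw [h]
  exact Iff.rfl

theorem finrank_derivedFlag {D : RSpace n → Submodule ℝ (RSpace n)} {p : RSpace n} (i : ℕ) :
    Module.finrank ℝ (derivedFlag (M := RSpace n) D i p) = Module.finrank ℝ (flagAt D i p) := by
  have h : derivedFlag (M := RSpace n) D i p = flagAt D i p := by
    ext v
    constructor
    · rintro ⟨V, hV, rfl⟩
      exact ⟨V, mem_derivedSections_iff.1 hV, rfl⟩
    · rintro ⟨V, hV, rfl⟩
      exact ⟨V, mem_derivedSections_iff.2 hV, rfl⟩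
  rw [h]
  rfl

end ManifoldTransfer
end

noncomputable section

/-! ### Goursat structures in charts and straightening of the characteristic field -/

section Pushforward

open VectorField

variable {n : ℕ} {M : Type*} [TopologicalSpace M] [ChartedSpace (RSpace n) M]
  {D : Π x : M, Submodule ℝ (TangentSpace (𝓡 n) x)} {p : M}

/-- The image of a distribution under a local diffeomorphism to `ℝⁿ`. -/
def pushDistribution (φ : OpenPartialHomeomorph M (RSpace n))
    (D : Π x : M, Submodule ℝ (TangentSpace (𝓡 n) x)) (y : RSpace n) : Submodule ℝ (RSpace n) :=
  (D (φ.symm y)).map (mfderiv (𝓡 n) (𝓡 n) φ (φ.symm y)).toLinearMap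

variable {φ : OpenPartialHomeomorph M (RSpace n)}

theorem isLocalEquiv_pushDistribution (h : ContMDiffOn (𝓡 n) (𝓡 n) ∞ φ φ.source)
    (h' : ContMDiffOn (𝓡 n) (𝓡 n) ∞ φ.symm φ.target) :
    IsLocalEquiv φ D (pushDistribution φ D) where
  contMDiffOn := h
  contMDiffOn_symm := h'
  map_eq x hx := by
    unfold pushDistribution
    rw [φ.left_inv hx]
    rfl

theorem IsLocalEquiv.eventually_finrank_flagAt [IsManifold (𝓡 n) ∞ M]
    {D' : RSpace n → Submodule ℝ (RSpace n)} (h : IsLocalEquiv φ D D') (hp : p ∈ φ.source)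
    (hD : ∀ᶠ q in 𝓝 p, ∀ i, i + 2 ≤ n → Module.finrank ℝ (derivedFlag D i q) = i + 2) :
    ∀ᶠ q in 𝓝 (φ p), ∀ i, i + 2 ≤ n → Module.finrank ℝ (flagAt D' i q) = i + 2 := by
  have hc : ContinuousAt φ.symm (φ p) := φ.symm.continuousAt (φ.map_source hp)
  have hD' := hc.eventually (by rw [φ.left_inv hp]; exact hD)
  filter_upwards [hD', φ.open_target.mem_nhds (φ.map_source hp)] with y hy hyt i hi
  rw [← finrank_derivedFlag, ← hy i hi, ← h.finrank_eq (φ.map_target hyt) i, φ.right_inv hyt]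

theorem IsLocalEquiv.isInvertible {M' : Type*} [TopologicalSpace M'] [ChartedSpace (RSpace n) M']
    {D' : Π x : M', Submodule ℝ (TangentSpace (𝓡 n) x)} {φ : OpenPartialHomeomorph M M'}
    (h : IsLocalEquiv φ D D') {x : M} (hx : x ∈ φ.source) :
    (mfderiv (𝓡 n) (𝓡 n) φ x).IsInvertible :=
  ⟨h.mdifferentiable.mfderiv hx, rfl⟩

theorem ContinuousLinearEquiv.eq_span_range_symm {E F ι : Type*} [AddCommGroup E] [Module ℝ E]
    [TopologicalSpace E] [AddCommGroup F] [Module ℝ F] [TopologicalSpace F] (L : E ≃L[ℝ] F)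
    {S : Submodule ℝ E} {f : ι → F}
    (h : S.map (L : E →L[ℝ] F).toLinearMap = Submodule.span ℝ (Set.range f)) :
    S = Submodule.span ℝ (Set.range fun i => L.symm (f i)) := by
  apply Submodule.map_injective_of_injective (f := (L : E →L[ℝ] F).toLinearMap) L.injective
  rw [h, Submodule.map_span, ← Set.range_comp]
  congr 2
  funext i
  exact (L.apply_symm_apply (f i)).symm

/-- Transport of a frame by a local diffeomorphism. -/
theorem IsLocalEquiv.exists_frame [IsManifold (𝓡 n) ∞ M] {k : ℕ}
    {D' : RSpace n → Submodule ℝ (RSpace n)} (h : IsLocalEquiv φ D D') (hp : p ∈ φ.source)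
    {f : Fin k → Π x : M, TangentSpace (𝓡 n) x} (hf : ∀ i, SmoothNear (f i) p)
    (hfD : ∀ᶠ x in 𝓝 p, LinearIndependent ℝ (fun i => f i x) ∧
      D x = Submodule.span ℝ (Set.range fun i => f i x)) :
    ∃ Z : Fin k → RSpace n → RSpace n, (∀ i, Z i = mpullback (𝓡 n) (𝓡 n) φ.symm (f i)) ∧
      (∀ i, SmoothGerm (Z i) (φ p)) ∧ (LinearIndependent ℝ fun i => Z i (φ p)) ∧
      ∀ᶠ y in 𝓝 (φ p), D' y = frameSpan Z y := by
  have hpt := φ.map_source hp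
  -- The formula for the transported frame is part of the conclusion so that its brackets can be
  -- computed later by naturality.
  refine ⟨fun i => mpullback (𝓡 n) (𝓡 n) φ.symm (f i), fun i => rfl, fun i => ?_, ?_, ?_⟩
  · have hs : f i ∈ derivedSections D (φ.symm (φ p)) 0 := by
      rw [φ.left_inv hp]
      refine ⟨hf i, ?_⟩
      filter_upwards [hfD] with x hx
      rw [hx.2]
      exact Submodule.subset_span ⟨i, rfl⟩
    exact (mem_derivedSections_iff.1 (h.symm.mpullback_mem hpt 0 hs)).1
  · have hli := hfD.self_of_nhds.1
    obtain ⟨L, hL⟩ := h.symm.isInvertible hpt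
    have hi : LinearIndependent ℝ fun i => f i (φ.symm (φ p)) := by
      rw [φ.left_inv hp]; exact hli
    have := hi.map' L.symm.toLinearEquiv.toLinearMap (LinearEquiv.ker _)
    have e : (fun i => mpullback (𝓡 n) (𝓡 n) φ.symm (f i) (φ p)) =
        fun i => L.symm (f i (φ.symm (φ p))) := by
      funext i
      rw [mpullback_apply, ← hL, ContinuousLinearMap.inverse_equiv]
      rfl
    change LinearIndependent ℝ fun i => mpullback (𝓡 n) (𝓡 n) φ.symm (f i) (φ p)
    rw [e]
    exact this
  · have hc : ContinuousAt φ.symm (φ p) := φ.symm.continuousAt hpt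
    have hD' := hc.eventually (by rw [φ.left_inv hp]; exact hfD)
    filter_upwards [hD', φ.open_target.mem_nhds hpt] with y hy hyt
    obtain ⟨L, hL⟩ := h.symm.isInvertible hyt
    have h1 := h.symm.map_eq y hyt
    rw [hy.2] at h1
    rw [← hL] at h1
    refine (L.eq_span_range_symm h1).trans ?_
    congr 2
    funext i
    change L.symm _ = (mfderiv (𝓡 n) (𝓡 n) φ.symm y).inverse _
    rw [← hL, ContinuousLinearMap.inverse_equiv]
    rfl

/-- A Goursat structure is, in a chart, a Goursat structure near a point of `ℝⁿ`. -/
theorem IsLocalEquiv.goursatNear [IsManifold (𝓡 n) ∞ M] {D' : RSpace n → Submodule ℝ (RSpace n)}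
    (h : IsLocalEquiv φ D D') (hp : p ∈ φ.source) (hD : IsGoursat D) : GoursatNear D' (φ p) := by
  obtain ⟨f, hf, hfD⟩ := hD.smooth p
  obtain ⟨Z, -, hZ, hZli, hZD⟩ := h.exists_frame hp hf hfD
  have hZ2 : Z = ![Z 0, Z 1] := by ext1 i; fin_cases i <;> rfl
  refine ⟨⟨Z 0, Z 1, hZ 0, hZ 1, ?_, ?_⟩, h.eventually_finrank_flagAt hp
    (Filter.Eventually.of_forall fun q i hi => hD.finrank_derivedFlag i hi q)⟩
  · rw [← eval_two, ← hZ2]; exact hZli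
  · rw [← hZ2]; exact hZD

theorem exists_goursatNear [IsManifold (𝓡 n) ∞ M] (hD : IsGoursat D) (p : M) :
    ∃ (D' : RSpace n → Submodule ℝ (RSpace n)) (φ : OpenPartialHomeomorph M (RSpace n)),
      p ∈ φ.source ∧ φ p = 0 ∧ IsLocalEquiv φ D D' ∧ GoursatNear D' 0 := by
  let τ := (Homeomorph.addRight (-chartAt (RSpace n) p p)).toOpenPartialHomeomorph
  let φ := (chartAt (RSpace n) p).trans τ
  have hp : p ∈ φ.source := ⟨mem_chart_source _ p, trivial⟩
  have hφp : φ p = 0 := add_neg_cancel _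
  have h : ContMDiffOn (𝓡 n) (𝓡 n) ∞ φ φ.source := by
    have ht : ContMDiff (𝓡 n) (𝓡 n) ∞ τ := (contDiff_id.add contDiff_const).contMDiff
    exact ht.comp_contMDiffOn ((contMDiffOn_chart (I := 𝓡 n)).mono fun x hx => hx.1)
  have h' : ContMDiffOn (𝓡 n) (𝓡 n) ∞ φ.symm φ.target := by
    have ht : ContMDiff (𝓡 n) (𝓡 n) ∞ τ.symm := (contDiff_id.add contDiff_const).contMDiff
    refine (contMDiffOn_chart_symm (I := 𝓡 n)).comp ht.contMDiffOn fun y hy => ?_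
    exact hy.2
  have hL := isLocalEquiv_pushDistribution (D := D) h h'
  exact ⟨_, φ, hp, hφp, hL, hφp ▸ hL.goursatNear hp hD⟩

theorem isLocalEquiv_of_contDiffOn {D D' : RSpace n → Submodule ℝ (RSpace n)}
    {φ : OpenPartialHomeomorph (RSpace n) (RSpace n)} (h : ContDiffOn ℝ ∞ φ φ.source)
    (h' : ContDiffOn ℝ ∞ φ.symm φ.target)
    (hmap : ∀ x ∈ φ.source, (D x).map (fderiv ℝ φ x).toLinearMap = D' (φ x)) :
    IsLocalEquiv (M := RSpace n) (M' := RSpace n) φ D D' :=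
  ⟨h.contMDiffOn, h'.contMDiffOn, fun x hx => by
    have := hmap x hx
    rw [← mfderiv_eq_fderiv] at this
    exact this⟩

/-- The flow box theorem turns a characteristic field into the last coordinate field. -/
theorem GoursatNear.exists_straightening {D : RSpace (n + 1) → Submodule ℝ (RSpace (n + 1))}
    (hn : 2 ≤ n) (hD : GoursatNear D 0) :
    ∃ (D' : RSpace (n + 1) → Submodule ℝ (RSpace (n + 1)))
      (φ : OpenPartialHomeomorph (RSpace (n + 1)) (RSpace (n + 1)))
      (Y : RSpace (n + 1) → RSpace (n + 1)),
      (0 : RSpace (n + 1)) ∈ φ.source ∧ φ 0 = 0 ∧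
      IsLocalEquiv (M := RSpace (n + 1)) (M' := RSpace (n + 1)) φ D D' ∧ GoursatNear D' 0 ∧
      SmoothGerm Y 0 ∧ (∀ᶠ x in 𝓝 0, D' x = frameSpan ![fun _ => lastVec n, Y] x) ∧
      LinearIndependent ℝ ![lastVec n, Y 0] ∧
      ∀ᶠ x in 𝓝 0, lieBracket ℝ (fun _ => lastVec n) (lieBracket ℝ (fun _ => lastVec n) Y) x ∈
        frameSpan ![fun _ => lastVec n, Y, lieBracket ℝ (fun _ => lastVec n) Y] x := by
  obtain ⟨C, Y, hC, hY, hDCY, hli, hchar⟩ := hD.exists_characteristic (by omega)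
  obtain ⟨φ, h0, hφ0, hφ, hφ', hflow⟩ :=
    hC.exists_flowBox (hli.ne_zero 0) (lastVec_ne_zero (n := n))
  have hL : IsLocalEquiv (M := RSpace (n + 1)) φ D (pushDistribution (M := RSpace (n + 1)) φ D) :=
    isLocalEquiv_pushDistribution (M := RSpace (n + 1)) hφ.contMDiffOn hφ'.contMDiffOn
  have hsm : ∀ i, SmoothNear (M := RSpace (n + 1)) ((![C, Y] : Fin 2 → _) i) 0 := by
    intro i
    have : ∀ {V : RSpace (n + 1) → RSpace (n + 1)}, SmoothGerm V 0 →
        SmoothNear (M := RSpace (n + 1)) V 0 := fun hV => by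
      filter_upwards [hV] with x hx using contMDiffAt_vectorSpace_iff_contDiffAt.2 hx
    fin_cases i
    exacts [this hC, this hY]
  have hli' : ∀ᶠ x in 𝓝 0, LinearIndependent ℝ fun i => (![C, Y] : Fin 2 → _) i x := by
    refine LinearIndependent.eventually_of_continuousAt (fun i => ?_) (by rw [eval_two]; exact hli)
    fin_cases i
    exacts [hC.continuousAt, hY.continuousAt]
  obtain ⟨Z, hZ, hZs, hZli, hZD⟩ := hL.exists_frame h0 hsm (hli'.and hDCY)
  rw [hφ0] at hZs hZli hZD
  have hZ0 : Z 0 = pullback ℝ φ.symm C := (hZ 0).trans mpullback_eq_pullback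
  have hZ1 : Z 1 = pullback ℝ φ.symm Y := (hZ 1).trans mpullback_eq_pullback
  have ht : ∀ᶠ y in 𝓝 0, y ∈ φ.target := φ.open_target.mem_nhds (hφ0 ▸ φ.map_source h0)
  have hc : ContinuousAt φ.symm 0 := φ.symm.continuousAt (hφ0 ▸ φ.map_source h0)
  have hφs0 : φ.symm 0 = 0 := by rw [← hφ0, φ.left_inv h0, hφ0]
  have hc' : ∀ {P : RSpace (n + 1) → Prop}, (∀ᶠ x in 𝓝 0, P x) → ∀ᶠ y in 𝓝 0, P (φ.symm y) :=
    fun hP => hc.eventually (by rw [hφs0]; exact hP)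
  -- `Z 0` is the image of `C` under the flow box chart, hence the constant last basis field.
  have hconst : Z 0 =ᶠ[𝓝 0] fun _ => lastVec n := by
    filter_upwards [ht] with y hy
    have hinv : (fderiv ℝ φ.symm y).IsInvertible := by
      rw [← mfderiv_eq_fderiv]
      exact hL.symm.isInvertible hy
    have h1 := OpenPartialHomeomorph.fderiv_symm_apply_fderiv hφ hφ' (φ.map_target hy)
      (C (φ.symm y))
    rw [hflow _ (φ.map_target hy), φ.right_inv hy] at h1
    rw [hZ0, pullback, hinv.inverse_apply_eq, h1]
  have hpull : ∀ {V W : RSpace (n + 1) → RSpace (n + 1)}, SmoothGerm V 0 → SmoothGerm W 0 →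
      pullback ℝ φ.symm (lieBracket ℝ V W) =ᶠ[𝓝 0]
        lieBracket ℝ (pullback ℝ φ.symm V) (pullback ℝ φ.symm W) := fun hV hW => by
    filter_upwards [ht, hc' hV, hc' hW] with y hy h1 h2
    exact pullback_lieBracket (n := ∞) (by
      rw [minSmoothness_of_isRCLikeNormedField]
      exact (mod_cast le_top : ((2 : ℕ∞) : WithTop ℕ∞) ≤ ∞))
      (hφ'.contDiffAt (φ.open_target.mem_nhds hy)) (h1.differentiableAt (by simp))
      (h2.differentiableAt (by simp))
  have hbr : lieBracket ℝ (fun _ => lastVec n) (Z 1) =ᶠ[𝓝 0]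
      pullback ℝ φ.symm (lieBracket ℝ C Y) :=
    (hconst.symm.lieBracket_vectorField Filter.EventuallyEq.rfl).trans
      (by rw [hZ0, hZ1]; exact (hpull hC hY).symm)
  have hbr2 : lieBracket ℝ (fun _ => lastVec n) (lieBracket ℝ (fun _ => lastVec n) (Z 1)) =ᶠ[𝓝 0]
      pullback ℝ φ.symm (lieBracket ℝ C (lieBracket ℝ C Y)) :=
    (hconst.symm.lieBracket_vectorField hbr).trans
      (by rw [hZ0]; exact (hpull hC (hC.lieBracket hY)).symm)
  have hZ2 : Z = ![Z 0, Z 1] := by ext1 i; fin_cases i <;> rfl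
  rw [hZ2] at hZD hZli
  rw [eval_two] at hZli
  refine ⟨_, φ, Z 1, h0, hφ0, hL, ⟨⟨Z 0, Z 1, hZs 0, hZs 1, hZli, hZD⟩, ?_⟩, hZs 1, ?_, ?_, ?_⟩
  · have := hL.eventually_finrank_flagAt h0 (by
      filter_upwards [hD.finrank_flagAt] with q hq i hi
      rw [finrank_derivedFlag, hq i hi])
    rwa [hφ0] at this
  · filter_upwards [hZD, hconst] with y h1 h2
    rw [h1, frameSpan, frameSpan, eval_two, eval_two, h2]
  · have e : Z 0 0 = lastVec n := hconst.self_of_nhds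
    rw [← e]; exact hZli
  -- The pullback is linear at each point, so the characteristic relation is transported with
  -- unchanged coefficients.
  · filter_upwards [hbr, hbr2, hconst, hc' hchar] with y h1 h2 h3 h4
    obtain ⟨a, b, c, h4⟩ := mem_frameSpan_three.1 h4
    rw [mem_frameSpan_three]
    refine ⟨a, b, c, ?_⟩
    rw [h1, h2, ← h3, hZ0, hZ1]
    simp only [pullback, ← h4, map_add, map_smul]

end Pushforward
end

noncomputable section

/-! ### Prolongation of local equivalences -/

section Prolongation

variable {n : ℕ}

theorem hasFDerivAt_prolongedMap {φ : RSpace n → RSpace n} {f : RSpace (n + 1) → ℝ}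
    {x : RSpace (n + 1)} (hφ : DifferentiableAt ℝ φ (initL n x)) (hf : DifferentiableAt ℝ f x) :
    HasFDerivAt (fun y => inclL n (φ (initL n y)) + f y • lastVec n)
      ((inclL n).comp ((fderiv ℝ φ (initL n x)).comp (initL n)) +
        (fderiv ℝ f x).smulRight (lastVec n)) x :=
  ((inclL n).hasFDerivAt.comp x (hφ.hasFDerivAt.comp x (initL n).hasFDerivAt)).add
    (hf.hasFDerivAt.smul_const (lastVec n))

/-- The map is block triangular with diagonal blocks `A` and the nonzero scalar `B (lastVec n)`. -/
theorem exists_prolongedEquiv {A : RSpace n →L[ℝ] RSpace n} (hA : Function.Injective A)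
    {B : RSpace (n + 1) →L[ℝ] ℝ} (hB : B (lastVec n) ≠ 0) :
    ∃ L : RSpace (n + 1) ≃L[ℝ] RSpace (n + 1), (L : RSpace (n + 1) →L[ℝ] RSpace (n + 1)) =
      (inclL n).comp (A.comp (initL n)) + B.smulRight (lastVec n) := by
  set T := (inclL n).comp (A.comp (initL n)) + B.smulRight (lastVec n) with hT
  have hinj : Function.Injective T := by
    refine (injective_iff_map_eq_zero T).2 fun w hw => ?_
    have h1 : A (initL n w) = 0 := by
      have := congrArg (initL n) hw
      simpa [hT] using this
    have h2 : initL n w = 0 := hA (by rw [h1, map_zero])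
    have h3 : B w = 0 := by
      have := congrArg (lastL n) hw
      simpa [hT] using this
    have h4 := inclL_initL_add w
    rw [h2, map_zero, zero_add] at h4
    rw [← h4, map_smul, smul_eq_mul] at h3
    rw [← h4, (mul_eq_zero.1 h3).resolve_right hB, zero_smul]
  refine ⟨(LinearEquiv.ofInjectiveEndo T.toLinearMap hinj).toContinuousLinearEquiv, ?_⟩
  ext1 w
  rfl

theorem det_ne_zero_of_linearIndependent_pair {V : Type*} [AddCommGroup V] [Module ℝ V]
    {K₁ K₂ : V} {a b a' b' : ℝ}
    (h : LinearIndependent ℝ ![a • K₁ + b • K₂, a' • K₁ + b' • K₂]) : a * b' - b * a' ≠ 0 := by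
  intro h0
  rw [LinearIndependent.pair_iff] at h
  have h1 := h b' (-b) (by
    have : b' • (a • K₁ + b • K₂) + -b • (a' • K₁ + b' • K₂) = (a * b' - b * a') • K₁ := by module
    rw [this, h0, zero_smul])
  have h2 := h (-a') a (by
    have : -a' • (a • K₁ + b • K₂) + a • (a' • K₁ + b' • K₂) = (a * b' - b * a') • K₂ := by module
    rw [this, h0, zero_smul])
  have hb : b = 0 := neg_eq_zero.1 h1.2
  have := h 1 0 (by rw [h2.2, hb]; simp)
  exact one_ne_zero this.1

/-- If `φ` maps the projection of `Y` to `u P + v Q`, then adding to `φ` the coordinate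
`u / v - c` maps the span of `Y` and the last coordinate field to the prolongation of `(P, Q)`. -/
theorem exists_isLocalEquiv_prolongation {D : RSpace (n + 1) → Submodule ℝ (RSpace (n + 1))}
    {Y : RSpace (n + 1) → RSpace (n + 1)} {P Q : RSpace n → RSpace n}
    {φ : OpenPartialHomeomorph (RSpace n) (RSpace n)} {u v : RSpace (n + 1) → ℝ}
    (hDY : ∀ᶠ x in 𝓝 0, D x = frameSpan ![fun _ => lastVec n, Y] x)
    (h0 : (0 : RSpace n) ∈ φ.source) (hφ0 : φ 0 = 0) (hφ : ContDiffOn ℝ ∞ φ φ.source)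
    (hφ' : ContDiffOn ℝ ∞ φ.symm φ.target) (hu : SmoothGerm u 0) (hv : SmoothGerm v 0)
    (hW : ∀ᶠ x in 𝓝 0, fderiv ℝ φ (initL n x) (initL n (Y x)) =
      u x • P (φ (initL n x)) + v x • Q (φ (initL n x)))
    (hv0 : v 0 ≠ 0)
    (hdet : u 0 * fderiv ℝ v 0 (lastVec n) - v 0 * fderiv ℝ u 0 (lastVec n) ≠ 0) :
    ∃ ψ : OpenPartialHomeomorph (RSpace (n + 1)) (RSpace (n + 1)),
      0 ∈ ψ.source ∧ ψ 0 = 0 ∧ IsLocalEquiv (M := RSpace (n + 1)) (M' := RSpace (n + 1)) ψ D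
        (frameSpan ![fun _ => lastVec n, fun x => (lastL n x + u 0 / v 0) •
          inclL n (P (initL n x)) + inclL n (Q (initL n x))]) := by
  set c := u 0 / v 0
  let f : RSpace (n + 1) → ℝ := fun x => u x / v x - c
  have hf : SmoothGerm f 0 := (hu.div hv hv0).sub (SmoothGerm.const c)
  have hf0 : f 0 = 0 := sub_self _
  have hφs : SmoothGerm φ (initL n 0) := by
    rw [map_zero]
    filter_upwards [φ.open_source.mem_nhds h0] with x hx
    exact hφ.contDiffAt (φ.open_source.mem_nhds hx)
  have huf : ∀ᶠ x in 𝓝 0, u x = (f x + c) * v x := by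
    filter_upwards [hv.continuousAt.eventually_ne hv0] with x hx
    simp only [f]
    field_simp
    ring
  -- Differentiating `u = (f + c) v` instead of the quotient: if `f` had zero derivative along the
  -- last coordinate, then `u' = c v'` and `u = c v` at `0`, so the determinant in `hdet` would
  -- vanish.
  have hfe : fderiv ℝ f 0 (lastVec n) ≠ 0 := by
    intro h
    have h1 : u =ᶠ[𝓝 0] fun x => (f x + c) * v x := huf
    have h2 := DFunLike.congr_fun (h1.fderiv_eq (𝕜 := ℝ)) (lastVec n)
    have hfc : DifferentiableAt ℝ (fun x => f x + c) 0 := hf.differentiableAt.add_const c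
    rw [fderiv_fun_mul hfc hv.differentiableAt] at h2
    simp only [fderiv_add_const, add_apply, smul_apply,
      h, hf0, smul_eq_mul, zero_add, mul_zero, add_zero] at h2
    apply hdet
    rw [h2, huf.self_of_nhds, hf0]
    ring
  -- `H` acts by `φ` on the base and takes `f` as the new last coordinate; subtracting `c` in `f`
  -- makes `H` fix the origin.
  let H : RSpace (n + 1) → RSpace (n + 1) :=
    fun y => inclL n (φ (initL n y)) + f y • lastVec n
  have hH : SmoothGerm H 0 :=
    ((hφs.comp (SmoothGerm.clm (initL n))).clm_comp (inclL n)).add (hf.smul (SmoothGerm.const _))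
  have hφinj : Function.Injective (fderiv ℝ φ (initL n 0)) := by
    intro w w' hw
    rw [map_zero] at hw
    rw [← OpenPartialHomeomorph.fderiv_symm_apply_fderiv hφ hφ' h0 w, hw,
      OpenPartialHomeomorph.fderiv_symm_apply_fderiv hφ hφ' h0 w']
  obtain ⟨L, hL⟩ := exists_prolongedEquiv hφinj hfe
  have hfe' : ∀ᶠ x in 𝓝 0, fderiv ℝ f x (lastVec n) ≠ 0 :=
    (hf.fderiv.clm_apply (SmoothGerm.const (lastVec n))).continuousAt.eventually_ne hfe
  have hφs' : ∀ᶠ x in 𝓝 0, ContDiffAt ℝ ∞ φ (initL n x) :=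
    (initL n).continuous.continuousAt.eventually hφs
  have hgood : ∀ᶠ x in 𝓝 0, (D x).map (fderiv ℝ H x).toLinearMap =
      frameSpan ![fun _ => lastVec n, fun x => (lastL n x + c) •
          inclL n (P (initL n x)) + inclL n (Q (initL n x))] (H x) := by
    filter_upwards [hDY, hφs', hf, hfe', hW, huf, hv.continuousAt.eventually_ne hv0]
      with x hDx hφx hfx hfex hWx hux hvx
    have hd := (hasFDerivAt_prolongedMap (hφx.differentiableAt (by simp))
      (hfx.differentiableAt (by simp))).fderiv
    have hinit : initL n (H x) = φ (initL n x) := by simp [H]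
    have hlast : lastL n (H x) = f x := by simp [H]
    have h1 : fderiv ℝ H x (lastVec n) = fderiv ℝ f x (lastVec n) • lastVec n := by
      simp [H, hd]
    -- Factoring out `v` turns `u P + v Q` into `v ((f + c) P + Q)`, the prolonged field up to a
    -- nonzero factor; the remainder is vertical.
    have h2 : fderiv ℝ H x (Y x) = v x • ((f x + c) • inclL n (P (φ (initL n x))) +
        inclL n (Q (φ (initL n x)))) + fderiv ℝ f x (Y x) • lastVec n := by
      simp only [H, hd, add_apply, ContinuousLinearMap.comp_apply, hWx, hux,
        ContinuousLinearMap.smulRight_apply, map_add, map_smul]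
      module
    rw [hDx]
    ext w
    rw [Submodule.mem_map, mem_frameSpan_two]
    simp only [hinit, hlast]
    constructor
    · rintro ⟨_, hz, rfl⟩
      obtain ⟨a, b, rfl⟩ := mem_frameSpan_two.1 hz
      refine ⟨a * fderiv ℝ f x (lastVec n) + b * fderiv ℝ f x (Y x), b * v x, ?_⟩
      change _ = fderiv ℝ H x (a • lastVec n + b • Y x)
      rw [map_add, map_smul, map_smul, h1, h2]
      module
    · rintro ⟨a, b, rfl⟩
      refine ⟨((a - b / v x * fderiv ℝ f x (Y x)) / fderiv ℝ f x (lastVec n)) • lastVec n +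
        (b / v x) • Y x, mem_frameSpan_two.2 ⟨_, _, rfl⟩, ?_⟩
      change fderiv ℝ H x _ = _
      rw [map_add, map_smul, map_smul, h1, h2, smul_smul, div_mul_cancel₀ _ hfex, smul_add,
        smul_smul, div_mul_cancel₀ _ hvx]
      module
  obtain ⟨ψ, hψ0, hψs, hψH, hψ, hψ'⟩ := hH.exists_openPartialHomeomorph (f' := L)
    (by rw [hL]; exact hasFDerivAt_prolongedMap hφs.differentiableAt hf.differentiableAt) hgood
  refine ⟨ψ, hψ0, ?_, isLocalEquiv_of_contDiffOn hψ hψ' fun x hx => ?_⟩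
  · rw [hψH]
    simp [H, hφ0, hf0]
  · rw [hψH]
    exact hψs hx

theorem fderiv_comp_initL_lastVec {F : Type*} [NormedAddCommGroup F] [NormedSpace ℝ F]
    {g : RSpace n → F} {x : RSpace (n + 1)} (hg : DifferentiableAt ℝ g (initL n x)) :
    fderiv ℝ (fun y => g (initL n y)) x (lastVec n) = 0 := by
  have h := (hg.hasFDerivAt.comp x (initL n).hasFDerivAt).fderiv
  change fderiv ℝ (fun y => g (initL n y)) x = _ at h
  rw [h, ContinuousLinearMap.comp_apply, initL_lastVec, map_zero]

/-- Independence survives prolongation because the new second field projects to a combination of the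
old pair with one coefficient equal to `1`. Smoothness and independence together allow smooth
coefficients with respect to the pair. -/
theorem IsKumperaRuiz.contDiff {κ : FieldPair n} (h : IsKumperaRuiz n κ) :
    ContDiff ℝ ∞ κ.1 ∧ ContDiff ℝ ∞ κ.2 ∧ ∀ x, LinearIndependent ℝ ![κ.1 x, κ.2 x] := by
  have hind : ∀ {n : ℕ} {κ : FieldPair n} (x : RSpace (n + 1)) (a b : ℝ),
      (∀ x, LinearIndependent ℝ ![κ.1 x, κ.2 x]) → a ≠ 0 ∨ b ≠ 0 →
      LinearIndependent ℝ ![lastVec n, a • liftField κ.1 x + b • liftField κ.2 x] := by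
    intro n κ x a b hκ hab
    rw [LinearIndependent.pair_iff]
    intro s t hst
    have h1 : (t * a) • κ.1 (initL n x) + (t * b) • κ.2 (initL n x) = 0 := by
      have := congrArg (initL n) hst
      simpa [liftField_apply, smul_smul] using this
    obtain ⟨h2, h3⟩ := LinearIndependent.pair_iff.1 (hκ (initL n x)) _ _ h1
    have ht : t = 0 := by
      rcases hab with h | h
      exacts [(mul_eq_zero.1 h2).resolve_right h, (mul_eq_zero.1 h3).resolve_right h]
    have := congrArg (lastL n) hst
    refine ⟨by simpa [ht] using this, ht⟩
  have hlift : ∀ {n : ℕ} {f : RSpace n → RSpace n}, ContDiff ℝ ∞ f → ContDiff ℝ ∞ (liftField f) :=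
    fun hf => (inclL _).contDiff.comp (hf.comp (initL _).contDiff)
  induction h with
  | base =>
    refine ⟨contDiff_const, ?_, fun x => ?_⟩
    · rw [contDiff_euclidean]
      intro i
      fin_cases i
      exacts [contDiff_const, (EuclideanSpace.proj (2 : Fin 3)).contDiff (𝕜 := ℝ), contDiff_const]
    · rw [LinearIndependent.pair_iff]
      intro s t hst
      have h0 := congrArg (fun v : RSpace 3 => v 0) hst
      have h2 := congrArg (fun v : RSpace 3 => v 2) hst
      simp [pfaffDarboux] at h0 h2
      exact ⟨h2, h0⟩
  | @regular n κ c _ ih =>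
    refine ⟨contDiff_const, (((lastL n).contDiff.add contDiff_const).smul (hlift ih.1)).add
      (hlift ih.2.1), fun x => ?_⟩
    have := hind x (lastL n x + c) 1 ih.2.2 (Or.inr one_ne_zero)
    rw [one_smul] at this
    exact this
  | @singular n κ _ ih =>
    refine ⟨contDiff_const, (hlift ih.1).add ((lastL n).contDiff.smul (hlift ih.2.1)), fun x => ?_⟩
    have := hind x 1 (lastL n x) ih.2.2 (Or.inl one_ne_zero)
    rw [one_smul] at this
    exact this

theorem spanDistribution_eq_frameSpan (κ : FieldPair n) (x : RSpace n) :
    spanDistribution κ x = frameSpan ![κ.1, κ.2] x := by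
  rw [frameSpan, eval_two, Matrix.range_cons_cons_empty]
  rfl

theorem IsLocalEquiv.congr {D D₁ D₂ : RSpace n → Submodule ℝ (RSpace n)}
    {φ : OpenPartialHomeomorph (RSpace n) (RSpace n)}
    (h : IsLocalEquiv (M := RSpace n) (M' := RSpace n) φ D D₁) (h' : ∀ x, D₁ x = D₂ x) :
    IsLocalEquiv (M := RSpace n) (M' := RSpace n) φ D D₂ :=
  ⟨h.contMDiffOn, h.contMDiffOn_symm, fun x hx => (h.map_eq x hx).trans (h' _)⟩

/-- The prolongation step. -/
theorem exists_isKumperaRuiz_succ {D : RSpace (n + 1) → Submodule ℝ (RSpace (n + 1))}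
    {Y : RSpace (n + 1) → RSpace (n + 1)} {D' : RSpace n → Submodule ℝ (RSpace n)}
    {κ : FieldPair n} {φ : OpenPartialHomeomorph (RSpace n) (RSpace n)} (hκ : IsKumperaRuiz n κ)
    (hY : SmoothGerm Y 0) (hDY : ∀ᶠ x in 𝓝 0, D x = frameSpan ![fun _ => lastVec n, Y] x)
    (hYD : ∀ᶠ x in 𝓝 0, initL n (Y x) ∈ D' (initL n x))
    (hli : LinearIndependent ℝ ![initL n (Y 0), initL n (fderiv ℝ Y 0 (lastVec n))])
    (h0 : (0 : RSpace n) ∈ φ.source) (hφ0 : φ 0 = 0)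
    (hφ : IsLocalEquiv (M := RSpace n) (M' := RSpace n) φ D' (spanDistribution κ)) :
    ∃ (κ' : FieldPair (n + 1)) (ψ : OpenPartialHomeomorph (RSpace (n + 1)) (RSpace (n + 1))),
      IsKumperaRuiz (n + 1) κ' ∧ 0 ∈ ψ.source ∧ ψ 0 = 0 ∧
      IsLocalEquiv (M := RSpace (n + 1)) (M' := RSpace (n + 1)) ψ D (spanDistribution κ') := by
  obtain ⟨hκ1, hκ2, hκli⟩ := hκ.contDiff
  have hsφ : ContDiffOn ℝ ∞ φ φ.source := contMDiffOn_iff_contDiffOn.1 hφ.contMDiffOn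
  have hsφ' : ContDiffOn ℝ ∞ φ.symm φ.target := contMDiffOn_iff_contDiffOn.1 hφ.contMDiffOn_symm
  have hgφ : SmoothGerm φ (initL n 0) := by
    rw [map_zero]
    filter_upwards [φ.open_source.mem_nhds h0] with x hx
    exact hsφ.contDiffAt (φ.open_source.mem_nhds hx)
  have hφi : SmoothGerm (fun x => φ (initL n x)) 0 := hgφ.comp (SmoothGerm.clm (initL n))
  let W : RSpace (n + 1) → RSpace n := fun x => fderiv ℝ φ (initL n x) (initL n (Y x))
  have hW : SmoothGerm W 0 :=
    (hgφ.fderiv.comp (SmoothGerm.clm (initL n))).clm_apply (hY.clm_comp (initL n))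
  let K₁ : RSpace (n + 1) → RSpace n := fun x => κ.1 (φ (initL n x))
  let K₂ : RSpace (n + 1) → RSpace n := fun x => κ.2 (φ (initL n x))
  have hK₁ : SmoothGerm K₁ 0 := (SmoothGerm.of_contDiff hκ1).comp hφi
  have hK₂ : SmoothGerm K₂ 0 := (SmoothGerm.of_contDiff hκ2).comp hφi
  obtain ⟨a, ha, hWa⟩ := hW.exists_coeff (X := ![K₁, K₂]) (fun i => by
      fin_cases i
      exacts [hK₁, hK₂])
    (by
      have : (fun i => (![K₁, K₂] : Fin 2 → RSpace (n + 1) → RSpace n) i 0) = ![K₁ 0, K₂ 0] := by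
        ext1 i; fin_cases i <;> rfl
      rw [this]
      exact hκli _)
    (by
      filter_upwards [hYD, (initL n).continuous.continuousAt.eventually
        ((map_zero (initL n)).symm ▸ φ.open_source.mem_nhds h0)] with x hx hxs
      have h1 := hφ.map_eq (initL n x) hxs
      rw [mfderiv_eq_fderiv, spanDistribution_eq_frameSpan] at h1
      have h2 : W x ∈ frameSpan ![κ.1, κ.2] (φ (initL n x)) := by
        rw [← h1]
        exact ⟨_, hx, rfl⟩
      obtain ⟨s, t, hst⟩ := mem_frameSpan_two.1 h2
      rw [← hst]
      exact Submodule.add_mem _ (Submodule.smul_mem _ _ (Submodule.subset_span ⟨0, rfl⟩))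
        (Submodule.smul_mem _ _ (Submodule.subset_span ⟨1, rfl⟩)))
  have hWa' : W =ᶠ[𝓝 0] fun x => a 0 x • K₁ x + a 1 x • K₂ x := by
    filter_upwards [hWa] with x hx
    rw [hx, Fin.sum_univ_two]
    rfl
  -- `κ` and `φ` are evaluated at the projected point, so differentiating along the last coordinate
  -- affects only `Y` on one side and the coefficients on the other.
  have hWe : fderiv ℝ φ (initL n 0) (initL n (fderiv ℝ Y 0 (lastVec n))) =
      fderiv ℝ (a 0) 0 (lastVec n) • K₁ 0 + fderiv ℝ (a 1) 0 (lastVec n) • K₂ 0 := by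
    have h1 := DFunLike.congr_fun (hWa'.fderiv_eq (𝕜 := ℝ)) (lastVec n)
    have hc : SmoothGerm (fun x => fderiv ℝ φ (initL n x)) 0 :=
      hgφ.fderiv.comp (SmoothGerm.clm (initL n))
    have hK₁e : fderiv ℝ K₁ 0 (lastVec n) = 0 := fderiv_comp_initL_lastVec (g := κ.1 ∘ φ)
      ((SmoothGerm.of_contDiff hκ1).comp hgφ).differentiableAt
    have hK₂e : fderiv ℝ K₂ 0 (lastVec n) = 0 := fderiv_comp_initL_lastVec (g := κ.2 ∘ φ)
      ((SmoothGerm.of_contDiff hκ2).comp hgφ).differentiableAt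
    rw [fderiv_clm_apply hc.differentiableAt (hY.clm_comp (initL n)).differentiableAt,
      fderiv_fun_add ((ha 0).smul hK₁).differentiableAt ((ha 1).smul hK₂).differentiableAt,
      fderiv_fun_smul (ha 0).differentiableAt hK₁.differentiableAt,
      fderiv_fun_smul (ha 1).differentiableAt hK₂.differentiableAt] at h1
    simpa [fderiv_comp_initL_lastVec hgφ.fderiv.differentiableAt, hK₁e, hK₂e,
      fderiv_initL_comp hY.differentiableAt] using h1
  have hdet := det_ne_zero_of_linearIndependent_pair (K₁ := K₁ 0) (K₂ := K₂ 0) (a := a 0 0)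
    (b := a 1 0) (a' := fderiv ℝ (a 0) 0 (lastVec n)) (b' := fderiv ℝ (a 1) 0 (lastVec n)) (by
      have e : W 0 = a 0 0 • K₁ 0 + a 1 0 • K₂ 0 := hWa'.self_of_nhds
      rw [← hWe, ← e, map_zero]
      have h1 := hli.map_injOn (fderiv ℝ φ 0).toLinearMap
        (Function.LeftInverse.injective
          (OpenPartialHomeomorph.fderiv_symm_apply_fderiv hsφ hsφ' h0)).injOn
      convert h1 using 1
      ext1 i
      fin_cases i
      · change fderiv ℝ φ (initL n 0) _ = _
        rw [map_zero]
        rfl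
      · rfl)
  -- If the `κ₂`-coefficient vanishes at `0`, the ratio `a 1 / a 0` is the new coordinate, with
  -- constant `0`, and the prolongation is singular. Otherwise `a 0 / a 1` is used and its value at
  -- `0` is the parameter of the regular prolongation.
  by_cases hb : a 1 0 = 0
  · have hne : a 0 0 ≠ 0 := fun h => hdet (by rw [h, hb]; ring)
    obtain ⟨ψ, hψ0, hψ00, hψ⟩ := exists_isLocalEquiv_prolongation (P := κ.2) (Q := κ.1) hDY h0 hφ0
      hsφ hsφ' (ha 1) (ha 0) (by filter_upwards [hWa'] with x hx using hx.trans (add_comm _ _))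
      hne (fun h => hdet (by linarith))
    refine ⟨_, ψ, hκ.singular, hψ0, hψ00, ?_⟩
    rw [hb, zero_div] at hψ
    refine hψ.congr fun x => ?_
    rw [spanDistribution_eq_frameSpan]
    simp only [add_zero, add_comm (_ • _)]
    rfl
  · obtain ⟨ψ, hψ0, hψ00, hψ⟩ := exists_isLocalEquiv_prolongation (P := κ.1) (Q := κ.2) hDY h0 hφ0
      hsφ hsφ' (ha 0) (ha 1) hWa' hb hdet
    refine ⟨_, ψ, hκ.regular (a 0 0 / a 1 0), hψ0, hψ00, ?_⟩
    refine hψ.congr fun x => ?_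
    rw [spanDistribution_eq_frameSpan]
    rfl

end Prolongation
end

noncomputable section

/-! ### The case of `ℝ³` and the induction on the dimension -/

section NormalForm

/-- This is a prolongation of the constant pair on the plane. The linear map `A` sends the
projections of `Y` and of its last derivative at `0` to the standard basis, so `w 0 = 1` and `w 1 =
0` at `0`, with derivatives `0` and `1`. The ratio `w 1 / w 0` then needs no constant and the
determinant is `-1`. -/
theorem exists_pfaffDarboux {D : RSpace 3 → Submodule ℝ (RSpace 3)} {Y : RSpace 3 → RSpace 3}
    (hY : SmoothGerm Y 0) (hDY : ∀ᶠ x in 𝓝 0, D x = frameSpan ![fun _ => lastVec 2, Y] x)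
    (hli : LinearIndependent ℝ ![initL 2 (Y 0), initL 2 (fderiv ℝ Y 0 (lastVec 2))]) :
    ∃ ψ : OpenPartialHomeomorph (RSpace 3) (RSpace 3), 0 ∈ ψ.source ∧ ψ 0 = 0 ∧
      IsLocalEquiv (M := RSpace 3) (M' := RSpace 3) ψ D (spanDistribution pfaffDarboux) := by
  let b := basisOfLinearIndependentOfCardEqFinrank hli (by simp)
  let A : RSpace 2 ≃L[ℝ] RSpace 2 :=
    (b.equiv (EuclideanSpace.basisFun (Fin 2) ℝ).toBasis (Equiv.refl _)).toContinuousLinearEquiv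
  have hA : ∀ i, A (b i) = EuclideanSpace.single i 1 := fun i => by simp [A]
  have hA0 : A (initL 2 (Y 0)) = EuclideanSpace.single 0 1 := by
    rw [← hA 0, coe_basisOfLinearIndependentOfCardEqFinrank]; rfl
  have hA1 : A (initL 2 (fderiv ℝ Y 0 (lastVec 2))) = EuclideanSpace.single 1 1 := by
    rw [← hA 1, coe_basisOfLinearIndependentOfCardEqFinrank]; rfl
  let w : Fin 2 → RSpace 3 → ℝ := fun i x => A (initL 2 (Y x)) i
  let B : Fin 2 → RSpace 3 →L[ℝ] ℝ := fun i =>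
    (EuclideanSpace.proj i).comp ((A : RSpace 2 →L[ℝ] RSpace 2).comp (initL 2))
  have hw : ∀ i, SmoothGerm (w i) 0 := fun i => hY.clm_comp (B i)
  have hdw : ∀ i, fderiv ℝ (w i) 0 (lastVec 2) = (EuclideanSpace.single 1 1 : RSpace 2) i := by
    intro i
    have h := ((B i).hasFDerivAt.comp (0 : RSpace 3) hY.differentiableAt.hasFDerivAt).fderiv
    change fderiv ℝ (w i) 0 = _ at h
    rw [h, ← hA1]
    rfl
  have hw0 : ∀ i, w i 0 = (EuclideanSpace.single 0 1 : RSpace 2) i := fun i =>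
    congrArg (fun z : RSpace 2 => z i) hA0
  obtain ⟨ψ, hψ0, hψ00, hψ⟩ := exists_isLocalEquiv_prolongation
    (φ := A.toHomeomorph.toOpenPartialHomeomorph) (P := fun _ => EuclideanSpace.single 1 1)
    (Q := fun _ => EuclideanSpace.single 0 1) hDY trivial (map_zero A) A.contDiff.contDiffOn
    A.symm.contDiff.contDiffOn (hw 1) (hw 0)
    (Filter.Eventually.of_forall fun x => by
      change fderiv ℝ A _ _ = _
      rw [A.fderiv]
      change A (initL 2 (Y x)) = _
      ext i
      fin_cases i <;> simp [w])
    (by rw [hw0]; simp) (by rw [hw0, hw0, hdw, hdw]; simp)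
  rw [hw0, hw0] at hψ
  refine ⟨ψ, hψ0, hψ00, hψ.congr fun x => ?_⟩
  rw [spanDistribution_eq_frameSpan, frameSpan, frameSpan, eval_two, eval_two]
  congr 3
  · ext i
    fin_cases i <;> simp [pfaffDarboux, lastVec]
  · congr 1
    ext i
    refine Fin.lastCases ?_ (fun j => ?_) i
    · simp only [PiLp.add_apply, PiLp.smul_apply, inclL_last]
      simp [pfaffDarboux]
    · simp only [PiLp.add_apply, PiLp.smul_apply, inclL_castSucc]
      fin_cases j
      · simp [pfaffDarboux]
      · simp [pfaffDarboux, lastL]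

/-- Each step straightens, descends, applies the induction hypothesis to the quotient and prolongs.
On `ℝ³` only the independence statement of `GoursatNear.exists_quotient` is kept, since any plane
field on `ℝ²` is the whole tangent space. -/
theorem GoursatNear.exists_isKumperaRuiz {n : ℕ} (hn : 3 ≤ n)
    {D : RSpace n → Submodule ℝ (RSpace n)}
    (hD : GoursatNear D 0) :
    ∃ (κ : FieldPair n) (ψ : OpenPartialHomeomorph (RSpace n) (RSpace n)), IsKumperaRuiz n κ ∧
      0 ∈ ψ.source ∧ ψ 0 = 0 ∧
      IsLocalEquiv (M := RSpace n) (M' := RSpace n) ψ D (spanDistribution κ) := by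
  induction n, hn using Nat.le_induction with
  | base =>
    obtain ⟨D₁, φ, Y, h0, hφ0, hφ, hD₁, hY, hDY, hli, hchar⟩ := hD.exists_straightening le_rfl
    obtain ⟨-, -, -, hli'⟩ := hD₁.exists_quotient le_rfl hY hDY hli hchar
    obtain ⟨ψ, hψ0, hψ00, hψ⟩ := exists_pfaffDarboux hY hDY hli'
    exact ⟨_, φ.trans ψ, .base, ⟨h0, by simpa [hφ0] using hψ0⟩, by simp [hφ0, hψ00], hφ.trans hψ⟩
  | succ n hn ih =>
    obtain ⟨D₁, φ, Y, h0, hφ0, hφ, hD₁, hY, hDY, hli, hchar⟩ :=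
      hD.exists_straightening (by omega)
    obtain ⟨D', hD', hYD, hli'⟩ := hD₁.exists_quotient (by omega) hY hDY hli hchar
    obtain ⟨κ, χ, hκ, hχ0, hχ00, hχ⟩ := ih hD'
    obtain ⟨κ', ψ, hκ', hψ0, hψ00, hψ⟩ :=
      exists_isKumperaRuiz_succ hκ hY hDY hYD hli' hχ0 hχ00 hχ
    exact ⟨κ', φ.trans ψ, hκ', ⟨h0, by simpa [hφ0] using hψ0⟩, by simp [hφ0, hψ00],
      hφ.trans hψ⟩

end NormalForm
end

theorem mainTheorem6 (n : ℕ) (hn : 3 ≤ n)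
    {M : Type*} [TopologicalSpace M] [ChartedSpace (RSpace n) M] [IsManifold (𝓡 n) ∞ M]
    (D : Π x : M, Submodule ℝ (TangentSpace (𝓡 n) x)) (hD : IsGoursat D) (p : M) :
    ∃ κ : FieldPair n, IsKumperaRuiz n κ ∧
      LocallyEquivalent D p (spanDistribution κ) (0 : RSpace n) := by
  obtain ⟨D', φ, hp, hφp, hφ, hD'⟩ := exists_goursatNear hD p
  obtain ⟨κ, ψ, hκ, hψ0, hψ00, hψ⟩ := hD'.exists_isKumperaRuiz hn
  have h := hφ.trans hψ
  exact ⟨κ, hκ, φ.trans ψ, ⟨hp, by simpa [hφp] using hψ0⟩, by simp [hφp, hψ00], h.contMDiffOn,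
    h.contMDiffOn_symm, h.map_eq⟩
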